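/- Let $\mathsf N\ge 0$ be an integer, let $\eta\in\mathbb C\setminus\{0\}$, and let $\mathsf k_2,\mathsf k_3\in\mathbb C\setminus\{0\}$ with $\mathsf k_2\ne \mathsf k_3$. Let $K_2$ be a $2\times 2$ complex matrix, diagonalizable with eigenvalues $\mathsf k_2,\mathsf k_3$, and let $\hat K=\begin{pmatrix}0&0\\0&K_2\end{pmatrix}$ act on the superspace $V=\mathbb C^{1|2}$ with basis $v_1$ (even), $v_2,v_3$ (odd). For $\xi=(\xi_1,\dots,\xi_{\mathsf N})\in\mathbb C^{\mathsf N}$ define on $V_1\otimes\dots\otimes V_{\mathsf N}$, with $V_j\simeq V$, the transfer matrix of the fundamental $gl_{1|2}$ model $$T_1^{(\hat K)}(\lambda)=\operatorname{str}_{0}\,\hat K_0R_{0\mathsf N}(\lambda-\xi_{\mathsf N})\cdots R_{01}(\lambda-\xi_1),\qquad R_{0n}(\lambda)=\lambda\,\mathbb I+\eta\,\mathbb P_{0n},$$ where $V_0\simeq V$ is an auxiliary space placed first in the tensor product, $\mathbb P_{0n}$ is the graded permutation of $V_0$ and $V_n$ and $\operatorname{str}_0$ is the supertrace over $V_0$.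 An entire function $t_1$ is called an eigenvalue of $T_1^{(\hat K)}$ if there is a vector $v\neq0$, independent of $\lambda$, with $T_1^{(\hat K)}(\lambda)v=t_1(\lambda)v$ for all $\lambda\in\mathbb C$. Put $d(\lambda)=\prod_{n=1}^{\mathsf N}(\lambda-\xi_n)$. A Bethe Ansatz solution is a pair of finite sets of complex numbers $\{\lambda_1,\dots,\lambda_L\}$, $\{\mu_1,\dots,\mu_M\}$ ($L,M\ge0$ arbitrary), where $\lambda_1,\dots,\lambda_L,\mu_1,\dots,\mu_M$ are pairwise distinct, such that, with $Q_1(\lambda)=\prod_{l=1}^L(\lambda-\lambda_l)$ and $Q_2(\lambda)=\prod_{m=1}^M(\lambda-\mu_m)$, the nested Bethe equations with $\mathsf k_1=0$ hold: $$0=\mathsf k_2\,d(\lambda_j)\,Q_2(\lambda_j+\eta)\quad(1\le j\le L),$$ $$\mathsf k_2\,Q_2(\mu_h+\eta)\,Q_1(\mu_h-\eta)=-\mathsf k_3\,Q_2(\mu_h-\eta)\,Q_1(\mu_h)\quad(1\le h\le M).$$ An entire function $t_1$ has the Bethe Ansatz form associated to this solution if $$t_1(\lambda)=-d(\lambda)\left(\mathsf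 k_2\frac{Q_1(\lambda-\eta)\,Q_2(\lambda+\eta)}{Q_1(\lambda)\,Q_2(\lambda)}+\mathsf k_3\frac{Q_2(\lambda-\eta)}{Q_2(\lambda)}\right)$$ for all $\lambda$ with $Q_1(\lambda)Q_2(\lambda)\ne0$. Then for almost all values of the inhomogeneities, i.e. for all $\xi\in\mathbb C^{\mathsf N}$ outside the zero set of some nonzero polynomial (which may depend on $\mathsf N,\eta,K_2$ and the ordered pair $(\mathsf k_2,\mathsf k_3)$), the following holds for every entire function $t_1$. The function $t_1$ is an eigenvalue of $T_1^{(\hat K)}$ if and only if it has the Bethe Ansatz form associated to some Bethe Ansatz solution. Moreover, for every eigenvalue $t_1$ the associated Bethe Ansatz solution is unique and satisfies the admissibility conditions $$\{\lambda_j\}_{j\le L}\subset\{\xi_n\}_{n\le\mathsf N},\qquad \{\mu_h\}_{h\le M}\cap\big(\{\xi_n\}_{n\le\mathsf N}\cup\{\xi_n+\eta\}_{n\le\mathsf N}\big)=\emptyset .$$ -/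

import Mathlib

open scoped BigOperators

noncomputable section

namespace GL12

/-! The superspace `ℂ^{1|2}` has basis `v 0` (even), `v 1`, `v 2` (odd).  The tensor product of `n`
copies has the basis `v (s 0) ⊗ ⋯ ⊗ v (s (n-1))`, indexed by `s : Fin n → Fin 3`.  An operator `A` on
it is the matrix with `A v_t = ∑ s, A s t • v_s`, so the matrix product is composition. -/

/-- Parity of the basis vectors of `ℂ^{1|2}`. -/
def parity : Fin 3 → ℕ := ![0, 1, 1]

/-- Operators on the `n`-fold tensor product of `ℂ^{1|2}`. -/
abbrev Op (n : ℕ) := Matrix (Fin n → Fin 3) (Fin n → Fin 3) ℂ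

/-- `1 ⊗ ⋯ ⊗ e ⊗ ⋯ ⊗ 1`, where the elementary operator `e v_k = δ_{jk} v_i`, of parity
`parity i + parity j`, stands at site `a`.  By the sign rule
`(x ⊗ y)(v ⊗ w) = (-1)^(|y||v|) x v ⊗ y w` it picks up a sign when it passes the vectors at the
sites before `a`. -/
def siteE {n : ℕ} (a : Fin n) (i j : Fin 3) : Op n :=
  Matrix.of fun s t =>
    if t a = j ∧ s = Function.update t a i then
      (-1 : ℂ) ^ ((parity i + parity j) * ∑ c ∈ Finset.univ.filter (fun c => c < a), parity (t c))
    else 0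

/-- The operator acting as the `3 × 3` matrix `K` at site `a` and trivially elsewhere. -/
def siteOp {n : ℕ} (a : Fin n) (K : Matrix (Fin 3) (Fin 3) ℂ) : Op n :=
  ∑ i, ∑ j, K i j • siteE a i j

/-- The graded permutation operator of the sites `a < b`. -/
def gradedPerm {n : ℕ} (a b : Fin n) : Op n :=
  ∑ α, ∑ β, ((-1 : ℂ) ^ parity β) • (siteE a α β * siteE b β α)

/-- The rational `R`-matrix `R_{ab}(x) = x + η P_{ab}`. -/
def rMatrix {n : ℕ} (η : ℂ) (a b : Fin n) (x : ℂ) : Op n :=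
  x • (1 : Op n) + η • gradedPerm a b

/-- The monodromy `K_0 R_{0N}(x - ξ_N) ⋯ R_{01}(x - ξ_1)`.  Site `0` is the auxiliary space, and the
sites `1, …, N` are the quantum spaces. -/
def monodromy {N : ℕ} (η : ℂ) (K : Matrix (Fin 3) (Fin 3) ℂ) (ξ : Fin N → ℂ) (x : ℂ) : Op (N + 1) :=
  siteOp 0 K * (List.ofFn fun n : Fin N => rMatrix η 0 n.succ (x - ξ n)).reverse.prod

/-- The supertrace over the auxiliary site `0` of an even operator: if `A = ∑ e ⊗ A_{ij}`, where `e`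
is the elementary operator `v_j ↦ v_i`, this is `∑ j, (-1)^(parity j) A_{jj}`. -/
def strAux {N : ℕ} (A : Op (N + 1)) : Op N :=
  Matrix.of fun s t => ∑ j : Fin 3, (-1 : ℂ) ^ parity j * A (Fin.cons j s) (Fin.cons j t)

/-- The transfer matrix `T_1^{(K)}(x)`. -/
def transfer {N : ℕ} (η : ℂ) (K : Matrix (Fin 3) (Fin 3) ℂ) (ξ : Fin N → ℂ) (x : ℂ) : Op N :=
  strAux (monodromy η K ξ x)

/-- The even block twist with even block `k₁` and odd block `K₂`. -/
def twist (k₁ : ℂ) (K₂ : Matrix (Fin 2) (Fin 2) ℂ) : Matrix (Fin 3) (Fin 3) ℂ :=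
  !![k₁, 0, 0; 0, K₂ 0 0, K₂ 0 1; 0, K₂ 1 0, K₂ 1 1]

/-- `t` is an eigenvalue of the commuting family `T_1^{(K)}(x)`: there is a nonzero vector, not
depending on `x`, with `T_1^{(K)}(x) v = t(x) v` for every `x`. -/
def IsTransferEigenvalue {N : ℕ} (η : ℂ) (K : Matrix (Fin 3) (Fin 3) ℂ) (ξ : Fin N → ℂ)
    (t : ℂ → ℂ) : Prop :=
  ∃ v : (Fin N → Fin 3) → ℂ, v ≠ 0 ∧ ∀ x : ℂ, (transfer η K ξ x).mulVec v = t x • v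

/-- `d(x) = ∏ (x - ξ_n)`. -/
def dFun {N : ℕ} (ξ : Fin N → ℂ) (x : ℂ) : ℂ := ∏ n, (x - ξ n)

/-- `a(x) = d(x + η)`. -/
def aFun {N : ℕ} (η : ℂ) (ξ : Fin N → ℂ) (x : ℂ) : ℂ := dFun ξ (x + η)

/-- The monic polynomial function with simple zeros at the points of `s`. -/
def qFun (s : Finset ℂ) (x : ℂ) : ℂ := ∏ r ∈ s, (x - r)

/-- `(Λ, Μ)` solves the nested Bethe equations.  The Bethe roots are pairwise distinct: the `λ_j`
(the points of `Λ`) among themselves, the `μ_h` (the points of `Μ`) among themselves, and the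
`λ_j` from the `μ_h`. -/
structure IsBetheSolution {N : ℕ} (η k₁ k₂ k₃ : ℂ) (ξ : Fin N → ℂ) (Λ Μ : Finset ℂ) : Prop where
  disjoint : Disjoint Λ Μ
  eq_one : ∀ l ∈ Λ, k₁ * qFun Μ l * aFun η ξ l = k₂ * dFun ξ l * qFun Μ (l + η)
  eq_two : ∀ m ∈ Μ, k₂ * qFun Μ (m + η) * qFun Λ (m - η) = -k₃ * qFun Μ (m - η) * qFun Λ m

/-- `t` coincides with the Bethe Ansatz expression attached to `(Λ, Μ)` wherever the denominators
of that expression do not vanish. -/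
def HasBetheForm {N : ℕ} (η k₁ k₂ k₃ : ℂ) (ξ : Fin N → ℂ) (Λ Μ : Finset ℂ) (t : ℂ → ℂ) : Prop :=
  ∀ x : ℂ, qFun Λ x ≠ 0 → qFun Μ x ≠ 0 →
    t x = k₁ * aFun η ξ x * (qFun Λ (x - η) / qFun Λ x)
      - dFun ξ x * (k₂ * ((qFun Λ (x - η) * qFun Μ (x + η)) / (qFun Λ x * qFun Μ x))
        + k₃ * (qFun Μ (x - η) / qFun Μ x))

/-- The `λ_j` are among the inhomogeneities, and the `μ_h` avoid every `ξ_n` and `ξ_n + η`. -/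
def IsAdmissible {N : ℕ} (η : ℂ) (ξ : Fin N → ℂ) (Λ Μ : Finset ℂ) : Prop :=
  (Λ : Set ℂ) ⊆ Set.range ξ ∧
    (Μ : Set ℂ) ∩ (Set.range ξ ∪ Set.range fun n => ξ n + η) = ∅

end GL12

end

/-! Because the even entry of the twist vanishes, only odd auxiliary states contribute to the
supertrace, and the transfer matrix is block triangular with respect to the set of even sites. If
`A` is the set of odd sites, the diagonal block is `-d_{Aᶜ}(x)` times the transfer matrix of a
twisted `gl_2` chain on `A` with `R`-matrix `x - η P`. The fusion relation of that chain shows that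
every eigenvalue is `t₁ = -d_{Aᶜ} Λ`, where `Λ` is a polynomial of degree at most `|A|`, with
coefficient `k₂ + k₃` in degree `|A|`, and `Λ(ξ_n) Λ(ξ_n + η) = k₂ k₃ d_A(ξ_n + η) d_A(ξ_n - η)` for
`n ∈ A` (`IsFusionSolution`, `IsTransferEigenvalue.exists_fusionSolution`).

That all such `Λ` occur follows by counting. Separation of variables turns the fusion solutions on
`A` into independent vectors in a space of dimension `2 ^ |A|` (`card_fusionSolution_le`), so there
are at most `∑ 2 ^ |A| = 3 ^ N` pairs `(A, Λ)`. For generic `ξ` the transfer matrix has `3 ^ N`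
distinct eigenvalues, since its suitably rescaled values at the inhomogeneities decouple when the
sites move apart (`exists_polynomial_isTransferEigenvalue`).

On the Bethe side, `k₁ = 0` together with disjointness of the roots forces every `λ_j` to be an
inhomogeneity, so `Q₁ = d_A` for some `A`. The Bethe form then reads `-d_{Aᶜ} Λ`, where `Λ` and `Q₂`
satisfy Baxter's equation on `A`. A fusion solution admits a polynomial `Q`, by linear algebra
(`IsFusionSolution.exists_baxterPair`), and a discrete Wronskian with `k₂ ≠ k₃` makes it unique up
to a scalar (`IsBaxterPair.exists_eq_C_mul`).

It remains to see that generically `Q` has simple roots away from all `ξ_n` and `ξ_n + η`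
(`exists_polynomial_roots_simple`). For widely separated sites the inverse function theorem gives a
Bethe solution for each subset of `A`, and by the count these are all the solutions
(`eventually_roots_simple`). The bad configurations form an algebraic family with empty fibres over
a Zariski dense set of `ξ`, and elimination makes the fibres empty outside a hypersurface
(`exists_forall_fibre_empty`). -/

/-! ### Elimination: generic emptiness of the fibres of an algebraic family -/

open Topology in
/-- A constructible set is a neighbourhood of each point lying in every nonempty open set which it
contains, and its complement is a neighbourhood of each such point which it does not contain. -/
theorem IsConstructible.mem_nhds_of_generic {X : Type*} [TopologicalSpace X] {η : X}
    (hη : ∀ U : Set X, IsOpen U → U.Nonempty → η ∈ U) {s : Set X} (hs : IsConstructible s) :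
    (η ∈ s → s ∈ nhds η) ∧ (η ∉ s → sᶜ ∈ nhds η) := by
  induction hs using IsConstructible.empty_union_induction with
  | open_retrocompact U hU _ =>
    refine ⟨fun h => hU.mem_nhds h, fun h => ?_⟩
    have : U = ∅ := by
      by_contra hne
      exact h (hη U hU (Set.nonempty_iff_ne_empty.mpr hne))
    simp [this]
  | union s hs t ht ihs iht =>
    constructor
    · rintro (h | h)
      · exact Filter.mem_of_superset (ihs.1 h) Set.subset_union_left
      · exact Filter.mem_of_superset (iht.1 h) Set.subset_union_right
    · intro h
      rw [Set.mem_union, not_or] at h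
      rw [Set.compl_union]
      exact Filter.inter_mem (ihs.2 h.1) (iht.2 h.2)
  | compl s hs ih =>
    refine ⟨fun h => ih.2 h, fun h => ?_⟩
    rw [compl_compl]
    exact ih.1 (by simpa using h)

namespace MvPolynomial

/-- If the ideal generated by a family of polynomials in `(x, y)` contains no nonzero polynomial
in `x` alone, then the family has a common zero over every `x` outside a hypersurface. -/
theorem exists_zero_of_comap_eq_bot {σ τ : Type*} [Finite σ] [Finite τ]
    (F : Set (MvPolynomial (σ ⊕ τ) ℂ))
    (hF : ∀ p : MvPolynomial σ ℂ, rename Sum.inl p ∈ Ideal.span F → p = 0) :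
    ∃ f : MvPolynomial σ ℂ, f ≠ 0 ∧ ∀ x : σ → ℂ, eval x f ≠ 0 →
      ∃ y : τ → ℂ, ∀ p ∈ F, eval (Sum.elim x y) p = 0 := by
  let I := Ideal.span F
  let φ : MvPolynomial σ ℂ →ₐ[ℂ] (MvPolynomial (σ ⊕ τ) ℂ ⧸ I) :=
    (Ideal.Quotient.mkₐ ℂ I).comp (rename Sum.inl)
  have hinj : Function.Injective φ.toRingHom := by
    rw [injective_iff_map_eq_zero]
    intro p hp
    exact hF p (Ideal.Quotient.eq_zero_iff_mem.mp hp)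
  have hft : φ.toRingHom.FiniteType := by
    have h1 : (φ.toRingHom.comp (algebraMap ℂ _)).FiniteType := by
      have : φ.toRingHom.comp (algebraMap ℂ _) = algebraMap ℂ (MvPolynomial (σ ⊕ τ) ℂ ⧸ I) :=
        φ.comp_algebraMap
      rw [this]
      exact RingHom.finiteType_algebraMap.mpr inferInstance
    exact RingHom.FiniteType.of_comp_finiteType h1
  have hfp : φ.toRingHom.FinitePresentation := RingHom.FinitePresentation.of_finiteType.mp hft
  have hcons := PrimeSpectrum.isConstructible_range_comap hfp
  let η : PrimeSpectrum (MvPolynomial σ ℂ) := ⟨⊥, Ideal.isPrime_bot⟩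
  have hgen : ∀ U : Set (PrimeSpectrum (MvPolynomial σ ℂ)), IsOpen U → U.Nonempty → η ∈ U := by
    rintro U hU ⟨q, hq⟩
    have hle : η ≤ q := bot_le (a := q.asIdeal)
    exact (PrimeSpectrum.le_iff_specializes η q |>.mp hle).mem_open hU hq
  have hmem : η ∈ Set.range (PrimeSpectrum.comap φ.toRingHom) := by
    -- The zero ideal is a minimal prime of the polynomial ring in `x`, and minimal primes lift
    -- along an injective ring map; so the generic point lies in the constructible image.
    obtain ⟨p, hp, hpc⟩ := Ideal.exists_comap_eq_of_mem_minimalPrimes_of_injective hinj ⊥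
      (by rw [IsDomain.minimalPrimes_eq_singleton_bot]; rfl)
    exact ⟨⟨p, hp⟩, PrimeSpectrum.ext hpc⟩
  have hnhds := (IsConstructible.mem_nhds_of_generic hgen hcons).1 hmem
  obtain ⟨t, ⟨f, rfl⟩, hηt, hts⟩ :=
    (PrimeSpectrum.isTopologicalBasis_basic_opens (R := MvPolynomial σ ℂ)).mem_nhds_iff.mp hnhds
  refine ⟨f, fun h => hηt (by rw [h]; exact Ideal.zero_mem _), fun x hx => ?_⟩
  -- When `f` does not vanish at `x`, the closed point of `x` is in the image. A maximal ideal above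
  -- a prime lying over it is, by the Nullstellensatz, a point whose first coordinates are `x`; the
  -- others are the required zero.
  have hmax : (vanishingIdeal ℂ {x} : Ideal (MvPolynomial σ ℂ)).IsMaximal :=
    isMaximal_iff_eq_vanishingIdeal_singleton.mpr ⟨x, rfl⟩
  obtain ⟨q, hq⟩ := hts (show (⟨_, hmax.isPrime⟩ : PrimeSpectrum (MvPolynomial σ ℂ)) ∈ _ from by
    change f ∉ vanishingIdeal ℂ {x}
    rw [mem_vanishingIdeal_singleton_iff]
    exact hx)
  have hq' : Ideal.comap φ.toRingHom q.asIdeal = vanishingIdeal ℂ {x} :=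
    congrArg PrimeSpectrum.asIdeal hq
  have hprime : (Ideal.comap (Ideal.Quotient.mk I) q.asIdeal).IsPrime := inferInstance
  obtain ⟨n, hn, hqn⟩ := Ideal.exists_le_maximal _ hprime.ne_top
  obtain ⟨v, hv⟩ := isMaximal_iff_eq_vanishingIdeal_singleton.mp hn
  have hvl : ∀ i, v (Sum.inl i) = x i := by
    intro i
    have h1 : (X i - C (x i) : MvPolynomial σ ℂ) ∈ Ideal.comap φ.toRingHom q.asIdeal := by
      rw [hq', mem_vanishingIdeal_singleton_iff]
      simp
    have h2 : (X (Sum.inl i) - C (x i) : MvPolynomial (σ ⊕ τ) ℂ) ∈ n := by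
      apply hqn
      have : φ.toRingHom (X i - C (x i))
          = Ideal.Quotient.mk I (X (Sum.inl i) - C (x i)) := by
        change Ideal.Quotient.mk I (rename Sum.inl (X i - C (x i))) = _
        simp
      rw [Ideal.mem_comap, ← this]
      exact h1
    rw [hv, mem_vanishingIdeal_singleton_iff] at h2
    simpa [sub_eq_zero] using h2
  refine ⟨fun j => v (Sum.inr j), fun p hp => ?_⟩
  have h1 : p ∈ n := by
    apply hqn
    rw [Ideal.mem_comap, Ideal.Quotient.eq_zero_iff_mem.mpr (Ideal.subset_span hp)]
    exact Ideal.zero_mem _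
  rw [hv, mem_vanishingIdeal_singleton_iff] at h1
  have hvv : Sum.elim x (fun j => v (Sum.inr j)) = v := by
    ext (i | j)
    · simp [hvl]
    · simp
  rw [hvv]
  simpa using h1

/-- If the fibres of an algebraic family are empty over a Zariski dense set of parameters, then
they are empty outside a hypersurface. -/
theorem exists_forall_fibre_empty {σ τ : Type*} [Finite σ] [Finite τ]
    (F : Set (MvPolynomial (σ ⊕ τ) ℂ))
    (hF : ∀ f : MvPolynomial σ ℂ, f ≠ 0 →
      ∃ x, eval x f ≠ 0 ∧ ∀ y, ¬ ∀ p ∈ F, eval (Sum.elim x y) p = 0) :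
    ∃ P : MvPolynomial σ ℂ, P ≠ 0 ∧
      ∀ x, eval x P ≠ 0 → ∀ y, ¬ ∀ p ∈ F, eval (Sum.elim x y) p = 0 := by
  -- Either the ideal contains a nonzero polynomial in `x` alone, which serves as `P`, or a generic
  -- fibre is nonempty, against the density assumption.
  by_cases h : ∀ p : MvPolynomial σ ℂ, rename Sum.inl p ∈ Ideal.span F → p = 0
  · obtain ⟨f, hf, hz⟩ := exists_zero_of_comap_eq_bot F h
    obtain ⟨x, hx, hne⟩ := hF f hf
    obtain ⟨y, hy⟩ := hz x hx
    exact absurd hy (hne y)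
  · push Not at h
    obtain ⟨P, hP, hP0⟩ := h
    refine ⟨P, hP0, fun x hx y hy => hx ?_⟩
    have : Ideal.span F ≤ RingHom.ker (eval (Sum.elim x y)) :=
      Ideal.span_le.mpr fun p hp => hy p hp
    have h2 := this hP
    rw [RingHom.mem_ker, eval_rename] at h2
    simpa using h2

/-- Functions given by polynomials. -/
def IsPolyFun {σ : Type*} (f : (σ → ℂ) → ℂ) : Prop := ∃ p : MvPolynomial σ ℂ, ∀ x, f x = eval x p

namespace IsPolyFun

variable {σ : Type*} {f g : (σ → ℂ) → ℂ}

theorem const (c : ℂ) : IsPolyFun (fun _ : σ → ℂ => c) := ⟨C c, by simp⟩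

theorem coord (i : σ) : IsPolyFun (fun x : σ → ℂ => x i) := ⟨X i, by simp⟩

theorem add (hf : IsPolyFun f) (hg : IsPolyFun g) : IsPolyFun (fun x => f x + g x) := by
  obtain ⟨p, hp⟩ := hf
  obtain ⟨q, hq⟩ := hg
  exact ⟨p + q, by simp [hp, hq]⟩

theorem mul (hf : IsPolyFun f) (hg : IsPolyFun g) : IsPolyFun (fun x => f x * g x) := by
  obtain ⟨p, hp⟩ := hf
  obtain ⟨q, hq⟩ := hg
  exact ⟨p * q, by simp [hp, hq]⟩

theorem sub (hf : IsPolyFun f) (hg : IsPolyFun g) : IsPolyFun (fun x => f x - g x) := by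
  obtain ⟨p, hp⟩ := hf
  obtain ⟨q, hq⟩ := hg
  exact ⟨p - q, by simp [hp, hq]⟩

theorem pow (hf : IsPolyFun f) (n : ℕ) : IsPolyFun (fun x => f x ^ n) := by
  obtain ⟨p, hp⟩ := hf
  exact ⟨p ^ n, by simp [hp]⟩

theorem sum {ι : Type*} (s : Finset ι) {f : ι → (σ → ℂ) → ℂ} (hf : ∀ i ∈ s, IsPolyFun (f i)) :
    IsPolyFun (fun x => ∑ i ∈ s, f i x) := by
  classical
  induction s using Finset.induction_on with
  | empty => simpa using const 0
  | insert a s ha ih =>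
    simp only [Finset.sum_insert ha]
    exact (hf a (by simp)).add (ih fun i hi => hf i (by simp [hi]))

theorem prod {ι : Type*} (s : Finset ι) {f : ι → (σ → ℂ) → ℂ} (hf : ∀ i ∈ s, IsPolyFun (f i)) :
    IsPolyFun (fun x => ∏ i ∈ s, f i x) := by
  classical
  induction s using Finset.induction_on with
  | empty => simpa using const 1
  | insert a s ha ih =>
    simp only [Finset.prod_insert ha]
    exact (hf a (by simp)).mul (ih fun i hi => hf i (by simp [hi]))

end IsPolyFun

end MvPolynomial

/-! ### Fusion solutions and Baxter's equation on separated sites -/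

namespace GL12

open Polynomial Lagrange

/-- The inhomogeneities are pairwise distinct and no two of them differ by `η`. -/
structure IsSeparated {ι : Type*} (η : ℂ) (ξ : ι → ℂ) : Prop where
  inj : Function.Injective ξ
  sub_ne : ∀ n m, n ≠ m → ξ n - ξ m ≠ η

/-- The functional characterization of the eigenvalues of the twisted `gl_2` chain on the sites in
`A`. -/
structure IsFusionSolution {ι : Type*} (η k₂ k₃ : ℂ) (ξ : ι → ℂ) (A : Finset ι) (Λ : ℂ[X]) :
    Prop where
  natDegree_le : Λ.natDegree ≤ A.card
  coeff_card : Λ.coeff A.card = k₂ + k₃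
  fusion : ∀ n ∈ A, Λ.eval (ξ n) * Λ.eval (ξ n + η)
    = k₂ * k₃ * ((nodal A ξ).eval (ξ n + η) * (nodal A ξ).eval (ξ n - η))

/-- Baxter's equation for `Λ` and `Q`. -/
def IsBaxterPair {ι : Type*} (η k₂ k₃ : ℂ) (ξ : ι → ℂ) (A : Finset ι) (Λ Q : ℂ[X]) : Prop :=
  ∀ x : ℂ, Λ.eval x * Q.eval x = k₂ * ((nodal A ξ).eval (x - η) * Q.eval (x + η))
    + k₃ * ((nodal A ξ).eval x * Q.eval (x - η))

variable {ι : Type*} {η k₂ k₃ : ℂ} {ξ : ι → ℂ} {A : Finset ι}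

theorem IsSeparated.nodal_add_ne (h : IsSeparated η ξ) (hη : η ≠ 0) (n : ι) :
    (nodal A ξ).eval (ξ n + η) ≠ 0 := by
  rw [eval_nodal, Finset.prod_ne_zero_iff]
  intro m _ h0
  by_cases hnm : m = n
  · subst hnm
    simp [hη] at h0
  · exact h.sub_ne m n hnm (by linear_combination -h0)

theorem IsSeparated.nodal_sub_ne (h : IsSeparated η ξ) (hη : η ≠ 0) (n : ι) :
    (nodal A ξ).eval (ξ n - η) ≠ 0 := by
  rw [eval_nodal, Finset.prod_ne_zero_iff]
  intro m _ h0
  by_cases hnm : n = m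
  · subst hnm
    simp [hη] at h0
  · exact h.sub_ne n m hnm (by linear_combination h0)

/-- The count of fusion solutions interpolates at every node set in which the sites of `H` are
shifted by `η`. A coincidence of nodes would make two inhomogeneities equal or their difference `η`.
-/
theorem IsSeparated.injOn_shift [DecidableEq ι] (h : IsSeparated η ξ) (H : Finset ι) :
    Set.InjOn (fun n => ξ n + if n ∈ H then η else 0) A := by
  intro n _ m _ hnm
  by_contra hne
  dsimp only at hnm
  split_ifs at hnm with h1 h2 h2
  · exact hne (h.inj (by linear_combination hnm))
  · exact h.sub_ne m n (Ne.symm hne) (by linear_combination -hnm)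
  · exact h.sub_ne n m hne (by linear_combination hnm)
  · exact hne (h.inj (by linear_combination hnm))

/-- Interpolation of a polynomial of degree at most the number of nodes from its values at the nodes
and its top coefficient. -/
theorem eval_eq_interpolate [DecidableEq ι] {p : ℂ[X]} (hp : p.natDegree ≤ A.card) {v : ι → ℂ}
    (hv : Set.InjOn v A) (x : ℂ) :
    p.eval x = p.coeff A.card * (nodal A v).eval x
      + ∑ n ∈ A, p.eval (v n) * (Lagrange.basis A v n).eval x := by
  have hdeg : (p - C (p.coeff A.card) * nodal A v).degree < A.card := by
    rw [degree_lt_iff_coeff_zero]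
    intro m hm
    rcases hm.eq_or_lt with rfl | hlt
    · have : (nodal A v).coeff A.card = 1 := by
        have := (nodal_monic (s := A) (v := v)).coeff_natDegree
        rwa [natDegree_nodal] at this
      simp [this]
    · have h1 : p.coeff m = 0 := coeff_eq_zero_of_natDegree_lt (hp.trans_lt hlt)
      have h2 : (nodal A v).coeff m = 0 :=
        coeff_eq_zero_of_natDegree_lt (by rwa [natDegree_nodal])
      simp [h1, h2]
  have := eq_interpolate_of_eval_eq (fun n => p.eval (v n)) hv hdeg (by
    intro n hn
    simp [eval_nodal_at_node hn])
  have h2 := congrArg (eval x) this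
  rw [interpolate_apply, eval_sub, eval_mul, eval_C, eval_finsetSum] at h2
  simp only [eval_mul, eval_C] at h2
  linear_combination h2

/-- There are at most `2 ^ #A` fusion solutions. -/
theorem card_fusionSolution_le [DecidableEq ι] (h : IsSeparated η ξ) (s : Finset ℂ[X])
    (hs : ∀ Λ ∈ s, IsFusionSolution η k₂ k₃ ξ A Λ) : s.card ≤ 2 ^ A.card := by
  classical
  -- A point at which the finitely many polynomials of `s` take distinct values; these values will
  -- be distinct eigenvalues of `M`.
  obtain ⟨x, hx⟩ : ∃ x : ℂ, ∀ p ∈ s, ∀ q ∈ s, p ≠ q → p.eval x ≠ q.eval x := by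
    have hne : ∏ pq ∈ s.offDiag, (pq.1 - pq.2) ≠ 0 := by
      rw [Finset.prod_ne_zero_iff]
      intro pq hpq
      exact sub_ne_zero.mpr (Finset.mem_offDiag.mp hpq).2.2
    obtain ⟨x, hx⟩ : ∃ x, (∏ pq ∈ s.offDiag, (pq.1 - pq.2)).eval x ≠ 0 := by
      by_contra hcon
      push Not at hcon
      exact hne (Polynomial.funext fun x => by simpa using hcon x)
    refine ⟨x, fun p hp q hq hpq heq => hx ?_⟩
    rw [eval_prod]
    refine Finset.prod_eq_zero (i := (p, q)) (by simp [hp, hq, hpq]) ?_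
    simp [heq]
  let v : Finset ι → ι → ℂ := fun H n => ξ n + if n ∈ H then η else 0
  let c : ι → ℂ := fun n =>
    k₂ * k₃ * ((nodal A ξ).eval (ξ n + η) * (nodal A ξ).eval (ξ n - η))
  have hmemE : ∀ (H : A.powerset) (n : ι), H.1.erase n ∈ A.powerset := fun H n =>
    Finset.mem_powerset.mpr ((Finset.erase_subset _ _).trans (Finset.mem_powerset.mp H.2))
  have hmemI : ∀ (H : A.powerset) (n : A), insert n.1 H.1 ∈ A.powerset := fun H n =>
    Finset.mem_powerset.mpr (Finset.insert_subset n.2 (Finset.mem_powerset.mp H.2))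
  -- Separation of variables: `Λ(x)` is interpolated from the nodes `v H`. Multiplying `e Λ H = ∏_{n
  -- ∈ H} Λ(ξ n)` by `Λ(ξ n)` for `n ∉ H` inserts `n`, and by `Λ(ξ n + η)` for `n ∈ H` removes `n`
  -- at the cost of `c n`, by fusion. So `M` does not depend on `Λ`, and `e Λ` is an eigenvector
  -- with eigenvalue `Λ(x)`.
  let M : Module.End ℂ (A.powerset → ℂ) := LinearMap.pi fun H =>
    ((k₂ + k₃) * (nodal A (v H)).eval x) • LinearMap.proj H
      + ∑ n : A, (Lagrange.basis A (v H) n).eval x •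
        (if n.1 ∈ H.1 then c n • LinearMap.proj ⟨_, hmemE H n⟩ else LinearMap.proj ⟨_, hmemI H n⟩)
  let e : s → A.powerset → ℂ := fun Λ H => ∏ n ∈ H.1, Λ.1.eval (ξ n)
  have hli : LinearIndependent ℂ e := by
    refine Module.End.eigenvectors_linearIndependent' M (fun Λ : s => Λ.1.eval x) ?_ e ?_
    · intro p q hpq
      by_contra hne
      exact hx p p.2 q q.2 (fun h => hne (Subtype.ext h)) hpq
    · intro Λ
      have hΛ := hs Λ.1 Λ.2
      refine Module.End.hasEigenvector_iff.mpr ⟨Module.End.mem_eigenspace_iff.mpr ?_, ?_⟩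
      · funext H
        have hint := eval_eq_interpolate hΛ.natDegree_le (h.injOn_shift (A := A) H.1) x
        rw [hΛ.coeff_card, ← Finset.sum_coe_sort A] at hint
        simp only [M, LinearMap.pi_apply, LinearMap.add_apply, LinearMap.smul_apply,
          LinearMap.proj_apply, LinearMap.sum_apply, Pi.smul_apply, smul_eq_mul]
        rw [hint, add_mul ((k₂ + k₃) * _), Finset.sum_mul]
        congr 1
        refine Finset.sum_congr rfl fun n _ => ?_
        split_ifs with hn
        · simp only [LinearMap.smul_apply, LinearMap.proj_apply, smul_eq_mul, e, c]
          rw [← hΛ.fusion n n.2, ← Finset.mul_prod_erase H.1 (fun n => Λ.1.eval (ξ n)) hn]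
          ring
        · simp only [LinearMap.proj_apply, e]
          rw [Finset.prod_insert hn, add_zero]
          ring
      · intro h0
        have := congrFun h0 ⟨∅, by simp⟩
        simp [e] at this
  have hcard := hli.fintype_card_le_finrank
  simpa using hcard

theorem coeff_comp_X_add_C {Q : ℂ[X]} {a : ℕ} (hQ : Q.natDegree ≤ a) (r : ℂ) :
    (Q.comp (X + C r)).coeff a = Q.coeff a := by
  have hdeg : (Q.comp (X + C r)).natDegree = Q.natDegree := by
    rw [natDegree_comp, natDegree_X_add_C, mul_one]
  rcases hQ.eq_or_lt with h | h
  · have h1 : (Q.comp (X + C r)).leadingCoeff = Q.leadingCoeff := by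
      rw [leadingCoeff_comp (by simp)]
      simp
    rw [leadingCoeff, leadingCoeff, hdeg, h] at h1
    exact h1
  · rw [coeff_eq_zero_of_natDegree_lt h, coeff_eq_zero_of_natDegree_lt (by rwa [hdeg])]

theorem natDegree_comp_X_add_C (Q : ℂ[X]) (r : ℂ) :
    (Q.comp (X + C r)).natDegree = Q.natDegree := by
  rw [natDegree_comp, natDegree_X_add_C, mul_one]

/-- The right hand side of Baxter's equation. -/
noncomputable def baxterPoly (η k₂ k₃ : ℂ) (ξ : ι → ℂ) (A : Finset ι) (Q : ℂ[X]) : ℂ[X] :=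
  C k₂ * ((nodal A ξ).comp (X + C (-η)) * Q.comp (X + C η))
    + C k₃ * (nodal A ξ * Q.comp (X + C (-η)))

theorem eval_baxterPoly (Q : ℂ[X]) (x : ℂ) : (baxterPoly η k₂ k₃ ξ A Q).eval x =
    k₂ * ((nodal A ξ).eval (x - η) * Q.eval (x + η))
    + k₃ * ((nodal A ξ).eval x * Q.eval (x - η)) := by
  simp [baxterPoly, sub_eq_add_neg]

theorem natDegree_baxterPoly_le {Q : ℂ[X]} {b : ℕ} (hQ : Q.natDegree ≤ b) :
    (baxterPoly η k₂ k₃ ξ A Q).natDegree ≤ A.card + b := by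
  have hd : (nodal A ξ).natDegree ≤ A.card := natDegree_nodal.le
  refine natDegree_add_le_of_degree_le ?_ ?_ <;> refine (natDegree_C_mul_le _ _).trans ?_ <;>
    refine natDegree_mul_le_of_le ?_ ?_ <;> first
    | assumption
    | (rw [natDegree_comp_X_add_C]; assumption)

theorem coeff_baxterPoly {Q : ℂ[X]} {b : ℕ} (hQ : Q.natDegree ≤ b) :
    (baxterPoly η k₂ k₃ ξ A Q).coeff (A.card + b) = (k₂ + k₃) * Q.coeff b := by
  have hd : (nodal A ξ).natDegree ≤ A.card := natDegree_nodal.le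
  have h1 : (nodal A ξ).coeff A.card = 1 := by
    have := (nodal_monic (s := A) (v := ξ)).coeff_natDegree
    rwa [natDegree_nodal] at this
  rw [baxterPoly, coeff_add, coeff_C_mul, coeff_C_mul,
    coeff_mul_add_eq_of_natDegree_le (by rwa [natDegree_comp_X_add_C])
      (by rwa [natDegree_comp_X_add_C]),
    coeff_mul_add_eq_of_natDegree_le hd (by rwa [natDegree_comp_X_add_C]),
    coeff_comp_X_add_C hd, coeff_comp_X_add_C hQ, coeff_comp_X_add_C hQ, h1]
  ring

theorem isBaxterPair_iff {Λ Q : ℂ[X]} :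
    IsBaxterPair η k₂ k₃ ξ A Λ Q ↔ Λ * Q = baxterPoly η k₂ k₃ ξ A Q := by
  constructor
  · intro h
    refine Polynomial.funext fun x => ?_
    rw [eval_mul, eval_baxterPoly, h x]
  · intro h x
    rw [← eval_mul, h, eval_baxterPoly]

/-- The right side of the fusion relation is nonzero on separated sites. Besides allowing division
by `Λ(ξ n)`, this lets the values of an eigenvalue at the inhomogeneities detect `A`. -/
theorem IsFusionSolution.eval_ne_zero {Λ : ℂ[X]} (h : IsFusionSolution η k₂ k₃ ξ A Λ)
    (hs : IsSeparated η ξ) (hη : η ≠ 0) (hk₂ : k₂ ≠ 0) (hk₃ : k₃ ≠ 0) {n : ι} (hn : n ∈ A) :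
    Λ.eval (ξ n) ≠ 0 := by
  intro h0
  have := h.fusion n hn
  rw [h0, zero_mul] at this
  exact mul_ne_zero (mul_ne_zero hk₂ hk₃)
    (mul_ne_zero (hs.nodal_add_ne hη n) (hs.nodal_sub_ne hη n)) this.symm

/-- Every fusion solution admits a polynomial solution of Baxter's equation. -/
theorem IsFusionSolution.exists_baxterPair [DecidableEq ι] {Λ : ℂ[X]}
    (h : IsFusionSolution η k₂ k₃ ξ A Λ)
    (hs : IsSeparated η ξ) (hη : η ≠ 0) (hk₂ : k₂ ≠ 0) (hk₃ : k₃ ≠ 0) :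
    ∃ Q : ℂ[X], Q ≠ 0 ∧ Q.natDegree ≤ A.card ∧ IsBaxterPair η k₂ k₃ ξ A Λ Q := by
  -- Baxter's equation at the points `ξ n` is a system of `A.card` linear equations in the `A.card +
  -- 1` coefficients of `Q`, hence has a nonzero solution.
  let φ : degreeLT ℂ (A.card + 1) →ₗ[ℂ] (A → ℂ) := LinearMap.pi fun n =>
    (Λ.eval (ξ n) • (Polynomial.leval (ξ n))
      - (k₂ * (nodal A ξ).eval (ξ n - η)) • (Polynomial.leval (ξ n + η))) ∘ₗ Submodule.subtype _
  have hker : LinearMap.ker φ ≠ ⊥ := by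
    have : FiniteDimensional ℂ (degreeLT ℂ (A.card + 1)) :=
      (degreeLTEquiv ℂ (A.card + 1)).symm.finiteDimensional
    apply LinearMap.ker_ne_bot_of_finrank_lt
    rw [(degreeLTEquiv ℂ (A.card + 1)).finrank_eq]
    simp
  obtain ⟨⟨Q, hQm⟩, hQker, hQ0⟩ := Submodule.exists_mem_ne_zero_of_ne_bot hker
  have hQ : Q ≠ 0 := fun h0 => hQ0 (Subtype.ext h0)
  have hdeg : Q.natDegree ≤ A.card := by
    rw [mem_degreeLT] at hQm
    have := (natDegree_lt_iff_degree_lt hQ).mpr hQm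
    omega
  have heq : ∀ n ∈ A, Λ.eval (ξ n) * Q.eval (ξ n)
      = k₂ * (nodal A ξ).eval (ξ n - η) * Q.eval (ξ n + η) := by
    intro n hn
    have := congrFun (LinearMap.mem_ker.mp hQker) ⟨n, hn⟩
    simpa [φ, sub_eq_zero] using this
  refine ⟨Q, hQ, hdeg, isBaxterPair_iff.mpr (sub_eq_zero.mp ?_)⟩
  -- The two sides of Baxter's equation have degree at most `2 * A.card` and agree in the
  -- coefficient of that degree, so equality at these `2 * A.card` points suffices. At `ξ n` it is
  -- the linear system, and at `ξ n + η` it follows from the linear system by fusion.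
  let t : Finset ℂ := A.image ξ ∪ A.image fun n => ξ n + η
  have ht : t.card = A.card + A.card := by
    rw [Finset.card_union_of_disjoint, Finset.card_image_of_injective _ hs.inj,
      Finset.card_image_of_injective _ fun a b hab => hs.inj (add_right_cancel hab)]
    rw [Finset.disjoint_left]
    intro z hz hz'
    obtain ⟨n, -, rfl⟩ := Finset.mem_image.mp hz
    obtain ⟨m, -, hm⟩ := Finset.mem_image.mp hz'
    by_cases hnm : n = m
    · subst hnm
      simp [hη] at hm
    · exact hs.sub_ne n m hnm (by linear_combination -hm)
  refine eq_zero_of_degree_lt_of_eval_finset_eq_zero t ?_ ?_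
  · rw [ht, degree_lt_iff_coeff_zero]
    intro m hm
    rcases hm.eq_or_lt with rfl | hlt
    · rw [coeff_sub, coeff_baxterPoly hdeg, coeff_mul_add_eq_of_natDegree_le h.natDegree_le hdeg,
        h.coeff_card, sub_self]
    · rw [coeff_sub, coeff_eq_zero_of_natDegree_lt
          ((natDegree_mul_le_of_le h.natDegree_le hdeg).trans_lt hlt),
        coeff_eq_zero_of_natDegree_lt ((natDegree_baxterPoly_le hdeg).trans_lt hlt), sub_self]
  · intro z hz
    rw [eval_sub, eval_mul, eval_baxterPoly]
    rcases Finset.mem_union.mp hz with hz | hz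
    · obtain ⟨n, hn, rfl⟩ := Finset.mem_image.mp hz
      rw [eval_nodal_at_node hn, heq n hn]
      ring
    · obtain ⟨n, hn, rfl⟩ := Finset.mem_image.mp hz
      rw [add_sub_cancel_right, eval_nodal_at_node hn]
      have h0 := h.eval_ne_zero hs hη hk₂ hk₃ hn
      refine (mul_right_inj' h0).mp ?_
      linear_combination Q.eval (ξ n + η) * h.fusion n hn
        - k₃ * (nodal A ξ).eval (ξ n + η) * heq n hn

/-- The polynomial solution of Baxter's equation is unique up to a scalar. -/
theorem IsBaxterPair.exists_eq_C_mul (hη : η ≠ 0) (hk : k₂ ≠ k₃) {Λ Q R : ℂ[X]}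
    (hQ0 : Q ≠ 0) (hQ : IsBaxterPair η k₂ k₃ ξ A Λ Q) (hR : IsBaxterPair η k₂ k₃ ξ A Λ R) :
    ∃ c : ℂ, R = C c * Q := by
  set d := nodal A ξ with hd
  -- The discrete Wronskian of two solutions. Eliminating `Λ` leaves a first order difference
  -- equation whose two sides have leading coefficients `k₂` and `k₃` times that of `W`, so `W = 0`.
  let W : ℂ[X] := Q * R.comp (X + C (-η)) - R * Q.comp (X + C (-η))
  have hW : C k₂ * (d.comp (X + C (-η)) * W.comp (X + C η)) = C k₃ * (d * W) := by
    refine Polynomial.funext fun x => ?_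
    have h1 := hQ x
    have h2 := hR x
    simp only [W, eval_mul, eval_C, eval_comp, eval_add, eval_X, eval_sub]
    rw [← sub_eq_add_neg, ← sub_eq_add_neg, add_sub_cancel_right]
    linear_combination Q.eval x * h2 - R.eval x * h1
  have hW0 : W = 0 := by
    by_contra hne
    have h1 := congrArg leadingCoeff hW
    have hdm : d.Monic := nodal_monic
    rw [leadingCoeff_mul, leadingCoeff_mul, leadingCoeff_mul, leadingCoeff_mul,
      leadingCoeff_comp (by rw [natDegree_X_add_C]; simp),
      leadingCoeff_comp (by rw [natDegree_X_add_C]; simp)] at h1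
    simp only [leadingCoeff_C, hdm.leadingCoeff, leadingCoeff_X_add_C, one_pow, mul_one,
      one_mul] at h1
    exact hk (mul_right_cancel₀ (leadingCoeff_ne_zero.mpr hne) h1)
  have hper : ∀ x, Q.eval x * R.eval (x - η) = R.eval x * Q.eval (x - η) := by
    intro x
    have := congrArg (eval x) hW0
    simpa [W, sub_eq_zero, ← sub_eq_add_neg] using this
  -- Since `W = 0`, the quotient `R / Q` is `η`-periodic. Along the points `-m η` beyond the last
  -- zero of `Q` it is a constant `c`, and `R - c Q` has infinitely many roots.
  have hinj : Function.Injective fun m : ℕ => -(m : ℂ) * η := by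
    intro m m' hmm
    have := mul_right_cancel₀ hη hmm
    exact_mod_cast neg_injective this
  have hfin : {m : ℕ | Q.eval (-(m : ℂ) * η) = 0}.Finite := by
    refine Set.Finite.of_finite_image (f := fun m : ℕ => -(m : ℂ) * η) ?_ hinj.injOn
    refine (Q.roots.toFinset.finite_toSet).subset ?_
    rintro _ ⟨m, hm, rfl⟩
    simpa [hQ0] using hm
  obtain ⟨b, hb⟩ := hfin.bddAbove
  have hbne : ∀ m : ℕ, Q.eval (-((b + 1 + m : ℕ) : ℂ) * η) ≠ 0 := by
    intro m h0
    have := hb h0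
    omega
  let c := R.eval (-((b + 1 + 0 : ℕ) : ℂ) * η) / Q.eval (-((b + 1 + 0 : ℕ) : ℂ) * η)
  have hc : ∀ m : ℕ, R.eval (-((b + 1 + m : ℕ) : ℂ) * η)
      = c * Q.eval (-((b + 1 + m : ℕ) : ℂ) * η) := by
    intro m
    induction m with
    | zero => exact (div_mul_cancel₀ _ (hbne 0)).symm
    | succ m ih =>
      have h1 := hper (-((b + 1 + m : ℕ) : ℂ) * η)
      have h2 : -((b + 1 + m : ℕ) : ℂ) * η - η = -((b + 1 + (m + 1) : ℕ) : ℂ) * η := by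
        push_cast
        ring
      rw [h2, ih] at h1
      exact mul_left_cancel₀ (hbne m) (by linear_combination h1)
  refine ⟨c, sub_eq_zero.mp (eq_zero_of_infinite_isRoot _ ?_)⟩
  refine Set.Infinite.mono ?_ (Set.infinite_range_of_injective
    (f := fun m : ℕ => -((b + 1 + m : ℕ) : ℂ) * η) fun m m' hmm => by
      have := hinj hmm
      omega)
  rintro _ ⟨m, rfl⟩
  rw [Set.mem_ofPred_eq, IsRoot, eval_sub, eval_mul, eval_C, hc m, sub_self]

theorem IsBaxterPair.eq_of_monic (hη : η ≠ 0) (hk : k₂ ≠ k₃) {Λ Q R : ℂ[X]}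
    (hQm : Q.Monic) (hRm : R.Monic) (hQ : IsBaxterPair η k₂ k₃ ξ A Λ Q)
    (hR : IsBaxterPair η k₂ k₃ ξ A Λ R) : R = Q := by
  obtain ⟨c, hc⟩ := hQ.exists_eq_C_mul hη hk hQm.ne_zero hR
  have := congrArg leadingCoeff hc
  rw [leadingCoeff_mul, hQm.leadingCoeff, hRm.leadingCoeff, leadingCoeff_C, mul_one] at this
  rw [hc, ← this, C_1, one_mul]

/-- A solution of the Bethe equations of the `gl_2` chain with simple roots gives a fusion
solution. -/
theorem exists_fusionSolution (hs : IsSeparated η ξ) (hη : η ≠ 0) (hk₃ : k₃ ≠ 0) (Μ : Finset ℂ)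
    (hΜ : ∀ m ∈ Μ, k₂ * ((nodal A ξ).eval (m - η) * (nodal Μ id).eval (m + η))
      + k₃ * ((nodal A ξ).eval m * (nodal Μ id).eval (m - η)) = 0)
    (hne : ∀ n ∈ A, ξ n ∉ Μ) :
    ∃ Λ, IsFusionSolution η k₂ k₃ ξ A Λ ∧ IsBaxterPair η k₂ k₃ ξ A Λ (nodal Μ id) := by
  have hdvd : nodal Μ id ∣ baxterPoly η k₂ k₃ ξ A (nodal Μ id) := by
    refine Finset.prod_dvd_of_coprime ?_ ?_
    · intro a _ b _ hab
      exact pairwise_coprime_X_sub_C Function.injective_id hab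
    · intro m hm
      rw [dvd_iff_isRoot, IsRoot, id, eval_baxterPoly]
      exact hΜ m hm
  obtain ⟨Λ, hΛ⟩ := hdvd
  have hmon : (nodal Μ id : ℂ[X]).Monic := nodal_monic
  have hdegQ : (nodal Μ id : ℂ[X]).natDegree = Μ.card := natDegree_nodal
  have hcoeffQ : (nodal Μ id : ℂ[X]).coeff Μ.card = 1 := by
    rw [← hdegQ]
    exact hmon.coeff_natDegree
  have hΛdeg : Λ.natDegree ≤ A.card := by
    have h1 := natDegree_baxterPoly_le (η := η) (k₂ := k₂) (k₃ := k₃) (ξ := ξ) (A := A) hdegQ.le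
    by_cases hΛ0 : Λ = 0
    · simp [hΛ0]
    · rw [hΛ, hmon.natDegree_mul' hΛ0, hdegQ] at h1
      omega
  have hB : IsBaxterPair η k₂ k₃ ξ A Λ (nodal Μ id) :=
    isBaxterPair_iff.mpr (by rw [hΛ, mul_comm])
  refine ⟨Λ, ⟨hΛdeg, ?_, fun n hn => ?_⟩, hB⟩
  · have h1 := coeff_baxterPoly (η := η) (k₂ := k₂) (k₃ := k₃) (ξ := ξ) (A := A) hdegQ.le
    rw [hΛ, mul_comm, coeff_mul_add_eq_of_natDegree_le hΛdeg hdegQ.le, hcoeffQ] at h1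
    simpa using h1
  · have h0 : (nodal Μ id).eval (ξ n) ≠ 0 := by
      rw [eval_nodal, Finset.prod_ne_zero_iff]
      intro m hm h
      rw [id, sub_eq_zero] at h
      exact hne n hn (h ▸ hm)
    -- One term of Baxter's equation vanishes at `ξ n` and the other at `ξ n + η`; the product of
    -- the two remaining identities is the fusion relation, once the values of `Q` are cancelled.
    -- The second identity also shows that `Q` cannot vanish at `ξ n + η`.
    have h1 := hB (ξ n)
    have h2 := hB (ξ n + η)
    rw [eval_nodal_at_node hn] at h1
    rw [add_sub_cancel_right, eval_nodal_at_node hn] at h2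
    have h3 : (nodal Μ id).eval (ξ n + η) ≠ 0 := by
      intro h
      rw [h] at h2
      have := mul_ne_zero hk₃ (mul_ne_zero (hs.nodal_add_ne (A := A) hη n) h0)
      exact this (by linear_combination -h2)
    refine mul_right_cancel₀ (mul_ne_zero h0 h3) ?_
    linear_combination Λ.eval (ξ n + η) * (nodal Μ id).eval (ξ n + η) * h1
      + k₂ * (nodal A ξ).eval (ξ n - η) * (nodal Μ id).eval (ξ n + η) * h2

end GL12

/-! ### Bethe roots for widely separated sites -/

namespace GL12

open Polynomial Lagrange Filter Topology

variable {ι : Type*} [DecidableEq ι]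

/-- The Bethe equations, in the variables `y n = (μ n - ξ n) / η`, of the chain with inhomogeneities
`ε⁻¹ • ζ`; the roots are labelled by the subset `S` of the set of sites `A`. -/
noncomputable def betheFun (η k₂ k₃ : ℂ) (ζ : ι → ℂ) (A S : Finset ι) (p : (ι → ℂ) × ℂ) (n : ι) : ℂ :=
  if n ∈ S then
    k₂ * (p.1 n - 1) * ((∏ m ∈ S.erase n, (ζ n - ζ m + p.2 * (η * (p.1 n - p.1 m + 1))))
      * ∏ l ∈ A.erase n, (ζ n - ζ l + p.2 * (η * (p.1 n - 1))))
    - k₃ * p.1 n * ((∏ m ∈ S.erase n, (ζ n - ζ m + p.2 * (η * (p.1 n - p.1 m - 1))))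
      * ∏ l ∈ A.erase n, (ζ n - ζ l + p.2 * (η * p.1 n)))
  -- Sites outside `S` carry no root. This dummy equation makes the system square and already has
  -- the decoupled form.
  else p.1 n - k₂ / (k₂ - k₃)

/-- Every factor belonging to another site contributes `ε⁻¹`, and the factors of the site itself
contribute `η ^ 2`. Clearing these powers gives equations that still make sense at `ε = 0`. -/
theorem bethe_eq_of_betheFun_eq_zero {η k₂ k₃ : ℂ} {ζ : ι → ℂ} {A S : Finset ι} (hSA : S ⊆ A)
    {ε : ℂ} (hε : ε ≠ 0) {y : ι → ℂ} {n : ι} (hn : n ∈ S)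
    (h : betheFun η k₂ k₃ ζ A S (y, ε) n = 0) :
    k₂ * ((nodal A fun i => ε⁻¹ * ζ i).eval (ε⁻¹ * ζ n + η * y n - η)
        * (nodal S fun i => ε⁻¹ * ζ i + η * y i).eval (ε⁻¹ * ζ n + η * y n + η))
      + k₃ * ((nodal A fun i => ε⁻¹ * ζ i).eval (ε⁻¹ * ζ n + η * y n)
        * (nodal S fun i => ε⁻¹ * ζ i + η * y i).eval (ε⁻¹ * ζ n + η * y n - η)) = 0 := by
  simp only [betheFun, if_pos hn] at h
  simp only [eval_nodal]
  have key : ∀ (T : Finset ι) (f g : ι → ℂ), n ∈ T → (∀ m, f m = ε⁻¹ * g m) →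
      ∏ m ∈ T, f m = f n * (ε⁻¹ ^ (T.erase n).card * ∏ m ∈ T.erase n, g m) := by
    intro T f g hT hfg
    rw [← Finset.mul_prod_erase T f hT, ← Finset.prod_const, ← Finset.prod_mul_distrib]
    congr 1
    exact Finset.prod_congr rfl fun m _ => hfg m
  rw [key A (fun i => ε⁻¹ * ζ n + η * y n - η - ε⁻¹ * ζ i)
      (fun i => ζ n - ζ i + ε * (η * (y n - 1))) (hSA hn) (fun m => by field_simp; ring),
    key S (fun i => ε⁻¹ * ζ n + η * y n + η - (ε⁻¹ * ζ i + η * y i))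
      (fun i => ζ n - ζ i + ε * (η * (y n - y i + 1))) hn (fun m => by field_simp; ring),
    key A (fun i => ε⁻¹ * ζ n + η * y n - ε⁻¹ * ζ i)
      (fun i => ζ n - ζ i + ε * (η * y n)) (hSA hn) (fun m => by field_simp; ring),
    key S (fun i => ε⁻¹ * ζ n + η * y n - η - (ε⁻¹ * ζ i + η * y i))
      (fun i => ζ n - ζ i + ε * (η * (y n - y i - 1))) hn (fun m => by field_simp; ring)]
  linear_combination (η ^ 2 * ε⁻¹ ^ (S.erase n).card * ε⁻¹ ^ (A.erase n).card) * h

variable [Fintype ι]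

theorem contDiff_betheFun (η k₂ k₃ : ℂ) (ζ : ι → ℂ) (A S : Finset ι) :
    ContDiff ℂ 1 (betheFun η k₂ k₃ ζ A S) := by
  rw [contDiff_pi]
  intro n
  unfold betheFun
  have h1 : ∀ m : ι, ContDiff ℂ 1 fun p : (ι → ℂ) × ℂ => p.1 m := fun m => by fun_prop
  have h2 : ContDiff ℂ 1 fun p : (ι → ℂ) × ℂ => p.2 := by fun_prop
  split_ifs
  · refine ContDiff.sub ?_ ?_
    · refine ContDiff.mul (by fun_prop) (ContDiff.mul ?_ ?_) <;>
        exact contDiff_prod fun m _ => by fun_prop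
    · refine ContDiff.mul (by fun_prop) (ContDiff.mul ?_ ?_) <;>
        exact contDiff_prod fun m _ => by fun_prop
  · fun_prop

/-- Widely separated sites: the Bethe equations have a solution near the decoupled one. -/
theorem eventually_exists_betheFun_eq_zero {η k₂ k₃ : ℂ} (hk : k₂ ≠ k₃) {ζ : ι → ℂ}
    (hζ : Function.Injective ζ) (A S : Finset ι) {r : ℝ} (hr : 0 < r) :
    ∀ᶠ ε in 𝓝 (0 : ℂ), ∃ y : ι → ℂ, (∀ n, ‖y n - k₂ / (k₂ - k₃)‖ < r) ∧
      ∀ n ∈ S, betheFun η k₂ k₃ ζ A S (y, ε) n = 0 := by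
  have hk' : k₂ - k₃ ≠ 0 := sub_ne_zero.mpr hk
  set y₀ : ι → ℂ := fun _ => k₂ / (k₂ - k₃) with hy₀
  -- At `ε = 0` the equations decouple into `c n * (y n - y₀ n) = 0` with `c n ≠ 0`. Keeping `ε` as
  -- a component makes the derivative of `G` at `(y₀, 0)` surjective, so the image of a
  -- neighbourhood of `(y₀, 0)` contains `(0, ε)` for all small `ε`.
  let G : (ι → ℂ) × ℂ → (ι → ℂ) × ℂ := fun p => (betheFun η k₂ k₃ ζ A S p, p.2)
  let c : ι → ℂ := fun n => if n ∈ S then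
    (k₂ - k₃) * ((∏ m ∈ S.erase n, (ζ n - ζ m)) * ∏ l ∈ A.erase n, (ζ n - ζ l)) else 1
  have hc : ∀ n, c n ≠ 0 := by
    intro n
    have hp : ∀ T : Finset ι, ∏ m ∈ T.erase n, (ζ n - ζ m) ≠ 0 := fun T =>
      Finset.prod_ne_zero_iff.mpr fun m hm h =>
        (Finset.ne_of_mem_erase hm) (hζ (sub_eq_zero.mp h)).symm
    simp only [c]
    split_ifs
    · exact mul_ne_zero hk' (mul_ne_zero (hp S) (hp A))
    · exact one_ne_zero
  have hzero : ∀ y : ι → ℂ, betheFun η k₂ k₃ ζ A S (y, 0) = fun n => c n * (y n - y₀ n) := by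
    intro y
    funext n
    simp only [betheFun, c, hy₀]
    split_ifs
    · simp only [zero_mul, add_zero]
      field_simp
      ring
    · simp
  have hGc : ContDiff ℂ 1 G := (contDiff_betheFun η k₂ k₃ ζ A S).prodMk contDiff_snd
  have hG : HasStrictFDerivAt G (fderiv ℂ G (y₀, 0)) (y₀, 0) :=
    hGc.contDiffAt.hasStrictFDerivAt one_ne_zero
  have hsnd : ∀ v, (fderiv ℂ G (y₀, 0) v).2 = v.2 := by
    intro v
    have h1 : HasFDerivAt (fun p => (G p).2) _ (y₀, (0 : ℂ)) := hG.hasFDerivAt.snd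
    have h2 : HasFDerivAt (fun p => (G p).2) (ContinuousLinearMap.snd ℂ (ι → ℂ) ℂ) (y₀, (0 : ℂ)) :=
      hasFDerivAt_snd
    exact congrArg (fun L => L v) (h1.unique h2)
  have hinl : ∀ v : ι → ℂ, (fderiv ℂ G (y₀, 0) (v, 0)).1 = fun n => c n * v n := by
    intro v
    have h0 : HasFDerivAt (fun y : ι → ℂ => (y, (0 : ℂ))) (ContinuousLinearMap.inl ℂ (ι → ℂ) ℂ) y₀ :=
      hasFDerivAt_prodMk_left y₀ 0
    have h1 : HasFDerivAt (fun y : ι → ℂ => (G (y, 0)).1) _ y₀ :=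
      HasFDerivAt.comp (g := fun p => (G p).1) y₀ hG.hasFDerivAt.fst h0
    have h2 : HasFDerivAt (fun y : ι → ℂ => (G (y, 0)).1)
        (ContinuousLinearMap.pi fun n => c n • ContinuousLinearMap.proj (R := ℂ) (φ := fun _ : ι => ℂ) n) y₀ := by
      rw [hasFDerivAt_pi]
      intro n
      have : (fun y : ι → ℂ => (G (y, 0)).1 n) = fun y => c n * (y n - y₀ n) := by
        funext y
        exact congrFun (hzero y) n
      rw [this]
      exact ((hasFDerivAt_apply n y₀).sub_const _).const_mul _
    have h3 := congrArg (fun L => L v) (h1.unique h2)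
    simpa [Pi.smul_def] using h3
  have hsurj : (fderiv ℂ G (y₀, 0)).range = ⊤ := by
    rw [LinearMap.range_eq_top]
    rintro ⟨w, e⟩
    let u := (fderiv ℂ G (y₀, 0) (0, e)).1
    refine ⟨(fun n => (w n - u n) / c n, e), ?_⟩
    have hsplit : ((fun n => (w n - u n) / c n, e) : (ι → ℂ) × ℂ)
        = (fun n => (w n - u n) / c n, 0) + (0, e) := by simp
    refine Prod.ext ?_ (hsnd _)
    change (fderiv ℂ G (y₀, 0) _).1 = w
    rw [hsplit, map_add, Prod.fst_add, hinl]
    funext n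
    simp [mul_div_cancel₀ _ (hc n), u]
  have hmap := hG.map_nhds_eq_of_surj hsurj
  have hG0 : G (y₀, 0) = (0, 0) := by
    refine Prod.ext ?_ rfl
    change betheFun η k₂ k₃ ζ A S (y₀, 0) = 0
    rw [hzero]
    funext n
    simp
  rw [hG0] at hmap
  have hU : {p : (ι → ℂ) × ℂ | ∀ n, ‖p.1 n - k₂ / (k₂ - k₃)‖ < r} ∈ 𝓝 (y₀, (0 : ℂ)) := by
    refine IsOpen.mem_nhds ?_ ?_
    · have : {p : (ι → ℂ) × ℂ | ∀ n, ‖p.1 n - k₂ / (k₂ - k₃)‖ < r}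
          = ⋂ n, {p : (ι → ℂ) × ℂ | ‖p.1 n - k₂ / (k₂ - k₃)‖ < r} := by
        ext p
        simp
      rw [this]
      exact isOpen_iInter_of_finite fun n => isOpen_lt (by fun_prop) continuous_const
    · intro n
      simpa [hy₀] using hr
  have himg := image_mem_map (m := G) hU
  rw [hmap] at himg
  have hcont : Tendsto (fun ε : ℂ => ((0 : ι → ℂ), ε)) (𝓝 0) (𝓝 (0, 0)) :=
    Continuous.tendsto (by fun_prop) 0
  filter_upwards [hcont himg] with ε hε
  obtain ⟨⟨y, ε'⟩, hy, hGy⟩ := hε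
  have h2 : ε' = ε := congrArg Prod.snd hGy
  subst h2
  exact ⟨y, hy, fun n _ => congrFun (congrArg Prod.fst hGy) n⟩

/-- For widely separated sites, every monic solution of Baxter's equation attached to a fusion
solution has simple roots which avoid all `ξ n` and `ξ n + η`. -/
theorem eventually_roots_simple {η k₂ k₃ : ℂ} (hη : η ≠ 0) (hk₂ : k₂ ≠ 0) (hk₃ : k₃ ≠ 0)
    (hk : k₂ ≠ k₃) {ζ : ι → ℂ} (hζ : Function.Injective ζ) :
    ∀ᶠ ε in 𝓝[≠] (0 : ℂ), ∀ (A : Finset ι) (Λ Q : ℂ[X]),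
      IsFusionSolution η k₂ k₃ (fun n => ε⁻¹ * ζ n) A Λ → Q.Monic →
      IsBaxterPair η k₂ k₃ (fun n => ε⁻¹ * ζ n) A Λ Q →
      ∃ Μ : Finset ℂ, Q = nodal Μ id ∧
        ∀ m ∈ Μ, ∀ n, m ≠ ε⁻¹ * ζ n ∧ m ≠ ε⁻¹ * ζ n + η := by
  have hk' : k₂ - k₃ ≠ 0 := sub_ne_zero.mpr hk
  set y₀ : ℂ := k₂ / (k₂ - k₃) with hy₀
  have hy0 : y₀ ≠ 0 := div_ne_zero hk₂ hk'
  have hy1 : y₀ - 1 ≠ 0 := by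
    have : y₀ - 1 = k₃ / (k₂ - k₃) := by
      rw [hy₀]
      field_simp
      ring
    rw [this]
    exact div_ne_zero hk₃ hk'
  -- A root `ξ n + η y` meets `ξ n` or `ξ n + η` exactly when `y` is `0` or `1`; this radius around
  -- `y₀` excludes both values.
  set r : ℝ := min ‖y₀‖ ‖y₀ - 1‖ with hr
  have hr0 : 0 < r := lt_min (norm_pos_iff.mpr hy0) (norm_pos_iff.mpr hy1)
  set C : ℝ := ‖y₀‖ + r with hC
  have hsol : ∀ᶠ ε in 𝓝[≠] (0 : ℂ), ∀ A S : Finset ι, ∃ y : ι → ℂ, (∀ n, ‖y n - y₀‖ < r) ∧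
      ∀ n ∈ S, betheFun η k₂ k₃ ζ A S (y, ε) n = 0 := by
    rw [eventually_all]
    intro A
    rw [eventually_all]
    intro S
    exact (eventually_exists_betheFun_eq_zero hk hζ A S hr0).filter_mono nhdsWithin_le_nhds
  -- After division by `ε` distinct sites are too far apart for roots, inhomogeneities or their
  -- shifts attached to different sites to coincide.
  have hsep : ∀ᶠ ε in 𝓝[≠] (0 : ℂ), ∀ n m : ι, n ≠ m → ‖η‖ * (2 * C + 1) * ‖ε‖ < ‖ζ n - ζ m‖ := by
    rw [eventually_all]
    intro n
    rw [eventually_all]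
    intro m
    by_cases hnm : n = m
    · simp [hnm]
    · have hpos : 0 < ‖ζ n - ζ m‖ := norm_pos_iff.mpr (sub_ne_zero.mpr (hζ.ne hnm))
      have ht : Tendsto (fun ε : ℂ => ‖η‖ * (2 * C + 1) * ‖ε‖) (𝓝 0) (𝓝 0) := by
        have : Continuous fun ε : ℂ => ‖η‖ * (2 * C + 1) * ‖ε‖ := by fun_prop
        simpa using this.tendsto 0
      filter_upwards [(ht.eventually_lt_const hpos).filter_mono nhdsWithin_le_nhds] with ε h _
      exact h
  filter_upwards [hsol, hsep, self_mem_nhdsWithin] with ε hsol hsep hε A Λ Q hΛ hQm hQ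
  replace hε : ε ≠ 0 := hε
  have hCpos : 0 ≤ C := add_nonneg (norm_nonneg _) hr0.le
  have key : ∀ n m : ι, n ≠ m → ∀ w : ℂ, ‖w‖ ≤ 2 * C + 1 →
      ε⁻¹ * ζ n - ε⁻¹ * ζ m + η * w ≠ 0 := by
    intro n m hnm w hw h0
    have h1 : ζ n - ζ m = -(η * w * ε) := by
      field_simp at h0
      linear_combination h0
    have h2 := hsep n m hnm
    rw [h1, norm_neg, norm_mul, norm_mul] at h2
    have h3 : ‖η‖ * ‖w‖ * ‖ε‖ ≤ ‖η‖ * (2 * C + 1) * ‖ε‖ := by gcongr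
    linarith
  set ξ : ι → ℂ := fun n => ε⁻¹ * ζ n with hξ
  have hs : IsSeparated η ξ := by
    constructor
    · intro n m hnm
      by_contra hne
      exact key n m hne 0 (by simp; linarith) (by
        rw [mul_zero, add_zero, sub_eq_zero]
        exact hnm)
    · intro n m hnm h
      exact key n m hnm (-1) (by simp; linarith) (by
        simp only [hξ] at h
        rw [h]
        ring)
  choose y hyr hyz using hsol A
  have hyC : ∀ S n, ‖y S n‖ ≤ C := by
    intro S n
    have : y S n = y₀ + (y S n - y₀) := by ring
    rw [this]
    exact (norm_add_le _ _).trans (add_le_add le_rfl (hyr S n).le)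
  have hyne0 : ∀ S n, y S n ≠ 0 := by
    intro S n h0
    have := hyr S n
    rw [h0, zero_sub, norm_neg] at this
    exact absurd (min_le_left _ _) (not_le.mpr this)
  have hyne1 : ∀ S n, y S n ≠ 1 := by
    intro S n h0
    have := hyr S n
    rw [h0, norm_sub_rev] at this
    exact absurd (min_le_right _ _) (not_le.mpr this)
  let μ : Finset ι → ι → ℂ := fun S n => ξ n + η * y S n
  have hμne : ∀ S S' n m, n ≠ m → μ S n ≠ μ S' m := by
    intro S S' n m hnm h
    refine key n m hnm (y S n - y S' m) ?_ ?_
    · have := norm_sub_le (y S n) (y S' m)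
      linarith [hyC S n, hyC S' m]
    · simp only [μ, hξ] at h
      linear_combination h
  have hμξ : ∀ S n m, μ S n ≠ ξ m ∧ μ S n ≠ ξ m + η := by
    intro S n m
    by_cases hnm : n = m
    · subst hnm
      constructor
      · simp only [μ, ne_eq, add_eq_left, mul_eq_zero, not_or]
        exact ⟨hη, hyne0 S n⟩
      · simp only [μ, ne_eq, add_right_inj]
        intro h
        exact hyne1 S n (mul_left_cancel₀ hη (by rw [h, mul_one]))
    · constructor
      · intro h
        refine key n m hnm (y S n) (by linarith [hyC S n]) ?_
        simp only [μ, hξ] at h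
        linear_combination h
      · intro h
        refine key n m hnm (y S n - 1) ?_ ?_
        · have := norm_sub_le (y S n) 1
          rw [norm_one] at this
          linarith [hyC S n]
        · simp only [μ, hξ] at h
          linear_combination h
  have hμinj : ∀ S, Function.Injective (μ S) := by
    intro S n m h
    by_contra hne
    exact hμne S S n m hne h
  have hnod : ∀ S : Finset ι, (nodal (S.image (μ S)) id : ℂ[X]) = nodal S (μ S) := by
    intro S
    rw [nodal, nodal, Finset.prod_image (hμinj S).injOn]
    rfl
  have hex : ∀ S : Finset ι, S ⊆ A → ∃ Λ, IsFusionSolution η k₂ k₃ ξ A Λ ∧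
      IsBaxterPair η k₂ k₃ ξ A Λ (nodal (S.image (μ S)) id) := by
    intro S hS
    refine exists_fusionSolution hs hη hk₃ _ ?_ ?_
    · intro m hm
      obtain ⟨n, hn, rfl⟩ := Finset.mem_image.mp hm
      rw [hnod]
      exact bethe_eq_of_betheFun_eq_zero hS hε hn (hyz S n hn)
    · intro n _ hn
      obtain ⟨m, -, hm⟩ := Finset.mem_image.mp hn
      exact (hμξ S m n).1 hm
  choose! L hL hLB using hex
  -- `Λ` determines its monic Baxter polynomial, and roots attached to different sites differ, so
  -- `S` can be recovered from `L S`.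
  have hLinj : Set.InjOn L (A.powerset : Set (Finset ι)) := by
    intro S hS S' hS' hSS
    have hS := Finset.mem_powerset.mp hS
    have hS' := Finset.mem_powerset.mp hS'
    have h1 : (nodal (S'.image (μ S')) id : ℂ[X]) = nodal (S.image (μ S)) id :=
      (hLB S hS).eq_of_monic hη hk nodal_monic nodal_monic (hSS ▸ hLB S' hS')
    rw [hnod, hnod] at h1
    have haux : ∀ T T' : Finset ι, (nodal T (μ T) : ℂ[X]) = nodal T' (μ T') → T ⊆ T' := by
      intro T T' hTT n hn
      have h2 : (nodal T' (μ T')).eval (μ T n) = 0 := by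
        rw [← hTT, eval_nodal_at_node hn]
      rw [eval_nodal, Finset.prod_eq_zero_iff] at h2
      obtain ⟨m, hm, h3⟩ := h2
      by_contra hnT
      refine hμne T T' n m ?_ (sub_eq_zero.mp h3)
      rintro rfl
      exact hnT hm
    exact (haux S S' h1.symm).antisymm (haux S' S h1)
  -- The `2 ^ A.card` polynomials `L S` already reach the bound on the number of fusion solutions.
  have hmem : Λ ∈ A.powerset.image L := by
    by_contra hnot
    have h1 := card_fusionSolution_le hs (insert Λ (A.powerset.image L)) (η := η) (k₂ := k₂)
      (k₃ := k₃) (A := A) (by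
        intro Λ' hΛ'
        rcases Finset.mem_insert.mp hΛ' with rfl | h
        · exact hΛ
        · obtain ⟨S, hS, rfl⟩ := Finset.mem_image.mp h
          exact hL S (Finset.mem_powerset.mp hS))
    rw [Finset.card_insert_of_notMem hnot, Finset.card_image_of_injOn hLinj,
      Finset.card_powerset] at h1
    omega
  obtain ⟨S, hS, rfl⟩ := Finset.mem_image.mp hmem
  refine ⟨S.image (μ S), (hLB S (Finset.mem_powerset.mp hS)).eq_of_monic hη hk nodal_monic hQm hQ,
    ?_⟩
  intro m hm n
  obtain ⟨i, -, rfl⟩ := Finset.mem_image.mp hm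
  exact hμξ S i n

end GL12

/-! ### From widely separated to generic inhomogeneities -/

namespace MvPolynomial

/-- If the polynomial equations `f k (x, y) = 0` are incompatible for a Zariski dense set of
parameters `x`, then they are incompatible for all `x` outside a hypersurface. -/
theorem exists_forall_exists_ne_zero {σ τ κ : Type*} [Finite σ] [Finite τ]
    (f : κ → (σ ⊕ τ → ℂ) → ℂ) (hf : ∀ k, IsPolyFun (f k))
    (h : ∀ q : MvPolynomial σ ℂ, q ≠ 0 → ∃ x, eval x q ≠ 0 ∧ ∀ y, ∃ k, f k (Sum.elim x y) ≠ 0) :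
    ∃ P : MvPolynomial σ ℂ, P ≠ 0 ∧ ∀ x, eval x P ≠ 0 → ∀ y, ∃ k, f k (Sum.elim x y) ≠ 0 := by
  choose p hp using hf
  obtain ⟨P, hP, hPx⟩ := exists_forall_fibre_empty (Set.range p) (fun q hq => by
    obtain ⟨x, hx, hy⟩ := h q hq
    refine ⟨x, hx, fun y hall => ?_⟩
    obtain ⟨k, hk⟩ := hy y
    exact hk ((hp k _).trans (hall _ ⟨k, rfl⟩)))
  refine ⟨P, hP, fun x hx y => ?_⟩
  by_contra hcon
  push Not at hcon
  refine hPx x hx y ?_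
  rintro _ ⟨k, rfl⟩
  rw [← hp k]
  exact hcon k

theorem X_sub_X_sub_C_ne_zero {σ : Type*} {n m : σ} (hnm : n ≠ m) (c : ℂ) :
    (X n - X m - C c : MvPolynomial σ ℂ) ≠ 0 := by
  classical
  intro h
  have := congrArg (eval (Pi.single n (c + 1))) h
  simp [hnm.symm] at this

end MvPolynomial

namespace GL12

open Polynomial Lagrange Filter Topology

section

variable {ι : Type*}
variable (η k₂ k₃ : ℂ) (A : Finset ι) (M : ℕ)

/-- The polynomial `Λ` with coefficients among the given variables. -/
noncomputable def coeffPoly (v : ι ⊕ (Fin (A.card + 1) ⊕ Fin M) → ℂ) : ℂ[X] :=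
  ∑ j : Fin (A.card + 1), C (v (Sum.inr (Sum.inl j))) * X ^ (j : ℕ)

/-- The polynomial equations which express that `v` consists of inhomogeneities, the coefficients of
a fusion solution and the roots of a solution of Baxter's equation. -/
noncomputable def fusionEquation (v : ι ⊕ (Fin (A.card + 1) ⊕ Fin M) → ℂ) : ℂ ⊕ (A ⊕ Unit) → ℂ
  | Sum.inl x => (coeffPoly A M v).eval x * ∏ i, (x - v (Sum.inr (Sum.inr i)))
      - (k₂ * ((∏ n ∈ A, (x - η - v (Sum.inl n))) * ∏ i, (x + η - v (Sum.inr (Sum.inr i))))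
        + k₃ * ((∏ n ∈ A, (x - v (Sum.inl n))) * ∏ i, (x - η - v (Sum.inr (Sum.inr i)))))
  | Sum.inr (Sum.inl n) => (coeffPoly A M v).eval (v (Sum.inl n.1))
      * (coeffPoly A M v).eval (v (Sum.inl n.1) + η)
      - k₂ * k₃ * ((∏ m ∈ A, (v (Sum.inl n.1) + η - v (Sum.inl m)))
        * ∏ m ∈ A, (v (Sum.inl n.1) - η - v (Sum.inl m)))
  | Sum.inr (Sum.inr _) => v (Sum.inr (Sum.inl (Fin.last _))) - (k₂ + k₃)

theorem isPolyFun_fusionEquation (k : ℂ ⊕ (A ⊕ Unit)) :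
    MvPolynomial.IsPolyFun fun v => fusionEquation η k₂ k₃ A M v k := by
  open MvPolynomial.IsPolyFun in
  have hΛ : ∀ g : (ι ⊕ (Fin (A.card + 1) ⊕ Fin M) → ℂ) → ℂ, MvPolynomial.IsPolyFun g →
      MvPolynomial.IsPolyFun fun v => (coeffPoly A M v).eval (g v) := by
    intro g hg
    simp only [coeffPoly, eval_finsetSum, eval_mul, eval_C, eval_pow, eval_X]
    exact sum _ fun j _ => (coord _).mul (hg.pow _)
  open MvPolynomial.IsPolyFun in
  rcases k with x | n | _
  · exact ((hΛ _ (const x)).mul (prod _ fun i _ => (const x).sub (coord _))).sub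
      (((const k₂).mul ((prod _ fun n _ => (const (x - η)).sub (coord _)).mul
          (prod _ fun n _ => (const (x + η)).sub (coord _)))).add
        ((const k₃).mul ((prod _ fun n _ => (const x).sub (coord _)).mul
          (prod _ fun n _ => (const (x - η)).sub (coord _)))))
  · exact ((hΛ _ (coord _)).mul (hΛ _ ((coord _).add (const η)))).sub
      ((const (k₂ * k₃)).mul
        ((prod _ fun m _ => ((coord _).add (const η)).sub (coord _)).mul
          (prod _ fun m _ => ((coord _).sub (const η)).sub (coord _))))
  · exact (coord _).sub (const _)

variable {η k₂ k₃ A M}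

/-- The degree bound is built into `coeffPoly`. Baxter's equation enters as one polynomial equation
for each `x : ℂ`; an infinite family is harmless, as elimination works with the ideal it generates.
-/
theorem fusionEquation_eq_zero_iff {v : ι ⊕ (Fin (A.card + 1) ⊕ Fin M) → ℂ} :
    (∀ k, fusionEquation η k₂ k₃ A M v k = 0) ↔
      IsFusionSolution η k₂ k₃ (fun n => v (Sum.inl n)) A (coeffPoly A M v) ∧
      IsBaxterPair η k₂ k₃ (fun n => v (Sum.inl n)) A (coeffPoly A M v)
        (∏ i, (X - C (v (Sum.inr (Sum.inr i))))) := by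
  have hdeg : (coeffPoly A M v).natDegree ≤ A.card :=
    natDegree_sum_le_of_forall_le _ _ fun j _ =>
      (natDegree_C_mul_X_pow_le _ _).trans (Nat.lt_succ_iff.mp j.2)
  have hcoeff : (coeffPoly A M v).coeff A.card = v (Sum.inr (Sum.inl (Fin.last _))) := by
    simp only [coeffPoly, finsetSum_coeff, coeff_C_mul, coeff_X_pow]
    rw [Finset.sum_eq_single (Fin.last A.card)]
    · simp
    · intro j _ hj
      have : A.card ≠ (j : ℕ) := fun h => hj (Fin.ext (by simp [← h]))
      simp [this]
    · simp
  constructor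
  · intro h
    refine ⟨⟨hdeg, ?_, fun n hn => ?_⟩, fun x => ?_⟩
    · rw [hcoeff]
      exact sub_eq_zero.mp (h (Sum.inr (Sum.inr ())))
    · have := sub_eq_zero.mp (h (Sum.inr (Sum.inl ⟨n, hn⟩)))
      simpa [eval_nodal] using this
    · have := sub_eq_zero.mp (h (Sum.inl x))
      simpa [eval_nodal, eval_prod] using this
  · rintro ⟨h1, h2⟩ (x | n | _)
    · have := h2 x
      simp only [eval_prod, eval_sub, eval_X, eval_C, eval_nodal] at this
      exact sub_eq_zero.mpr this
    · have := h1.fusion n.1 n.2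
      simp only [eval_nodal] at this
      exact sub_eq_zero.mpr this
    · have := h1.coeff_card
      rw [hcoeff] at this
      exact sub_eq_zero.mpr this

end

variable {ι : Type*} [Fintype ι] [DecidableEq ι]

theorem exists_polynomial_isSeparated (η : ℂ) :
    ∃ P : MvPolynomial ι ℂ, P ≠ 0 ∧ ∀ ξ, MvPolynomial.eval ξ P ≠ 0 → IsSeparated η ξ := by
  refine ⟨∏ p ∈ (Finset.univ : Finset ι).offDiag,
    ((MvPolynomial.X p.1 - MvPolynomial.X p.2 - MvPolynomial.C 0)
      * (MvPolynomial.X p.1 - MvPolynomial.X p.2 - MvPolynomial.C η)), ?_, ?_⟩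
  · rw [Finset.prod_ne_zero_iff]
    intro p hp
    have hne := (Finset.mem_offDiag.mp hp).2.2
    exact mul_ne_zero (MvPolynomial.X_sub_X_sub_C_ne_zero hne _)
      (MvPolynomial.X_sub_X_sub_C_ne_zero hne _)
  · intro ξ hξ
    rw [map_prod, Finset.prod_ne_zero_iff] at hξ
    have hp : ∀ n m : ι, n ≠ m → ξ n - ξ m ≠ 0 ∧ ξ n - ξ m - η ≠ 0 := by
      intro n m hnm
      have := hξ (n, m) (by simp [hnm])
      simpa using this
    refine ⟨fun n m h => ?_, fun n m hnm h => (hp n m hnm).2 (sub_eq_zero.mpr h)⟩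
    by_contra hne
    exact (hp n m hne).1 (sub_eq_zero.mpr h)

/-- A property which holds for all sufficiently widely separated configurations holds on a Zariski
dense set. -/
theorem exists_eval_ne_zero_of_eventually {p : (ι → ℂ) → Prop}
    (hp : ∀ ζ : ι → ℂ, Function.Injective ζ → ∀ᶠ ε in 𝓝[≠] (0 : ℂ), p fun n => ε⁻¹ * ζ n)
    (q : MvPolynomial ι ℂ) (hq : q ≠ 0) : ∃ ξ, MvPolynomial.eval ξ q ≠ 0 ∧ p ξ := by
  -- Separation with `η` replaced by `0` is used only for the injectivity of `ζ`.
  obtain ⟨R, hR, hRs⟩ := exists_polynomial_isSeparated (ι := ι) 0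
  obtain ⟨ζ, hζ⟩ : ∃ ζ, MvPolynomial.eval ζ (q * R) ≠ 0 := by
    by_contra hcon
    push Not at hcon
    exact mul_ne_zero hq hR (MvPolynomial.funext fun x => by simpa using hcon x)
  rw [map_mul, mul_ne_zero_iff] at hζ
  -- The restriction of `q` to the line through `ζ`; it is nonzero because its value at `1` is, so
  -- it has no zero at `ε⁻¹` for small `ε ≠ 0`.
  let g : ℂ[X] := MvPolynomial.aeval (fun n => C (ζ n) * X) q
  have hg : ∀ z : ℂ, g.eval z = MvPolynomial.eval (fun n => z * ζ n) q := by
    intro z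
    have h1 : (Polynomial.aeval z).comp (MvPolynomial.aeval fun n => C (ζ n) * (X : ℂ[X]))
        = MvPolynomial.aeval (R := ℂ) fun n => z * ζ n := by
      refine MvPolynomial.algHom_ext fun n => ?_
      rw [AlgHom.comp_apply, MvPolynomial.aeval_X, MvPolynomial.aeval_X, map_mul,
        Polynomial.aeval_C, Polynomial.aeval_X, mul_comm]
      rfl
    have h2 := congrArg (fun φ => φ q) h1
    simpa [Polynomial.coe_aeval_eq_eval, MvPolynomial.coe_aeval_eq_eval] using h2
  have hg0 : g ≠ 0 := by
    intro h0
    have := hg 1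
    rw [h0, eval_zero] at this
    simp only [one_mul] at this
    exact hζ.1 this.symm
  have hfin : ∀ᶠ ε in 𝓝[≠] (0 : ℂ), g.eval ε⁻¹ ≠ 0 := by
    have hb : Bornology.IsBounded {z | g.eval z = 0} := by
      refine (Set.Finite.subset g.roots.toFinset.finite_toSet ?_).isBounded
      intro z hz
      simpa [hg0] using hz
    exact tendsto_inv₀_nhdsNE_zero.eventually (Bornology.isBounded_def.mp hb)
  obtain ⟨ε, h1, h2⟩ := (hfin.and (hp ζ (hRs ζ hζ.2).inj)).exists
  exact ⟨_, by rwa [hg] at h1, h2⟩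

section

variable {η k₂ k₃ : ℂ} {A : Finset ι} {M : ℕ}

/-- A polynomial condition on `ξ`, `Λ` and the roots of `Q` which excludes all solutions for widely
separated sites excludes them generically. -/
theorem exists_polynomial_exclude (g : (ι ⊕ (Fin (A.card + 1) ⊕ Fin M) → ℂ) → ℂ)
    (hg : MvPolynomial.IsPolyFun g)
    (hgood : ∀ ζ : ι → ℂ, Function.Injective ζ → ∀ᶠ ε in 𝓝[≠] (0 : ℂ), ∀ y,
      (∀ k, fusionEquation η k₂ k₃ A M (Sum.elim (fun n => ε⁻¹ * ζ n) y) k = 0) →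
      g (Sum.elim (fun n => ε⁻¹ * ζ n) y) ≠ 0) :
    ∃ P : MvPolynomial ι ℂ, P ≠ 0 ∧ ∀ ξ, MvPolynomial.eval ξ P ≠ 0 → ∀ y,
      (∀ k, fusionEquation η k₂ k₃ A M (Sum.elim ξ y) k = 0) → g (Sum.elim ξ y) ≠ 0 := by
  -- The index `none` adjoins the forbidden equation `g = 0` to the system; the enlarged system has
  -- no solution for widely separated sites.
  let f : Option (ℂ ⊕ (A ⊕ Unit)) → (ι ⊕ (Fin (A.card + 1) ⊕ Fin M) → ℂ) → ℂ := fun k v =>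
    k.elim (g v) fun k => fusionEquation η k₂ k₃ A M v k
  obtain ⟨P, hP, hPx⟩ := MvPolynomial.exists_forall_exists_ne_zero f (by
    rintro (_ | k)
    · exact hg
    · exact isPolyFun_fusionEquation η k₂ k₃ A M k)
    (exists_eval_ne_zero_of_eventually fun ζ hζ => by
      filter_upwards [hgood ζ hζ] with ε hε y
      by_contra hcon
      push Not at hcon
      exact hε y (fun k => hcon (some k)) (hcon none))
  refine ⟨P, hP, fun ξ hξ y hall h0 => ?_⟩
  obtain ⟨k, hk⟩ := hPx ξ hξ y
  rcases k with _ | k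
  · exact hk h0
  · exact hk (hall k)

end

theorem exists_polynomial_forall {σ κ : Type*} [Finite κ] (p : κ → (σ → ℂ) → Prop)
    (h : ∀ k, ∃ P : MvPolynomial σ ℂ, P ≠ 0 ∧ ∀ ξ, MvPolynomial.eval ξ P ≠ 0 → p k ξ) :
    ∃ P : MvPolynomial σ ℂ, P ≠ 0 ∧ ∀ ξ, MvPolynomial.eval ξ P ≠ 0 → ∀ k, p k ξ := by
  have := Fintype.ofFinite κ
  choose P hP hPx using h
  refine ⟨∏ k, P k, Finset.prod_ne_zero_iff.mpr fun k _ => hP k, fun ξ hξ k => hPx k ξ ?_⟩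
  rw [map_prod, Finset.prod_ne_zero_iff] at hξ
  exact hξ k (Finset.mem_univ k)

theorem prod_X_sub_C_eq_nodal_iff {M : ℕ} {μ : Fin M → ℂ} {Μ : Finset ℂ}
    (h : ∏ i, (X - C (μ i)) = nodal Μ id) :
    Function.Injective μ ∧ ∀ i, μ i ∈ Μ := by
  have h1 : (∏ i, (X - C (μ i))).roots = Finset.univ.val.map μ := by
    have : ∏ i, (X - C (μ i)) = ((Finset.univ.val.map μ).map fun a => X - C a).prod := by
      rw [Multiset.map_map]
      rfl
    rw [this, roots_multiset_prod_X_sub_C]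
  have h2 : (nodal Μ id : ℂ[X]).roots = Μ.val := by
    have : (nodal Μ id : ℂ[X]) = (Μ.val.map fun a => X - C a).prod := rfl
    rw [this, roots_multiset_prod_X_sub_C]
  rw [h, h2] at h1
  constructor
  · have := Μ.nodup
    rw [h1] at this
    intro i j hij
    exact Multiset.inj_on_of_nodup_map this i (Finset.mem_univ i) j (Finset.mem_univ j) hij
  · intro i
    rw [← Finset.mem_val, h1]
    exact Multiset.mem_map_of_mem μ (Finset.mem_univ i)

/-- Generically, every monic solution of Baxter's equation attached to a fusion solution has simple
roots which avoid all `ξ n` and `ξ n + η`. -/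
theorem exists_polynomial_roots_simple {η k₂ k₃ : ℂ} (hη : η ≠ 0) (hk₂ : k₂ ≠ 0) (hk₃ : k₃ ≠ 0)
    (hk : k₂ ≠ k₃) :
    ∃ P : MvPolynomial ι ℂ, P ≠ 0 ∧ ∀ ξ, MvPolynomial.eval ξ P ≠ 0 →
      ∀ (A : Finset ι) (Λ Q : ℂ[X]), IsFusionSolution η k₂ k₃ ξ A Λ → Q.Monic →
      Q.natDegree ≤ A.card → IsBaxterPair η k₂ k₃ ξ A Λ Q →
      ∃ Μ : Finset ℂ, Q = nodal Μ id ∧ ∀ m ∈ Μ, ∀ n, m ≠ ξ n ∧ m ≠ ξ n + η := by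
  have hmonic : ∀ {M : ℕ} (μ : Fin M → ℂ), (∏ i, (X - C (μ i))).Monic := fun μ =>
    monic_prod_of_monic _ _ fun i _ => monic_X_sub_C _
  have hgood : ∀ (A : Finset ι) (M : ℕ) (g : (ι ⊕ (Fin (A.card + 1) ⊕ Fin M) → ℂ) → ℂ),
      MvPolynomial.IsPolyFun g →
      (∀ v : ι ⊕ (Fin (A.card + 1) ⊕ Fin M) → ℂ,
        Function.Injective (fun i => v (Sum.inr (Sum.inr i))) →
        (∀ i n, v (Sum.inr (Sum.inr i)) ≠ v (Sum.inl n) ∧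
          v (Sum.inr (Sum.inr i)) ≠ v (Sum.inl n) + η) → g v ≠ 0) →
      ∃ P : MvPolynomial ι ℂ, P ≠ 0 ∧ ∀ ξ, MvPolynomial.eval ξ P ≠ 0 → ∀ y,
        (∀ k, fusionEquation η k₂ k₃ A M (Sum.elim ξ y) k = 0) → g (Sum.elim ξ y) ≠ 0 := by
    intro A M g hg hv
    refine exists_polynomial_exclude g hg fun ζ hζ => ?_
    filter_upwards [eventually_roots_simple hη hk₂ hk₃ hk hζ] with ε hε y hy
    obtain ⟨h1, h2⟩ := fusionEquation_eq_zero_iff.mp hy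
    obtain ⟨Μ, hQ, hΜ⟩ := hε A _ _ h1 (hmonic _) h2
    obtain ⟨h3, h4⟩ := prod_X_sub_C_eq_nodal_iff hQ
    exact hv _ h3 fun i n => hΜ _ (h4 i) n
  open MvPolynomial.IsPolyFun in
  obtain ⟨P, hP, hPx⟩ := exists_polynomial_forall (σ := ι)
    -- The bound `Q.natDegree ≤ A.card` leaves finitely many conditions: two roots coincide, or a
    -- root equals `ξ n` (`false`) or `ξ n + η` (`true`). The product of their polynomials excludes
    -- them all.
    (κ := (A : Finset ι) × (M : Fin (A.card + 1)) × (Fin M × Fin M ⊕ Fin M × ι × Bool))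
    (fun k ξ => ∀ y, (∀ e, fusionEquation η k₂ k₃ k.1 k.2.1 (Sum.elim ξ y) e = 0) →
      match k.2.2 with
      | Sum.inl (i, j) => i ≠ j → y (Sum.inr i) - y (Sum.inr j) ≠ 0
      | Sum.inr (i, n, b) => y (Sum.inr i) - (ξ n + bif b then η else 0) ≠ 0) (by
    rintro ⟨A, M, ⟨i, j⟩ | ⟨i, n, b⟩⟩
    · by_cases hij : i = j
      · exact ⟨1, one_ne_zero, fun ξ _ y _ h => absurd hij h⟩
      · obtain ⟨P, hP, hPx⟩ := hgood A M
          (fun v => v (Sum.inr (Sum.inr i)) - v (Sum.inr (Sum.inr j))) ((coord _).sub (coord _))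
          (fun v h _ h0 => hij (h (sub_eq_zero.mp h0)))
        exact ⟨P, hP, fun ξ hξ y hy _ => hPx ξ hξ y hy⟩
    · obtain ⟨P, hP, hPx⟩ := hgood A M
          (fun v => v (Sum.inr (Sum.inr i)) - (v (Sum.inl n) + bif b then η else 0))
          ((coord _).sub ((coord _).add (const _)))
          (fun v _ h h0 => by
            have h1 := sub_eq_zero.mp h0
            cases b
            · exact (h i n).1 (by simpa using h1)
            · exact (h i n).2 (by simpa using h1))
      exact ⟨P, hP, fun ξ hξ y hy => hPx ξ hξ y hy⟩)
  refine ⟨P, hP, fun ξ hξ A Λ Q hΛ hQm hQd hQ => ?_⟩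
  obtain ⟨μ, hμ⟩ : ∃ μ : Fin Q.natDegree → ℂ, Q = ∏ i, (X - C (μ i)) := by
    have hsp := IsAlgClosed.splits Q
    have hcard := splits_iff_card_roots.mp hsp
    have hprod := hsp.eq_prod_roots_of_monic hQm
    have hlen : Q.roots.toList.length = Q.natDegree := by rw [Multiset.length_toList, hcard]
    refine ⟨fun i => Q.roots.toList.get (i.cast hlen.symm), ?_⟩
    rw [← Fintype.prod_equiv (finCongr hlen) (fun i => X - C (Q.roots.toList.get i)) _
      (fun i => rfl)]
    conv_lhs => rw [hprod, ← Multiset.coe_toList Q.roots]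
    rw [Multiset.map_coe, Multiset.prod_coe, ← List.prod_ofFn]
    congr 1
    conv_lhs => rw [← List.ofFn_get Q.roots.toList]
    rw [List.map_ofFn]
    rfl
  let y : Fin (A.card + 1) ⊕ Fin Q.natDegree → ℂ := Sum.elim (fun j => Λ.coeff j) μ
  have hc : coeffPoly A Q.natDegree (Sum.elim ξ y) = Λ := by
    simp only [coeffPoly, Sum.elim_inr, y, Sum.elim_inl]
    rw [Fin.sum_univ_eq_sum_range (fun j => C (Λ.coeff j) * X ^ j)]
    exact (as_sum_range_C_mul_X_pow' _ (Nat.lt_succ_iff.mpr hΛ.natDegree_le)).symm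
  have hy : ∀ e, fusionEquation η k₂ k₃ A Q.natDegree (Sum.elim ξ y) e = 0 := by
    rw [fusionEquation_eq_zero_iff, hc]
    simp only [Sum.elim_inl, Sum.elim_inr, y]
    exact ⟨hΛ, hμ ▸ hQ⟩
  have hM : Q.natDegree < A.card + 1 := Nat.lt_succ_iff.mpr hQd
  have hinj : Function.Injective μ := by
    intro i j hij
    by_contra hne
    exact hPx ξ hξ ⟨A, ⟨_, hM⟩, Sum.inl (i, j)⟩ y hy hne (sub_eq_zero.mpr hij)
  refine ⟨Finset.univ.image μ, ?_, ?_⟩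
  · rw [nodal, Finset.prod_image hinj.injOn]
    exact hμ
  · intro m hm n
    obtain ⟨i, -, rfl⟩ := Finset.mem_image.mp hm
    constructor
    · intro h
      exact hPx ξ hξ ⟨A, ⟨_, hM⟩, Sum.inr (i, n, false)⟩ y hy (by simp [y, h])
    · intro h
      exact hPx ξ hξ ⟨A, ⟨_, hM⟩, Sum.inr (i, n, true)⟩ y hy (by simp [y, h])

end GL12

/-! ### The transfer matrix in matrix product form -/

namespace GL12

open Matrix

/-- The product `W (n - 1) * ⋯ * W 0`. -/
def oprod {R : Type*} [Monoid R] {n : ℕ} (W : Fin n → R) : R := (List.ofFn W).reverse.prod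

@[simp]
theorem oprod_zero {R : Type*} [Monoid R] (W : Fin 0 → R) : oprod W = 1 := by simp [oprod]

theorem oprod_succ {R : Type*} [Monoid R] {n : ℕ} (W : Fin (n + 1) → R) :
    oprod W = W (Fin.last n) * oprod fun i => W i.castSucc := by
  rw [oprod, List.ofFn_succ', List.concat_eq_append, List.reverse_append]
  simp [oprod]

/-- The `3 × 3` matrix in the auxiliary space which stands at a site with outgoing state `s` and
incoming state `t`, in the basis in which the auxiliary vector is moved along the chain. -/
def lax (η x : ℂ) (s t : Fin 3) : Matrix (Fin 3) (Fin 3) ℂ :=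
  Matrix.of fun i l => (if i = l ∧ s = t then x * (-1) ^ (parity i * parity s) else 0)
    + if i = t ∧ s = l then η else 0

theorem siteE_mul_siteE_apply {n : ℕ} (a b : Fin n) (α β : Fin 3) (u v : Fin n → Fin 3) :
    (siteE a α β * siteE b β α) u v =
      if v b = α then
        (-1) ^ ((parity β + parity α) * ∑ c ∈ Finset.univ.filter (fun c => c < b), parity (v c))
          * siteE a α β u (Function.update v b β)
      else 0 := by
  rw [Matrix.mul_apply, Finset.sum_eq_single (Function.update v b β)]
  · simp only [siteE, Matrix.of_apply, and_true]
    split_ifs <;> ring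
  · intro w _ hw
    simp [siteE, hw]
  · simp

/-- The two exchanged states pass each other, and each of them passes the states at the quantum
sites before `n`; these crossings account for the sign. -/
theorem gradedPerm_zero_succ_apply {N : ℕ} (n : Fin N) (i j : Fin 3) (s t : Fin N → Fin 3) :
    gradedPerm (0 : Fin (N + 1)) n.succ (Fin.cons i s) (Fin.cons j t) =
      if j = s n ∧ t = Function.update s n i then
        (-1) ^ (parity i * parity (s n) + (parity i + parity (s n))
          * ∑ c ∈ Finset.univ.filter (fun c => c < n), parity (s c))
      else 0 := by
  have hsum : ∑ c ∈ Finset.univ.filter (fun c : Fin (N + 1) => c < n.succ),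
      parity ((Fin.cons j t : Fin (N + 1) → Fin 3) c)
      = parity j + ∑ c ∈ Finset.univ.filter (fun c => c < n), parity (t c) := by
    rw [Finset.sum_filter, Fin.sum_univ_succ, Finset.sum_filter]
    simp
  have hupd : ∀ β, Function.update (Fin.cons j t : Fin (N + 1) → Fin 3) n.succ β
      = Fin.cons j (Function.update t n β) := fun β =>
    (Fin.cons_update (α := fun _ => Fin 3) j t n β).symm
  simp only [gradedPerm, Matrix.sum_apply, Matrix.smul_apply, siteE_mul_siteE_apply, hsum, hupd,
    Fin.cons_succ, smul_eq_mul]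
  rw [Finset.sum_eq_single (t n) (fun α _ hα => by simp [hα.symm]) (by simp)]
  rw [Finset.sum_eq_single j (fun β _ hβ => by
    simp [siteE, Function.update_of_ne (Fin.succ_ne_zero n).symm, hβ.symm]) (by simp)]
  simp only [if_true, siteE, Matrix.of_apply, Fin.cons_zero, true_and, Fin.update_cons_zero]
  have hcond : (Fin.cons i s : Fin (N + 1) → Fin 3) = Fin.cons (t n) (Function.update t n j)
      ↔ j = s n ∧ t = Function.update s n i := by
    rw [Fin.cons_inj]
    constructor
    · rintro ⟨rfl, rfl⟩
      simp
    · rintro ⟨rfl, rfl⟩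
      simp
  by_cases h : j = s n ∧ t = Function.update s n i
  · rw [if_pos h, if_pos (hcond.mpr h)]
    obtain ⟨rfl, rfl⟩ := h
    have h0 : (Finset.univ.filter fun c : Fin (N + 1) => c < 0) = ∅ := by simp
    have h1 : ∑ c ∈ Finset.univ.filter (fun c => c < n), parity (Function.update s n i c)
        = ∑ c ∈ Finset.univ.filter (fun c => c < n), parity (s c) :=
      Finset.sum_congr rfl fun c hc => by
        rw [Function.update_of_ne (Finset.mem_filter.mp hc).2.ne]
    rw [h0, h1]
    simp only [Finset.sum_empty, mul_zero, pow_zero, mul_one, Function.update_self, ← pow_add]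
    generalize ∑ c ∈ Finset.univ.filter (fun c => c < n), parity (s c) = k
    rw [neg_one_pow_eq_pow_mod_two, neg_one_pow_eq_pow_mod_two (n := _ + _)]
    congr 1
    generalize s n = j
    rcases Nat.mod_two_eq_zero_or_one k with hk | hk <;> fin_cases i <;> fin_cases j <;>
      simp [parity] <;> omega
  · rw [if_neg h, if_neg (fun h' => h (hcond.mp h'))]
    simp

theorem rMatrix_zero_succ_mul_apply {N : ℕ} (η x : ℂ) (n : Fin N) (ρ : Op (N + 1)) (i : Fin 3)
    (s : Fin N → Fin 3) (w : Fin (N + 1) → Fin 3) :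
    (rMatrix η 0 n.succ x * ρ) (Fin.cons i s) w = x * ρ (Fin.cons i s) w
      + η * ((-1) ^ (parity i * parity (s n) + (parity i + parity (s n))
          * ∑ c ∈ Finset.univ.filter (fun c => c < n), parity (s c))
        * ρ (Fin.cons (s n) (Function.update s n i)) w) := by
  rw [rMatrix, Matrix.add_mul, Matrix.add_apply, Matrix.smul_mul, Matrix.smul_mul, Matrix.one_mul,
    Matrix.smul_apply, Matrix.smul_apply, smul_eq_mul, smul_eq_mul]
  congr 2
  rw [Matrix.mul_apply, Finset.sum_eq_single (Fin.cons (s n) (Function.update s n i))]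
  · rw [gradedPerm_zero_succ_apply, if_pos ⟨rfl, rfl⟩]
  · intro v _ hv
    rw [← Fin.cons_self_tail v, gradedPerm_zero_succ_apply, if_neg, zero_mul]
    rintro ⟨h1, h2⟩
    exact hv (by rw [← Fin.cons_self_tail v, h1, h2])
  · simp

/-- The product of the first `k` `R`-matrices as a matrix product. -/
theorem oprod_rMatrix_apply {N : ℕ} (η : ℂ) (x : Fin N → ℂ) (k : ℕ) (hk : k ≤ N) (i j : Fin 3)
    (s t : Fin N → Fin 3) :
    oprod (fun n : Fin k => rMatrix η (0 : Fin (N + 1)) (Fin.castLE hk n).succ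
        (x (Fin.castLE hk n))) (Fin.cons i s) (Fin.cons j t)
      = if ∀ c : Fin N, k ≤ c → s c = t c then
          (-1) ^ (parity i * ∑ c ∈ Finset.univ.filter (fun c : Fin N => (c : ℕ) < k), parity (s c))
          * oprod (fun n : Fin k => lax η (x (Fin.castLE hk n)) (s (Fin.castLE hk n))
              (t (Fin.castLE hk n))) i j
        else 0 := by
  -- The sign is the cost of carrying the auxiliary state `i` past the first `k` quantum states. The
  -- induction must vary `i` and `s`, since the permutation exchanges `i` with the state at the new
  -- site.
  induction k generalizing i s with
  | zero =>
    simp only [oprod_zero, Matrix.one_apply, Fin.cons_inj]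
    simp only [zero_le, forall_const, ← funext_iff]
    by_cases h1 : i = j <;> by_cases h2 : s = t <;> simp [h1, h2]
  | succ k ih =>
    have hk' : k ≤ N := by omega
    set n : Fin N := ⟨k, by omega⟩ with hn
    have hlast : Fin.castLE hk (Fin.last k) = n := rfl
    have hcs : ∀ c : Fin k, Fin.castLE hk c.castSucc = Fin.castLE hk' c := fun _ => rfl
    have hne : ∀ c : Fin k, Fin.castLE hk' c ≠ n := fun c h => by
      have := congrArg Fin.val h
      simp [hn] at this
      omega
    rw [oprod_succ, oprod_succ]
    simp only [hlast, hcs]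
    rw [rMatrix_zero_succ_mul_apply, ih hk', ih hk']
    have hfilt : (Finset.univ.filter fun c : Fin N => c < n)
        = Finset.univ.filter fun c : Fin N => (c : ℕ) < k := rfl
    have hsum' : ∑ c ∈ Finset.univ.filter (fun c : Fin N => (c : ℕ) < k),
        parity (Function.update s n i c)
        = ∑ c ∈ Finset.univ.filter (fun c : Fin N => (c : ℕ) < k), parity (s c) :=
      Finset.sum_congr rfl fun c hc => by
        rw [Function.update_of_ne]
        rintro rfl
        simp [hn] at hc
    have hsum1 : ∑ c ∈ Finset.univ.filter (fun c : Fin N => (c : ℕ) < k + 1), parity (s c)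
        = parity (s n)
          + ∑ c ∈ Finset.univ.filter (fun c : Fin N => (c : ℕ) < k), parity (s c) := by
      have : (Finset.univ.filter fun c : Fin N => (c : ℕ) < k + 1)
          = insert n (Finset.univ.filter fun c : Fin N => (c : ℕ) < k) := by
        ext c
        simp only [Finset.mem_filter, Finset.mem_univ, true_and, Finset.mem_insert, hn, Fin.ext_iff]
        omega
      rw [this, Finset.sum_insert (by simp [hn])]
    have hc1 : (∀ c : Fin N, k ≤ c → s c = t c) ↔
        s n = t n ∧ ∀ c : Fin N, k + 1 ≤ c → s c = t c := by
      constructor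
      · intro h
        exact ⟨h n le_rfl, fun c hc => h c (by omega)⟩
      · rintro ⟨h1, h2⟩ c hc
        rcases hc.eq_or_lt with h | h
        · have : c = n := Fin.ext h.symm
          rw [this, h1]
        · exact h2 c h
    have hc2 : (∀ c : Fin N, k ≤ c → Function.update s n i c = t c) ↔
        i = t n ∧ ∀ c : Fin N, k + 1 ≤ c → s c = t c := by
      constructor
      · intro h
        refine ⟨by simpa using h n le_rfl, fun c hc => ?_⟩
        have := h c (by omega)
        rwa [Function.update_of_ne] at this
        rintro rfl
        simp [hn] at hc
      · rintro ⟨h1, h2⟩ c hc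
        rcases hc.eq_or_lt with h | h
        · have : c = n := Fin.ext h.symm
          rw [this, h1, Function.update_self]
        · rw [Function.update_of_ne, h2 c h]
          rintro rfl
          simp [hn] at h
    simp only [hc1, hc2, hfilt, hsum', hsum1, Function.update_of_ne (hne _)]
    by_cases hst : ∀ c : Fin N, k + 1 ≤ c → s c = t c
    · rw [if_pos hst]
      simp only [and_iff_left hst]
      set ρ : Matrix (Fin 3) (Fin 3) ℂ := oprod fun n : Fin k => lax η (x (Fin.castLE hk' n)) (s (Fin.castLE hk' n))
        (t (Fin.castLE hk' n))
      set K := ∑ c ∈ Finset.univ.filter (fun c : Fin N => (c : ℕ) < k), parity (s c)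
      have hl : (lax η (x n) (s n) (t n) * ρ) i j
          = (if s n = t n then x n * (-1) ^ (parity i * parity (s n)) * ρ i j else 0)
            + if i = t n then η * ρ (s n) j else 0 := by
        rw [Matrix.mul_apply]
        simp only [lax, Matrix.of_apply, add_mul, Finset.sum_add_distrib, ite_and, ite_mul,
          zero_mul, Finset.sum_ite_eq, Finset.mem_univ, if_true]
        congr 1
        split_ifs
        · simp
        · simp
      rw [hl]
      have hsq : ∀ m : ℕ, ((-1 : ℂ) ^ m) * (-1) ^ m = 1 := fun m => by
        rw [← mul_pow]
        simp
      have e1 : (-1 : ℂ) ^ (parity i * (parity (s n) + K))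
          = (-1) ^ (parity i * parity (s n)) * (-1) ^ (parity i * K) := by rw [mul_add, pow_add]
      have e2 : (-1 : ℂ) ^ (parity i * parity (s n) + (parity i + parity (s n)) * K)
          = (-1) ^ (parity i * parity (s n)) * (-1) ^ (parity i * K)
            * (-1) ^ (parity (s n) * K) := by
        rw [add_mul, pow_add, pow_add, mul_assoc]
      rw [e1, e2]
      have h1 := hsq (parity i * parity (s n))
      have h2 := hsq (parity (s n) * K)
      generalize (-1 : ℂ) ^ (parity i * parity (s n)) = a at *
      generalize (-1 : ℂ) ^ (parity i * K) = b at *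
      generalize (-1 : ℂ) ^ (parity (s n) * K) = c at *
      split_ifs
      · linear_combination (-(x n) * b * ρ i j) * h1 + η * a * b * ρ (s n) j * h2
      · linear_combination (-(x n) * b * ρ i j) * h1
      · linear_combination η * a * b * ρ (s n) j * h2
      · ring
    · rw [if_neg hst, if_neg (fun h => hst h.2), if_neg (fun h => hst h.2)]
      ring

theorem siteOp_zero_mul_apply {N : ℕ} (K : Matrix (Fin 3) (Fin 3) ℂ) (ρ : Op (N + 1)) (i : Fin 3)
    (s : Fin N → Fin 3) (w : Fin (N + 1) → Fin 3) :
    (siteOp (0 : Fin (N + 1)) K * ρ) (Fin.cons i s) w = ∑ l, K i l * ρ (Fin.cons l s) w := by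
  have hsite : ∀ v : Fin (N + 1) → Fin 3, siteOp (0 : Fin (N + 1)) K (Fin.cons i s) v
      = ∑ l, if v = Fin.cons l s then K i l else 0 := by
    intro v
    simp only [siteOp, Matrix.sum_apply, Matrix.smul_apply, siteE, Matrix.of_apply, smul_eq_mul]
    rw [Finset.sum_eq_single i]
    · refine Finset.sum_congr rfl fun l _ => ?_
      have : (v 0 = l ∧ (Fin.cons i s : Fin (N + 1) → Fin 3) = Function.update v 0 i)
          ↔ v = Fin.cons l s := by
        rw [← Fin.cons_self_tail v, Fin.update_cons_zero, Fin.cons_inj, Fin.cons_inj,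
          Fin.cons_zero]
        exact ⟨fun ⟨h1, _, h2⟩ => ⟨h1, h2.symm⟩, fun ⟨h1, h2⟩ => ⟨h1, rfl, h2.symm⟩⟩
      simp [this]
    · intro j _ hj
      refine Finset.sum_eq_zero fun l _ => ?_
      rw [if_neg, mul_zero]
      rintro ⟨-, h⟩
      have := congrFun h 0
      simp at this
      exact hj this.symm
    · simp
  rw [Matrix.mul_apply]
  simp only [hsite, Finset.sum_mul, ite_mul, zero_mul]
  rw [Finset.sum_comm]
  simp

/-- The transfer matrix as a matrix product operator. -/
theorem transfer_apply {N : ℕ} (η : ℂ) (K : Matrix (Fin 3) (Fin 3) ℂ) (ξ : Fin N → ℂ) (x : ℂ)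
    (s t : Fin N → Fin 3) :
    transfer η K ξ x s t = ∑ j, ∑ i, (-1) ^ parity j * (K j i * ((-1) ^ (parity i * ∑ c, parity (s c))
      * oprod (fun n => lax η (x - ξ n) (s n) (t n)) i j)) := by
  simp only [transfer, strAux, monodromy, Matrix.of_apply, siteOp_zero_mul_apply, Finset.mul_sum]
  refine Finset.sum_congr rfl fun j _ => Finset.sum_congr rfl fun i _ => ?_
  have h := oprod_rMatrix_apply η (fun n => x - ξ n) N le_rfl i j s t
  have hc : ∀ c : Fin N, N ≤ c → s c = t c := fun c hc => absurd c.2 (not_lt.mpr hc)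
  rw [if_pos hc] at h
  have hf : (Finset.univ.filter fun c : Fin N => (c : ℕ) < N) = Finset.univ := by
    ext c
    simp
  rw [hf] at h
  simp only [Fin.castLE_rfl, id] at h
  rw [← Finset.mul_sum, ← h]
  rfl

end GL12

namespace GL12
open Matrix
open scoped Kronecker

/-! ### Matrix product operators -/

section oprod

variable {σ m : Type*} [Fintype σ] [Fintype m] [DecidableEq m]

/-- The intertwiner is carried through the product one site at a time. -/
theorem oprod_intertwine {R : Type*} [Monoid R] {n : ℕ} {r : R} {E E' : Fin n → R}
    (h : ∀ i, r * E i = E' i * r) : r * oprod E = oprod E' * r := by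
  induction n with
  | zero => simp
  | succ n ih =>
    rw [oprod_succ, oprod_succ, ← mul_assoc, h, mul_assoc, ih fun i => h _, mul_assoc]

theorem sum_oprod_kronecker_oprod {n : ℕ} (A B : Fin n → σ → Matrix m m ℂ) :
    ∑ t : Fin n → σ, oprod (fun i => A i (t i)) ⊗ₖ oprod (fun i => B i (t i))
      = oprod fun i => ∑ c, A i c ⊗ₖ B i c := by
  induction n with
  | zero => simp
  | succ n ih =>
    rw [oprod_succ, ← ih, ← (Fin.snocEquiv fun _ => σ).sum_comp, Fintype.sum_prod_type,
      Finset.sum_mul_sum]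
    refine Finset.sum_congr rfl fun c _ => Finset.sum_congr rfl fun t _ => ?_
    simp [oprod_succ, Matrix.mul_kronecker_mul]

/-- The product of two matrix product operators is a matrix product operator. -/
theorem sum_trace_mul_trace {n : ℕ} (K : Matrix m m ℂ) (A B : Fin n → σ → Matrix m m ℂ) :
    ∑ t : Fin n → σ, (K * oprod fun i => A i (t i)).trace * (K * oprod fun i => B i (t i)).trace
      = (K ⊗ₖ K * oprod fun i => ∑ c, A i c ⊗ₖ B i c).trace := by
  rw [← sum_oprod_kronecker_oprod, Finset.mul_sum, Matrix.trace_sum]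
  refine Finset.sum_congr rfl fun t _ => ?_
  rw [← Matrix.trace_kronecker, Matrix.mul_kronecker_mul]

end oprod

/-! ### Yang-Baxter equation and commuting transfer matrices -/

/-- The sign `(-1) ^ (parity i * parity j)`. -/
def gsign (i j : Fin 3) : ℂ := (-1) ^ (parity i * parity j)

theorem gsign_comm (i j : Fin 3) : gsign i j = gsign j i := by
  rw [gsign, gsign, mul_comm]

theorem gsign_mul_self (i j : Fin 3) : gsign i j * gsign i j = 1 := by
  rw [gsign, ← mul_pow]
  simp

/-- The graded `R`-matrix of two auxiliary spaces composed with their permutation. -/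
def rCheck (η u : ℂ) : Matrix (Fin 3 × Fin 3) (Fin 3 × Fin 3) ℂ :=
  Matrix.of fun p q => (if p.1 = q.2 ∧ p.2 = q.1 then u * gsign p.1 p.2 else 0)
    + if p = q then η else 0

theorem sum_lax_kronecker_lax_apply (η x y : ℂ) (s u a b d e : Fin 3) :
    (∑ c, lax η x s c ⊗ₖ lax η y c u) (a, b) (d, e)
      = (if a = d then x * gsign a s * lax η y s u b e else 0)
        + if s = d then η * lax η y a u b e else 0 := by
  rw [Matrix.sum_apply]
  simp only [Matrix.kroneckerMap_apply]
  generalize lax η y = G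
  simp only [lax, Matrix.of_apply, add_mul, Finset.sum_add_distrib, ite_and, ite_mul, zero_mul,
    Finset.sum_ite_eq, Finset.mem_univ, if_true, gsign]
  congr 1
  split_ifs <;> simp

theorem rCheck_mul_apply (η u : ℂ) (E : Matrix (Fin 3 × Fin 3) (Fin 3 × Fin 3) ℂ) (a b : Fin 3)
    (q : Fin 3 × Fin 3) : (rCheck η u * E) (a, b) q
      = u * gsign a b * E (b, a) q + η * E (a, b) q := by
  rw [Matrix.mul_apply, Fintype.sum_prod_type]
  simp [rCheck, add_mul, Finset.sum_add_distrib, ite_and, Prod.ext_iff]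

theorem mul_rCheck_apply (η u : ℂ) (E : Matrix (Fin 3 × Fin 3) (Fin 3 × Fin 3) ℂ) (c d : Fin 3)
    (q : Fin 3 × Fin 3) : (E * rCheck η u) q (c, d)
      = u * gsign d c * E q (d, c) + η * E q (c, d) := by
  rw [Matrix.mul_apply, Fintype.sum_prod_type]
  simp [rCheck, mul_add, Finset.sum_add_distrib, ite_and, Prod.ext_iff]
  ring

/-- The local intertwining relation (Yang-Baxter equation). -/
theorem rCheck_mul_sum_lax (η x y : ℂ) (s u : Fin 3) :
    rCheck η (x - y) * ∑ c, lax η x s c ⊗ₖ lax η y c u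
      = (∑ c, lax η y s c ⊗ₖ lax η x c u) * rCheck η (x - y) := by
  ext ⟨a, b⟩ ⟨d, e⟩
  rw [rCheck_mul_apply, mul_rCheck_apply]
  simp only [sum_lax_kronecker_lax_apply]
  -- With Kronecker deltas for the conditionals the claim becomes an algebraic identity. Its only
  -- non-formal input is `hδ`, which replaces one index by another inside a sign.
  let δ : Fin 3 → Fin 3 → ℂ := fun i j => if i = j then 1 else 0
  have hite : ∀ (i j : Fin 3) (z : ℂ), (if i = j then z else 0) = z * δ i j := fun i j z => by
    simp [δ]
  have hlax : ∀ (x : ℂ) (s t i l : Fin 3), lax η x s t i l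
      = x * gsign i s * δ i l * δ s t + η * δ i t * δ s l := by
    intro x s t i l
    simp only [lax, Matrix.of_apply, ite_and, hite, gsign]
    ring
  simp only [hite, hlax]
  have hδ : ∀ (f : Fin 3 → ℂ) (i j : Fin 3), δ i j * f i = δ i j * f j := by
    intro f i j
    by_cases h : i = j
    · rw [h]
    · simp [δ, h]
  have e1 : δ b d * δ a e * (gsign a b * gsign b s * gsign a s)
      = δ b d * δ a e * (gsign e d * gsign b s * gsign a s) := by
    linear_combination δ a e * hδ (fun b => gsign a b * gsign b s * gsign a s) b d
      + δ b d * hδ (fun a => gsign a d * gsign b s * gsign a s) a e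
      - δ a e * gsign a d * gsign a s * hδ (fun b => gsign b s) b d
      - δ b d * gsign e d * gsign b s * hδ (fun a => gsign a s) a e
  have e2 : δ b d * δ s e * (gsign a b * gsign b s) = δ b d * δ s e * (gsign e d * gsign a b) := by
    linear_combination δ b d * gsign a b * hδ (fun s => gsign b s) s e
      + δ s e * gsign a b * hδ (fun b => gsign b e) b d
      + δ b d * δ s e * gsign a b * gsign_comm d e
  have e3 : δ s d * δ a e = δ s d * δ a e * (gsign e d * gsign a s) := by
    linear_combination -δ s d * gsign_mul_self e d * δ a e
      - δ s d * gsign e d * hδ (fun a => gsign a s) a e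
      - δ a e * gsign e d * hδ (fun s => gsign e s) s d
  have e4 : δ a d * δ s e * gsign a s = δ a d * δ s e * gsign e d := by
    linear_combination δ a d * hδ (fun s => gsign a s) s e + δ s e * hδ (fun a => gsign a e) a d
      + δ a d * δ s e * gsign_comm d e
  have e5 := gsign_comm a b
  have e6 := gsign_mul_self a b
  linear_combination (x - y) * x * y * δ s u * e1 + (x - y) * x * η * δ a u * e2
    + (x - y) * x * η * δ a u * δ b d * δ s e * gsign e d * e5
    + (x - y) * y * η * δ b u * (δ s d * δ a e * e6 + e3)
    + η ^ 2 * (x - y) * (δ s d * δ a u * δ b e * e5 + δ b u * e4)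

/-- Unitarity of the `R`-matrix; it provides an inverse unless `u = η` or `u = -η`. -/
theorem rCheck_mul_rCheck_neg (η u : ℂ) :
    rCheck η u * rCheck η (-u) = (η ^ 2 - u ^ 2) • (1 : Matrix (Fin 3 × Fin 3) (Fin 3 × Fin 3) ℂ) := by
  ext ⟨a, b⟩ ⟨c, d⟩
  rw [rCheck_mul_apply]
  simp only [rCheck, Matrix.of_apply, Matrix.smul_apply, Matrix.one_apply, Prod.mk.injEq,
    smul_eq_mul]
  have h := gsign_mul_self a b
  by_cases h1 : a = c ∧ b = d
  · have h2 : b = d ∧ a = c := ⟨h1.2, h1.1⟩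
    rw [if_pos h1, if_pos h1, if_pos h2]
    by_cases h3 : a = d ∧ b = c
    · have h4 : b = c ∧ a = d := ⟨h3.2, h3.1⟩
      rw [if_pos h3, if_pos h4, gsign_comm b a]
      linear_combination -u ^ 2 * h
    · have h4 : ¬ (b = c ∧ a = d) := fun h => h3 ⟨h.2, h.1⟩
      rw [if_neg h3, if_neg h4, gsign_comm b a]
      linear_combination -u ^ 2 * h
  · have h2 : ¬ (b = d ∧ a = c) := fun h => h1 ⟨h.2, h.1⟩
    rw [if_neg h1, if_neg h1, if_neg h2]
    by_cases h3 : a = d ∧ b = c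
    · have h4 : b = c ∧ a = d := ⟨h3.2, h3.1⟩
      rw [if_pos h3, if_pos h4]
      ring
    · have h4 : ¬ (b = c ∧ a = d) := fun h => h3 ⟨h.2, h.1⟩
      rw [if_neg h3, if_neg h4]
      ring

/-- An even twist only connects states of equal parity, so the sign of an exchange is the same
before and after it acts. -/
theorem rCheck_mul_kronecker_self (η u : ℂ) (K : Matrix (Fin 3) (Fin 3) ℂ)
    (hK : ∀ i j, parity i ≠ parity j → K i j = 0) :
    rCheck η u * (K ⊗ₖ K) = (K ⊗ₖ K) * rCheck η u := by
  ext ⟨a, b⟩ ⟨c, d⟩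
  rw [rCheck_mul_apply, mul_rCheck_apply]
  simp only [Matrix.kroneckerMap_apply]
  by_cases h1 : parity b = parity c
  · by_cases h2 : parity a = parity d
    · have : gsign a b = gsign d c := by rw [gsign, gsign, h1, h2]
      rw [this]
      ring
    · rw [hK a d h2]
      ring
  · rw [hK b c h1]
    ring

/-- The transfer matrix without its overall sign, as a matrix product operator. -/
def bareTransfer {N : ℕ} (η : ℂ) (K : Matrix (Fin 3) (Fin 3) ℂ) (ξ : Fin N → ℂ) (x : ℂ) : Op N :=
  Matrix.of fun s t => (K * oprod fun n => lax η (x - ξ n) (s n) (t n)).trace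

theorem twist_apply_of_parity_ne (K₂ : Matrix (Fin 2) (Fin 2) ℂ) (i j : Fin 3)
    (h : parity i ≠ parity j) : twist 0 K₂ i j = 0 := by
  fin_cases i <;> fin_cases j <;> simp_all [twist, parity]

/-- A product of two transfer matrices is a trace over two auxiliary spaces. Conjugation by the
`R`-matrix exchanges the two spectral parameters there, and it commutes with the doubled twist, so
the trace is unchanged. -/
theorem bareTransfer_mul_comm_of_ne {N : ℕ} {η : ℂ} {K : Matrix (Fin 3) (Fin 3) ℂ}
    (hK : ∀ i j, parity i ≠ parity j → K i j = 0) (ξ : Fin N → ℂ) {x y : ℂ}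
    (hxy : η ^ 2 - (x - y) ^ 2 ≠ 0) :
    bareTransfer η K ξ x * bareTransfer η K ξ y = bareTransfer η K ξ y * bareTransfer η K ξ x := by
  ext s u
  rw [Matrix.mul_apply, Matrix.mul_apply]
  have h := fun x y : ℂ => sum_trace_mul_trace K (fun n c => lax η (x - ξ n) (s n) c)
    (fun n c => lax η (y - ξ n) c (u n))
  simp only [bareTransfer, Matrix.of_apply]
  rw [h x y, h y x]
  set R := rCheck η (x - y)
  set R' := (η ^ 2 - (x - y) ^ 2)⁻¹ • rCheck η (-(x - y))
  have hR : R * R' = 1 := by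
    rw [Matrix.mul_smul, rCheck_mul_rCheck_neg, smul_smul, inv_mul_cancel₀ hxy, one_smul]
  have hR' : R' * R = 1 := mul_eq_one_comm.mp hR
  set E := oprod fun n => ∑ c, lax η (x - ξ n) (s n) c ⊗ₖ lax η (y - ξ n) c (u n)
  set E' := oprod fun n => ∑ c, lax η (y - ξ n) (s n) c ⊗ₖ lax η (x - ξ n) c (u n)
  have hE : R * E = E' * R := oprod_intertwine fun n => by
    have := rCheck_mul_sum_lax η (x - ξ n) (y - ξ n) (s n) (u n)
    rwa [sub_sub_sub_cancel_right] at this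
  have hE' : E' = R * E * R' := by rw [hE, mul_assoc, hR, mul_one]
  rw [hE', Matrix.mul_assoc R, ← Matrix.mul_assoc (K ⊗ₖ K), ← rCheck_mul_kronecker_self η _ K hK,
    Matrix.mul_assoc (rCheck _ _), Matrix.trace_mul_comm (rCheck _ _), Matrix.mul_assoc,
    Matrix.mul_assoc, hR', mul_one]

theorem continuous_oprod {X m : Type*} [TopologicalSpace X] [Fintype m] [DecidableEq m] {n : ℕ}
    {W : X → Fin n → Matrix m m ℂ} (hW : ∀ i, Continuous fun x => W x i) :
    Continuous fun x => oprod (W x) := by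
  induction n with
  | zero => simpa using continuous_const
  | succ n ih =>
    simp only [oprod_succ]
    exact (hW _).matrix_mul (ih fun i => hW _)

theorem continuous_bareTransfer {N : ℕ} (η : ℂ) (K : Matrix (Fin 3) (Fin 3) ℂ) (ξ : Fin N → ℂ) :
    Continuous (bareTransfer η K ξ) := by
  refine continuous_matrix fun s t => ?_
  simp only [bareTransfer, Matrix.of_apply]
  refine Continuous.matrix_trace (continuous_const.matrix_mul (continuous_oprod fun n => ?_))
  refine continuous_matrix fun i j => ?_
  simp only [lax, Matrix.of_apply]
  split_ifs <;> fun_prop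

/-- The excluded values `x = y ± η` are reached by continuity. -/
theorem bareTransfer_mul_comm {N : ℕ} (η : ℂ) {K : Matrix (Fin 3) (Fin 3) ℂ}
    (hK : ∀ i j, parity i ≠ parity j → K i j = 0) (ξ : Fin N → ℂ) (x y : ℂ) :
    bareTransfer η K ξ x * bareTransfer η K ξ y = bareTransfer η K ξ y * bareTransfer η K ξ x := by
  have hc := continuous_bareTransfer η K ξ
  have hcl : IsClosed {x | bareTransfer η K ξ x * bareTransfer η K ξ y
      = bareTransfer η K ξ y * bareTransfer η K ξ x} :=
    isClosed_eq (hc.matrix_mul continuous_const) (continuous_const.matrix_mul hc)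
  have hd : Dense ({y + η, y - η}ᶜ : Set ℂ) := (Set.to_countable _).dense_compl ℂ
  have hsub : ({y + η, y - η}ᶜ : Set ℂ) ⊆ {x | bareTransfer η K ξ x * bareTransfer η K ξ y
      = bareTransfer η K ξ y * bareTransfer η K ξ x} := by
    intro z hz
    refine bareTransfer_mul_comm_of_ne hK ξ fun h0 => hz ?_
    have h1 : (η - (z - y)) * (η + (z - y)) = 0 := by linear_combination h0
    rcases mul_eq_zero.mp h1 with h | h
    · exact Or.inl (by linear_combination -h)
    · exact Or.inr (show z = y - η by linear_combination h)
  have := hcl.closure_subset_iff.mpr hsub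
  rw [hd.closure_eq] at this
  exact this (Set.mem_univ x)

/-! ### Conservation of parity -/

/-- The sign `(-1) ^ F`, with `F` the number of odd sites. -/
def fsign {N : ℕ} (s : Fin N → Fin 3) : ℂ := ∏ n, (-1) ^ parity (s n)

theorem fsign_mul_self {N : ℕ} (s : Fin N → Fin 3) : fsign s * fsign s = 1 := by
  rw [fsign, ← Finset.prod_mul_distrib]
  refine Finset.prod_eq_one fun n _ => ?_
  rw [← mul_pow]
  simp

theorem oprod_smul_conj {m : Type*} [Fintype m] [DecidableEq m] {n : ℕ} {S : Matrix m m ℂ}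
    (hS : S * S = 1) (c : Fin n → ℂ) (W : Fin n → Matrix m m ℂ) :
    oprod (fun i => c i • (S * W i * S)) = (∏ i, c i) • (S * oprod W * S) := by
  induction n with
  | zero => simp [hS]
  | succ n ih =>
    rw [oprod_succ, oprod_succ, ih, Fin.prod_univ_castSucc, Matrix.smul_mul, Matrix.mul_smul,
      smul_smul, mul_comm (c _)]
    congr 1
    calc S * W (Fin.last n) * S * (S * oprod (fun i => W i.castSucc) * S)
        = S * W (Fin.last n) * (S * S) * oprod (fun i => W i.castSucc) * S := by
          simp only [Matrix.mul_assoc]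
      _ = _ := by
          rw [hS]
          simp only [Matrix.mul_assoc, Matrix.one_mul]

/-- The parity of the number of odd sites is conserved. -/
theorem fsign_mul_bareTransfer {N : ℕ} (η : ℂ) {K : Matrix (Fin 3) (Fin 3) ℂ}
    (hK : ∀ i j, parity i ≠ parity j → K i j = 0) (ξ : Fin N → ℂ) (x : ℂ) (s t : Fin N → Fin 3) :
    fsign s * bareTransfer η K ξ x s t = fsign t * bareTransfer η K ξ x s t := by
  -- Conjugation by `S` multiplies each local matrix by the signs of its two quantum states and
  -- fixes the even twist; inside the trace the conjugations cancel, leaving `fsign s * fsign t`.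
  let S : Matrix (Fin 3) (Fin 3) ℂ := Matrix.diagonal fun i => (-1) ^ parity i
  have hsq : ∀ k : ℕ, ((-1 : ℂ) ^ k) * (-1) ^ k = 1 := fun k => by
    rw [← mul_pow]
    simp
  have hS : S * S = 1 := by
    rw [Matrix.diagonal_mul_diagonal, ← Matrix.diagonal_one]
    congr 1
    funext i
    exact hsq _
  have hloc : ∀ n, lax η (x - ξ n) (s n) (t n)
      = ((-1 : ℂ) ^ parity (s n) * (-1) ^ parity (t n)) • (S * lax η (x - ξ n) (s n) (t n) * S) := by
    intro n
    ext i j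
    rw [Matrix.smul_apply, Matrix.mul_diagonal, Matrix.diagonal_mul]
    simp only [lax, Matrix.of_apply, smul_eq_mul]
    by_cases h1 : i = j ∧ s n = t n
    · obtain ⟨rfl, h1⟩ := h1
      rw [h1]
      linear_combination (- hsq (parity (t n)) * ((-1) ^ parity i * (-1) ^ parity i)
        - hsq (parity i)) * ((if i = i ∧ t n = t n then (x - ξ n) * (-1) ^ (parity i * parity (t n))
          else 0) + if i = t n ∧ t n = i then η else 0)
    · rw [if_neg h1]
      by_cases h2 : i = t n ∧ s n = j
      · obtain ⟨rfl, rfl⟩ := h2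
        simp only [and_self, if_true]
        linear_combination (- hsq (parity (t n)) * ((-1) ^ parity (s n) * (-1) ^ parity (s n))
          - hsq (parity (s n))) * η
      · rw [if_neg h2]
        ring
  have hKS : S * K * S = K := by
    ext i j
    rw [Matrix.mul_diagonal, Matrix.diagonal_mul]
    by_cases h : parity i = parity j
    · rw [h]
      linear_combination K i j * hsq (parity j)
    · rw [hK i j h]
      ring
  have hmain : bareTransfer η K ξ x s t = fsign s * fsign t * bareTransfer η K ξ x s t := by
    simp only [bareTransfer, Matrix.of_apply]
    conv_lhs => rw [funext hloc, oprod_smul_conj hS, Matrix.mul_smul, Matrix.trace_smul,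
      Finset.prod_mul_distrib, ← Matrix.mul_assoc, Matrix.trace_mul_comm, ← Matrix.mul_assoc,
      ← Matrix.mul_assoc, hKS]
    rfl
  linear_combination fsign s * hmain + fsign t * bareTransfer η K ξ x s t * fsign_mul_self s

theorem transfer_twist_apply {N : ℕ} (η : ℂ) (K₂ : Matrix (Fin 2) (Fin 2) ℂ) (ξ : Fin N → ℂ) (x : ℂ)
    (s t : Fin N → Fin 3) :
    transfer η (twist 0 K₂) ξ x s t = -(fsign s * bareTransfer η (twist 0 K₂) ξ x s t) := by
  have hf : fsign s = (-1) ^ ∑ c, parity (s c) := by rw [fsign, Finset.prod_pow_eq_pow_sum]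
  rw [transfer_apply, bareTransfer, Matrix.of_apply, Matrix.trace, hf]
  generalize (oprod fun n => lax η (x - ξ n) (s n) (t n)) = ρ
  simp only [Matrix.diag_apply, Matrix.mul_apply, Fin.sum_univ_three, parity, twist]
  simp
  ring

/-- Up to an overall sign the two transfer matrices differ by `fsign`, which squares to one and
commutes with `bareTransfer`, so it drops out of products of two. -/
theorem transfer_twist_mul_comm {N : ℕ} (η : ℂ) (K₂ : Matrix (Fin 2) (Fin 2) ℂ) (ξ : Fin N → ℂ)
    (x y : ℂ) : transfer η (twist 0 K₂) ξ x * transfer η (twist 0 K₂) ξ y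
      = transfer η (twist 0 K₂) ξ y * transfer η (twist 0 K₂) ξ x := by
  have hK := twist_apply_of_parity_ne K₂
  have h : ∀ x y, transfer η (twist 0 K₂) ξ x * transfer η (twist 0 K₂) ξ y
      = bareTransfer η (twist 0 K₂) ξ x * bareTransfer η (twist 0 K₂) ξ y := by
    intro x y
    ext s u
    rw [Matrix.mul_apply, Matrix.mul_apply]
    refine Finset.sum_congr rfl fun t _ => ?_
    rw [transfer_twist_apply, transfer_twist_apply]
    have h1 := fsign_mul_bareTransfer η hK ξ x s t
    linear_combination fsign t * bareTransfer η (twist 0 K₂) ξ y t u * h1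
      + bareTransfer η (twist 0 K₂) ξ x s t * bareTransfer η (twist 0 K₂) ξ y t u
        * fsign_mul_self t
  rw [h, h, bareTransfer_mul_comm η hK]

end GL12

namespace GL12

open Matrix Polynomial Lagrange
open scoped Kronecker

/-! ### The chain of odd sites -/

/-- The local matrix of the `gl_2` chain with `R`-matrix `x - η P`. -/
def oddLax (η x : ℂ) (s t : Fin 2) : Matrix (Fin 2) (Fin 2) ℂ :=
  Matrix.of fun i l => (if i = l ∧ s = t then x else 0) - if i = t ∧ s = l then η else 0

/-- The local matrices of the `gl_2` chain on the sites in `A`; it acts trivially at the other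
sites. -/
def chainLax {ι : Type*} [DecidableEq ι] (η : ℂ) (ξ : ι → ℂ) (A : Finset ι) (x : ℂ) (n : ι)
    (s t : Fin 2) : Matrix (Fin 2) (Fin 2) ℂ :=
  if n ∈ A then oddLax η (x - ξ n) s t else if s = t then 1 else 0

/-- The transfer matrix of the `gl_2` chain on the sites in `A`. -/
def chainTransfer {N : ℕ} (η : ℂ) (K₂ : Matrix (Fin 2) (Fin 2) ℂ) (ξ : Fin N → ℂ)
    (A : Finset (Fin N)) (x : ℂ) : Matrix (Fin N → Fin 2) (Fin N → Fin 2) ℂ :=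
  Matrix.of fun s t => (K₂ * oprod fun n => chainLax η ξ A x n (s n) (t n)).trace

/-- The factors are block lower triangular, so the odd block of the product is the product of the
odd blocks. -/
theorem oprod_block {n : ℕ} {W : Fin n → Matrix (Fin 3) (Fin 3) ℂ} {c : Fin n → ℂ}
    {w : Fin n → Matrix (Fin 2) (Fin 2) ℂ} (h0 : ∀ n j, W n 0 (Fin.succ j) = 0)
    (h1 : ∀ n i j, W n (Fin.succ i) (Fin.succ j) = c n * w n i j) :
    (∀ j, oprod W 0 (Fin.succ j) = 0) ∧
      ∀ i j, oprod W (Fin.succ i) (Fin.succ j) = (∏ n, c n) * oprod w i j := by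
  induction n with
  | zero => simp [Matrix.one_apply, (Fin.succ_ne_zero _).symm]
  | succ n ih =>
    obtain ⟨ih0, ih1⟩ := ih (fun m => h0 m.castSucc) (fun m => h1 m.castSucc)
    constructor
    · intro j
      rw [oprod_succ, Matrix.mul_apply, Fin.sum_univ_succ, ih0, mul_zero, zero_add]
      exact Finset.sum_eq_zero fun k _ => by rw [h0, zero_mul]
    · intro i j
      rw [oprod_succ, Matrix.mul_apply, Fin.sum_univ_succ, ih0, mul_zero, zero_add, oprod_succ,
        Matrix.mul_apply, Finset.mul_sum, Fin.prod_univ_castSucc]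
      refine Finset.sum_congr rfl fun k _ => ?_
      rw [h1, ih1]
      ring

/-- Applied to an odd auxiliary vector, the factors before `c` keep it odd, and the factor at `c`
kills it. -/
theorem oprod_apply_succ_eq_zero {n : ℕ} {W : Fin n → Matrix (Fin 3) (Fin 3) ℂ} (c : Fin n)
    (h0 : ∀ n < c, ∀ j, W n 0 (Fin.succ j) = 0) (h1 : ∀ i j, W c i (Fin.succ j) = 0) (i : Fin 3)
    (j : Fin 2) : oprod W i (Fin.succ j) = 0 := by
  induction n generalizing i with
  | zero => exact c.elim0
  | succ n ih =>
    rw [oprod_succ, Matrix.mul_apply]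
    rcases Fin.eq_castSucc_or_eq_last c with ⟨c, rfl⟩ | rfl
    · refine Finset.sum_eq_zero fun k _ => ?_
      rw [ih c (fun m hm => h0 m.castSucc (Fin.castSucc_lt_castSucc_iff.mpr hm)) h1, mul_zero]
    · have hb : ∀ {m : ℕ} (V : Fin m → Matrix (Fin 3) (Fin 3) ℂ),
          (∀ n j, V n 0 (Fin.succ j) = 0) → oprod V 0 (Fin.succ j) = 0 := by
        intro m V hV
        exact (oprod_block (c := fun _ => 1) (w := fun n i j => V n i.succ j.succ) hV
          (fun n i j => (one_mul _).symm)).1 j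
      rw [Fin.sum_univ_succ, hb _ fun m => h0 m.castSucc (Fin.castSucc_lt_last m), mul_zero,
        zero_add]
      exact Finset.sum_eq_zero fun k _ => by rw [h1, zero_mul]

/-- The state with even vectors at the sites outside `A` and the given odd vectors at the sites
in `A`. -/
def embed {N : ℕ} (A : Finset (Fin N)) (r : Fin N → Fin 2) (n : Fin N) : Fin 3 :=
  if n ∈ A then (r n).succ else 0

theorem trace_twist_mul (K₂ : Matrix (Fin 2) (Fin 2) ℂ) (ρ : Matrix (Fin 3) (Fin 3) ℂ) :
    (twist 0 K₂ * ρ).trace = ∑ j : Fin 2, ∑ i : Fin 2, K₂ j i * ρ i.succ j.succ := by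
  simp only [Matrix.trace, Matrix.diag_apply, Matrix.mul_apply, Fin.sum_univ_three,
    Fin.sum_univ_two, twist]
  simp

theorem lax_zero_succ_of_iff (η x : ℂ) {s t : Fin 3} (h : s = 0 ↔ t = 0) (j : Fin 2) :
    lax η x s t 0 j.succ = 0 := by
  have h1 : ¬ (0 = j.succ ∧ s = t) := fun h => (Fin.succ_ne_zero j) h.1.symm
  have h2 : ¬ (0 = t ∧ s = j.succ) := fun h' => (Fin.succ_ne_zero j) (by
    rw [← h'.2]
    exact h.mpr h'.1.symm)
  simp only [lax, Matrix.of_apply]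
  rw [if_neg h1, if_neg h2, add_zero]

/-- On odd auxiliary states an odd site contributes `-(x - ξ n - η P)` and an even site the scalar
`x - ξ n`. The signs of the odd sites cancel `fsign`, and the scalars make up `d_{Aᶜ}`. -/
theorem transfer_embed {N : ℕ} (η : ℂ) (K₂ : Matrix (Fin 2) (Fin 2) ℂ) (ξ : Fin N → ℂ) (x : ℂ)
    (A : Finset (Fin N)) (r r' : Fin N → Fin 2) (hr : ∀ n, n ∉ A → r' n = r n) :
    transfer η (twist 0 K₂) ξ x (embed A r) (embed A r')
      = -((nodal Aᶜ ξ).eval x * chainTransfer η K₂ ξ A x r r') := by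
  have hb := oprod_block (W := fun n => lax η (x - ξ n) (embed A r n) (embed A r' n))
    (c := fun n => if n ∈ A then -1 else x - ξ n)
    (w := fun n => chainLax η ξ A x n (r n) (r' n))
    (fun n j => lax_zero_succ_of_iff _ _ (by simp [embed]) j)
    (fun n i j => by
      by_cases hn : n ∈ A
      · simp only [embed, if_pos hn, chainLax, lax, oddLax, Matrix.of_apply, Fin.succ_inj]
        have : ∀ i : Fin 2, parity i.succ = 1 := by
          intro i
          fin_cases i <;> rfl
        rw [this, this]
        split_ifs <;> ring
      · simp only [embed, if_neg hn, chainLax, lax, Matrix.of_apply, Fin.succ_inj, hr n hn]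
        have h0 : ∀ i : Fin 2, ¬ (i.succ = 0 ∧ (0 : Fin 3) = j.succ) := fun i h =>
          Fin.succ_ne_zero i h.1
        rw [if_neg (h0 i)]
        simp [parity, Matrix.one_apply])
  rw [transfer_twist_apply]
  congr 1
  simp only [bareTransfer, Matrix.of_apply]
  rw [trace_twist_mul]
  have hprod : (∏ n, if n ∈ A then (-1 : ℂ) else x - ξ n)
      = fsign (embed A r) * (nodal Aᶜ ξ).eval x := by
    rw [eval_nodal, fsign, ← Finset.prod_filter_mul_prod_filter_not Finset.univ (· ∈ A),
      ← Finset.prod_filter_mul_prod_filter_not Finset.univ (· ∈ A)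
        (fun n => (-1 : ℂ) ^ parity (embed A r n))]
    have h1 : (Finset.univ.filter fun n => n ∉ A) = Aᶜ := by
      ext n
      simp
    have h2 : ∏ n ∈ Finset.univ.filter (fun n => n ∉ A), (-1 : ℂ) ^ parity (embed A r n) = 1 := by
      refine Finset.prod_eq_one fun n hn => ?_
      simp [embed, (Finset.mem_filter.mp hn).2, parity]
    rw [h2, mul_one, h1]
    congr 1
    · refine Finset.prod_congr rfl fun n hn => ?_
      have : ∀ i : Fin 2, parity i.succ = 1 := by
        intro i
        fin_cases i <;> rfl
      rw [if_pos (Finset.mem_filter.mp hn).2, embed, if_pos (Finset.mem_filter.mp hn).2, this,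
        pow_one]
    · refine Finset.prod_congr rfl fun n hn => ?_
      rw [if_neg (Finset.mem_compl.mp hn)]
  simp only [chainTransfer, Matrix.of_apply, Matrix.trace, Matrix.diag_apply, Matrix.mul_apply,
    hb.2, hprod, Finset.mul_sum]
  refine Finset.sum_congr rfl fun j _ => Finset.sum_congr rfl fun i _ => ?_
  linear_combination ((nodal Aᶜ ξ).eval x * (K₂ j i
    * (oprod fun n => chainLax η ξ A x n (r n) (r' n)) i j)) * fsign_mul_self (embed A r)

/-- The set of even sites of a state, with the lexicographic order. -/
def evenSites {N : ℕ} (s : Fin N → Fin 3) : Lex (Fin N → Bool) := toLex fun n => decide (s n = 0)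

/-- The transfer matrix is block triangular with respect to the set of even sites. -/
theorem transfer_eq_zero_of_lt {N : ℕ} (η : ℂ) (K₂ : Matrix (Fin 2) (Fin 2) ℂ) (ξ : Fin N → ℂ)
    (x : ℂ) {s t : Fin N → Fin 3} (h : evenSites t < evenSites s) :
    transfer η (twist 0 K₂) ξ x s t = 0 := by
  -- At the first site `c` where the sets of even sites differ, `s` is even and `t` is odd, so the
  -- local matrix annihilates odd auxiliary vectors.
  obtain ⟨c, hc, hlt⟩ := h
  have hc' : ∀ n < c, (s n = 0 ↔ t n = 0) := fun n hn => by
    have := hc n hn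
    simpa [evenSites, eq_comm] using this.symm
  have hs : s c = 0 ∧ t c ≠ 0 := by
    have := Bool.lt_iff.mp hlt
    simpa [evenSites, and_comm] using this
  rw [transfer_twist_apply, bareTransfer, Matrix.of_apply, trace_twist_mul]
  rw [Finset.sum_eq_zero, mul_zero, neg_zero]
  intro j _
  refine Finset.sum_eq_zero fun i _ => ?_
  rw [oprod_apply_succ_eq_zero c (fun n hn j => lax_zero_succ_of_iff _ _ (hc' n hn) j), mul_zero]
  intro i j
  have h1 : ¬ (i = j.succ ∧ s c = t c) := fun h => hs.2 (h.2 ▸ hs.1)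
  have h2 : ¬ (i = t c ∧ s c = j.succ) := fun h => Fin.succ_ne_zero j (h.2 ▸ hs.1)
  simp only [lax, Matrix.of_apply]
  rw [if_neg h1, if_neg h2, add_zero]

theorem evenSites_eq_iff {N : ℕ} {s t : Fin N → Fin 3} :
    evenSites s = evenSites t ↔ ∀ n, (s n = 0 ↔ t n = 0) := by
  rw [evenSites, evenSites, toLex_inj, funext_iff]
  simp

/-- An eigenvector of the transfer matrix gives an eigenvector of the `gl_2` chain on some set of
sites. -/
theorem IsTransferEigenvalue.exists_chain {N : ℕ} {η : ℂ} {K₂ : Matrix (Fin 2) (Fin 2) ℂ}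
    {ξ : Fin N → ℂ} {t : ℂ → ℂ} (h : IsTransferEigenvalue η (twist 0 K₂) ξ t) :
    ∃ (A : Finset (Fin N)) (w : (Fin N → Fin 2) → ℂ), w ≠ 0 ∧ ∀ x,
      t x • w = -(nodal Aᶜ ξ).eval x • (chainTransfer η K₂ ξ A x).mulVec w := by
  obtain ⟨v, hv, hTv⟩ := h
  obtain ⟨s₁, hs₁⟩ := Function.ne_iff.mp hv
  -- In a row of the block of a maximal element of the support, larger blocks contribute nothing by
  -- maximality and smaller ones by triangularity. The restriction of `v` to that block is therefore
  -- an eigenvector of the diagonal block.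
  obtain ⟨s₀, hs₀, hmax⟩ := Finset.exists_max_image (Finset.univ.filter fun s => v s ≠ 0) evenSites
    ⟨s₁, by simpa using hs₁⟩
  have hs₀' : v s₀ ≠ 0 := (Finset.mem_filter.mp hs₀).2
  have hmax' : ∀ s, evenSites s₀ < evenSites s → v s = 0 := by
    intro s hs
    by_contra hne
    exact absurd (hmax s (by simpa using hne)) (not_le.mpr hs)
  let A : Finset (Fin N) := Finset.univ.filter fun n => s₀ n ≠ 0
  -- Below, `pr` inverts `Fin.succ` on odd states; its value at the even state is arbitrary.
  have hA : ∀ n, n ∈ A ↔ s₀ n ≠ 0 := fun n => by simp [A]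
  let pr : Fin 3 → Fin 2 := ![0, 0, 1]
  have hpr1 : ∀ a : Fin 2, pr a.succ = a := by
    intro a
    fin_cases a <;> rfl
  have hpr2 : ∀ b : Fin 3, b ≠ 0 → (pr b).succ = b := by
    intro b hb
    fin_cases b
    · exact absurd rfl hb
    · rfl
    · rfl
  have hemb : ∀ r, evenSites (embed A r) = evenSites s₀ := by
    intro r
    rw [evenSites_eq_iff]
    intro n
    by_cases hn : n ∈ A
    · simp [embed, hn, (hA n).mp hn]
    · have : s₀ n = 0 := by simpa [hA] using hn
      simp [embed, hn, this]
  have hback : ∀ s (r : Fin N → Fin 2), evenSites s = evenSites s₀ →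
      embed A (fun n => if n ∈ A then pr (s n) else r n) = s := by
    intro s r hs
    rw [evenSites_eq_iff] at hs
    funext n
    by_cases hn : n ∈ A
    · have : s n ≠ 0 := fun h => (hA n).mp hn ((hs n).mp h)
      simp [embed, hn, hpr2 _ this]
    · have : s₀ n = 0 := by simpa [hA] using hn
      simp [embed, hn, (hs n).mpr this]
  refine ⟨A, fun r => v (embed A r), ?_, ?_⟩
  · intro h0
    refine hs₀' ?_
    exact (congrArg v (hback s₀ 0 rfl)).symm.trans (congrFun h0 _)
  · intro x
    funext r
    have h1 := congrFun (hTv x) (embed A r)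
    simp only [Pi.smul_apply, smul_eq_mul, Matrix.mulVec, dotProduct] at h1 ⊢
    rw [← h1, Finset.mul_sum]
    rw [← Finset.sum_filter_of_ne (p := fun s => evenSites s = evenSites s₀) (f := fun s =>
      transfer η (twist 0 K₂) ξ x (embed A r) s * v s)]
    · rw [← Finset.sum_filter_of_ne (p := fun r' : Fin N → Fin 2 => ∀ n, n ∉ A → r' n = r n)]
      · symm
        refine Finset.sum_nbij' (fun r' => embed A r')
          (fun s n => if n ∈ A then pr (s n) else r n) ?_ ?_ ?_ ?_ ?_
        · intro r' _
          simpa using hemb r'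
        · intro s _
          simp +contextual
        · intro r' hr'
          funext n
          by_cases hn : n ∈ A
          · simp [embed, hn, hpr1]
          · simp [hn, (Finset.mem_filter.mp hr').2 n hn]
        · intro s hs
          exact hback s r (Finset.mem_filter.mp hs).2
        · intro r' hr'
          rw [transfer_embed η K₂ ξ x A r r' (Finset.mem_filter.mp hr').2]
          ring
      · intro r' _ hne n hn
        by_contra hrn
        apply hne
        have hz : oprod (fun n => chainLax η ξ A x n (r n) (r' n)) = 0 := by
          rw [oprod]
          refine List.prod_eq_zero (List.mem_reverse.mpr ?_)
          rw [List.mem_ofFn]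
          exact ⟨n, by simp [chainLax, hn, Ne.symm hrn]⟩
        simp [chainTransfer, hz]
    · intro s _ hne
      rcases lt_trichotomy (evenSites s) (evenSites s₀) with hlt | heq | hgt
      · rw [← hemb r] at hlt
        rw [transfer_eq_zero_of_lt η K₂ ξ x hlt, zero_mul] at hne
        exact absurd rfl hne
      · exact heq
      · rw [hmax' s hgt, mul_zero] at hne
        exact absurd rfl hne

end GL12

namespace GL12

open Matrix Polynomial Lagrange
open scoped Kronecker

/-! ### Fusion -/

theorem trace_eq_of_rank_one {m : Type*} [Fintype m] {X : Matrix m m ℂ} {w y : m → ℂ} {c : ℂ}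
    (hw : w ≠ 0) (hX : X = Matrix.vecMulVec w y) (hc : X.mulVec w = c • w) : X.trace = c := by
  obtain ⟨i, hi⟩ := Function.ne_iff.mp hw
  have h1 := congrFun hc i
  rw [hX, Matrix.vecMulVec_mulVec] at h1
  simp only [Pi.smul_apply, smul_eq_mul, MulOpposite.smul_eq_mul_unop, MulOpposite.unop_op] at h1
  have h2 : y ⬝ᵥ w = c := mul_right_cancel₀ hi (by rw [← h1, mul_comm])
  rw [hX, Matrix.trace_vecMulVec, dotProduct_comm, h2]

theorem oprod_mulVec {m : Type*} [Fintype m] [DecidableEq m] {n : ℕ} {E : Fin n → Matrix m m ℂ}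
    {w : m → ℂ} {c : Fin n → ℂ} (h : ∀ i, (E i).mulVec w = c i • w) :
    (oprod E).mulVec w = (∏ i, c i) • w := by
  induction n with
  | zero => simp
  | succ n ih =>
    rw [oprod_succ, ← Matrix.mulVec_mulVec, ih fun i => h _, Matrix.mulVec_smul, h, smul_smul,
      Fin.prod_univ_castSucc]

theorem exists_oprod_eq_vecMulVec {m : Type*} [Fintype m] [DecidableEq m] {n : ℕ}
    {E : Fin n → Matrix m m ℂ} {w : m → ℂ} {c : Fin n → ℂ} (h : ∀ i, (E i).mulVec w = c i • w)
    (k : Fin n) {y : m → ℂ} (hk : E k = Matrix.vecMulVec w y) :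
    ∃ y', oprod E = Matrix.vecMulVec w y' := by
  induction n with
  | zero => exact k.elim0
  | succ n ih =>
    rw [oprod_succ]
    rcases Fin.eq_castSucc_or_eq_last k with ⟨k, rfl⟩ | rfl
    · obtain ⟨y', hy'⟩ := ih (fun i => h _) k hk
      refine ⟨c (Fin.last n) • y', ?_⟩
      rw [hy', Matrix.mul_vecMulVec, h, Matrix.smul_vecMulVec, Matrix.vecMulVec_smul]
    · exact ⟨y ᵥ* oprod fun i => E i.castSucc, by rw [hk, Matrix.vecMulVec_mul]⟩

/-- The antisymmetric vector of two auxiliary spaces. -/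
def singlet (p : Fin 2 × Fin 2) : ℂ := (!![0, 1; -1, 0] : Matrix (Fin 2) (Fin 2) ℂ) p.1 p.2

theorem singlet_ne_zero : singlet ≠ 0 := by
  intro h
  have := congrFun h (0, 1)
  simp [singlet] at this

/-- The antisymmetric tensors in two copies of `ℂ²` form a line, on which `K₂ ⊗ K₂` acts by the
determinant. -/
theorem kronecker_mulVec_singlet (K₂ : Matrix (Fin 2) (Fin 2) ℂ) :
    (K₂ ⊗ₖ K₂).mulVec singlet = K₂.det • singlet := by
  funext ⟨i, j⟩
  simp only [Matrix.mulVec, dotProduct, Fintype.sum_prod_type, Fin.sum_univ_two,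
    Matrix.kroneckerMap_apply, Pi.smul_apply, smul_eq_mul, Matrix.det_fin_two, singlet]
  fin_cases i <;> fin_cases j <;> simp <;> ring

/-- The shift by `η` between the two spectral parameters is the one for which the singlet is
preserved; the scalar is the quantum determinant of a site. -/
theorem sum_oddLax_mulVec_singlet (η x : ℂ) (s u : Fin 2) :
    (∑ c, oddLax η x s c ⊗ₖ oddLax η (x + η) c u).mulVec singlet
      = (if s = u then (x + η) * (x - η) else 0) • singlet := by
  funext ⟨i, j⟩
  simp only [Matrix.mulVec, dotProduct, Fintype.sum_prod_type, Fin.sum_univ_two, Matrix.add_apply,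
    Matrix.kroneckerMap_apply, Pi.smul_apply, smul_eq_mul, singlet, oddLax, Matrix.of_apply]
  fin_cases s <;> fin_cases u <;> fin_cases i <;> fin_cases j <;> simp <;> ring

/-- At spectral parameter `0` the first factor is `-η P` and the second is `η (1 - P)`, so their
product has its auxiliary image in the antisymmetric vectors. -/
theorem sum_oddLax_eq_vecMulVec (η : ℂ) (s u : Fin 2) :
    ∃ y, ∑ c, oddLax η 0 s c ⊗ₖ oddLax η (0 + η) c u = Matrix.vecMulVec singlet y := by
  refine ⟨fun q => (∑ c, oddLax η 0 s c ⊗ₖ oddLax η (0 + η) c u) (0, 1) q, ?_⟩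
  ext ⟨i, j⟩ ⟨k, l⟩
  simp only [Matrix.vecMulVec_apply, Fin.sum_univ_two, Matrix.add_apply,
    Matrix.kroneckerMap_apply, singlet, oddLax, Matrix.of_apply]
  fin_cases s <;> fin_cases u <;> fin_cases i <;> fin_cases j <;> fin_cases k <;> fin_cases l <;>
    simp

theorem sum_chainLax_mulVec_singlet {ι : Type*} [DecidableEq ι] (η : ℂ) (ξ : ι → ℂ) (A : Finset ι)
    (x : ℂ) (n : ι) (s u : Fin 2) :
    (∑ c, chainLax η ξ A x n s c ⊗ₖ chainLax η ξ A (x + η) n c u).mulVec singlet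
      = (if s = u then (if n ∈ A then (x + η - ξ n) * (x - η - ξ n) else 1) else 0) • singlet := by
  by_cases hn : n ∈ A
  · have := sum_oddLax_mulVec_singlet η (x - ξ n) s u
    rw [sub_add_eq_add_sub, sub_sub, add_comm (ξ n), ← sub_sub] at this
    simpa [chainLax, hn] using this
  · simp only [chainLax, if_neg hn]
    have : ∑ c : Fin 2, (if s = c then (1 : Matrix (Fin 2) (Fin 2) ℂ) else 0) ⊗ₖ
        (if c = u then (1 : Matrix (Fin 2) (Fin 2) ℂ) else 0) = if s = u then 1 else 0 := by
      rw [Finset.sum_eq_single s (fun c _ hc => by rw [if_neg hc.symm, Matrix.zero_kronecker])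
        (by simp), if_pos rfl]
      split_ifs <;> simp
    rw [this]
    split_ifs <;> simp

/-- The fusion relation of the transfer matrix of the `gl_2` chain. -/
theorem chainTransfer_mul {N : ℕ} (η : ℂ) (K₂ : Matrix (Fin 2) (Fin 2) ℂ) (ξ : Fin N → ℂ)
    {A : Finset (Fin N)} {n : Fin N} (hn : n ∈ A) :
    chainTransfer η K₂ ξ A (ξ n) * chainTransfer η K₂ ξ A (ξ n + η)
      = (K₂.det * ((nodal A ξ).eval (ξ n + η) * (nodal A ξ).eval (ξ n - η))) •
        (1 : Matrix (Fin N → Fin 2) (Fin N → Fin 2) ℂ) := by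
  ext s u
  have h := sum_trace_mul_trace K₂ (fun i c => chainLax η ξ A (ξ n) i (s i) c)
    (fun i c => chainLax η ξ A (ξ n + η) i c (u i))
  rw [Matrix.mul_apply]
  simp only [chainTransfer, Matrix.of_apply]
  rw [h]
  have hE := fun i => sum_chainLax_mulVec_singlet η ξ A (ξ n) i (s i) (u i)
  obtain ⟨y, hy⟩ := sum_oddLax_eq_vecMulVec η (s n) (u n)
  -- One factor with image in the singlet line, while all factors preserve that line, makes the
  -- whole product rank at most one; its trace is then its eigenvalue on the singlet.
  obtain ⟨y', hy'⟩ := exists_oprod_eq_vecMulVec hE n (y := y) (by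
    rw [← hy]
    simp [chainLax, hn])
  refine trace_eq_of_rank_one singlet_ne_zero (y := K₂.det • y') ?_ ?_
  · rw [hy', Matrix.mul_vecMulVec, kronecker_mulVec_singlet, Matrix.smul_vecMulVec,
      Matrix.vecMulVec_smul]
  · rw [← Matrix.mulVec_mulVec, oprod_mulVec hE, Matrix.mulVec_smul, kronecker_mulVec_singlet,
      smul_smul]
    congr 1
    rw [Matrix.smul_apply, smul_eq_mul, mul_comm, mul_assoc]
    congr 1
    rw [eval_nodal, eval_nodal, ← Finset.prod_mul_distrib, Matrix.one_apply]
    by_cases hsu : s = u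
    · subst hsu
      simp [Finset.prod_ite_mem]
    · rw [if_neg hsu, mul_zero]
      obtain ⟨i, hi⟩ := Function.ne_iff.mp hsu
      exact Finset.prod_eq_zero (Finset.mem_univ i) (if_neg hi)

/-! ### Polynomial dependence on the spectral parameter -/

/-- `f` is a polynomial function of degree at most `m` whose coefficient of degree `m` is `c`. -/
def HasTopCoeff (m : ℕ) (c : ℂ) (f : ℂ → ℂ) : Prop :=
  ∃ p : ℂ[X], p.natDegree ≤ m ∧ p.coeff m = c ∧ ∀ x, f x = p.eval x

namespace HasTopCoeff

theorem mul {m m' : ℕ} {c c' : ℂ} {f g : ℂ → ℂ} (hf : HasTopCoeff m c f)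
    (hg : HasTopCoeff m' c' g) : HasTopCoeff (m + m') (c * c') fun x => f x * g x := by
  obtain ⟨p, hp, hpc, hpe⟩ := hf
  obtain ⟨q, hq, hqc, hqe⟩ := hg
  exact ⟨p * q, natDegree_mul_le_of_le hp hq, by
    rw [coeff_mul_add_eq_of_natDegree_le hp hq, hpc, hqc], fun x => by simp only [eval_mul, hpe, hqe]⟩

theorem const (c : ℂ) : HasTopCoeff 0 c fun _ => c := ⟨C c, by simp⟩

theorem sum {ι : Type*} (s : Finset ι) {m : ℕ} {c : ι → ℂ} {f : ι → ℂ → ℂ}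
    (hf : ∀ i ∈ s, HasTopCoeff m (c i) (f i)) :
    HasTopCoeff m (∑ i ∈ s, c i) fun x => ∑ i ∈ s, f i x := by
  classical
  induction s using Finset.induction_on with
  | empty => exact ⟨0, by simp⟩
  | insert a s ha ih =>
    obtain ⟨p, hp, hpc, hpe⟩ := hf a (by simp)
    obtain ⟨q, hq, hqc, hqe⟩ := ih fun i hi => hf i (by simp [hi])
    simp only [Finset.sum_insert ha]
    exact ⟨p + q, natDegree_add_le_of_degree_le hp hq, by rw [coeff_add, hpc, hqc],
      fun x => by rw [eval_add, ← hpe, ← hqe]⟩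

theorem oprod {l : Type*} [Fintype l] [DecidableEq l] {n : ℕ} {W : ℂ → Fin n → Matrix l l ℂ}
    {m : Fin n → ℕ} {c : Fin n → Matrix l l ℂ}
    (hW : ∀ k i j, HasTopCoeff (m k) (c k i j) fun x => W x k i j) (i j : l) :
    HasTopCoeff (∑ k, m k) (oprod c i j) fun x => GL12.oprod (W x) i j := by
  induction n generalizing i with
  | zero => simpa using const _
  | succ n ih =>
    simp only [oprod_succ, Matrix.mul_apply]
    rw [Fin.sum_univ_castSucc, add_comm]
    exact sum _ fun k _ => (hW _ i k).mul (ih (fun k => hW k.castSucc) k)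

end HasTopCoeff

theorem hasTopCoeff_chainLax {ι : Type*} [DecidableEq ι] (η : ℂ) (ξ : ι → ℂ) (A : Finset ι)
    (n : ι) (s t i j : Fin 2) : HasTopCoeff (if n ∈ A then 1 else 0)
      ((if s = t then (1 : Matrix (Fin 2) (Fin 2) ℂ) else 0) i j)
      fun x => chainLax η ξ A x n s t i j := by
  by_cases hn : n ∈ A
  · simp only [chainLax, if_pos hn, oddLax, Matrix.of_apply]
    refine ⟨(if i = j ∧ s = t then X - C (ξ n) else 0) - C (if i = t ∧ s = j then η else 0), ?_, ?_,
      ?_⟩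
    · refine (natDegree_sub_C).le.trans ?_
      split_ifs
      · exact (natDegree_X_sub_C _).le
      · simp
    · rw [coeff_sub, coeff_C_of_ne_zero one_ne_zero, sub_zero]
      by_cases h1 : i = j <;> by_cases h2 : s = t <;> simp [h1, h2, Matrix.one_apply]
    · intro x
      rw [eval_sub, eval_C]
      split_ifs <;> simp
  · simp only [chainLax, if_neg hn]
    exact HasTopCoeff.const _

/-- Only the identity part of each local matrix contributes to the highest power of `x`, which
leaves the trace of the twist. -/
theorem hasTopCoeff_chainTransfer {N : ℕ} (η : ℂ) (K₂ : Matrix (Fin 2) (Fin 2) ℂ) (ξ : Fin N → ℂ)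
    (A : Finset (Fin N)) (s t : Fin N → Fin 2) :
    HasTopCoeff A.card (if s = t then K₂.trace else 0) fun x => chainTransfer η K₂ ξ A x s t := by
  have hcard : A.card = 0 + ∑ n, if n ∈ A then 1 else 0 := by simp
  have hone : ∀ n : ℕ, oprod (fun _ : Fin n => (1 : Matrix (Fin 2) (Fin 2) ℂ)) = 1 := by
    intro n
    simp [oprod]
  have htop : (if s = t then K₂.trace else 0) = ∑ i : Fin 2, ∑ j : Fin 2, K₂ i j
      * oprod (fun n => if s n = t n then (1 : Matrix (Fin 2) (Fin 2) ℂ) else 0) j i := by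
    by_cases hst : s = t
    · subst hst
      simp only [if_true, hone]
      simp [Matrix.trace, Matrix.one_apply]
    · have hz : oprod (fun n => if s n = t n then (1 : Matrix (Fin 2) (Fin 2) ℂ) else 0) = 0 := by
        obtain ⟨n, hn⟩ := Function.ne_iff.mp hst
        rw [oprod]
        refine List.prod_eq_zero (List.mem_reverse.mpr ?_)
        rw [List.mem_ofFn]
        exact ⟨n, if_neg hn⟩
      simp [hst, hz]
  rw [htop, hcard]
  simp only [chainTransfer, Matrix.of_apply, Matrix.trace, Matrix.diag_apply, Matrix.mul_apply]
  exact HasTopCoeff.sum _ fun i _ => HasTopCoeff.sum _ fun j _ =>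
    (HasTopCoeff.const _).mul (HasTopCoeff.oprod (fun n => hasTopCoeff_chainLax η ξ A n _ _) j i)

/-- Every eigenvalue of the transfer matrix comes from a fusion solution. -/
theorem IsTransferEigenvalue.exists_fusionSolution {N : ℕ} {η k₂ k₃ : ℂ} (hη : η ≠ 0)
    {K₂ : Matrix (Fin 2) (Fin 2) ℂ} (hdet : K₂.det = k₂ * k₃) (htr : K₂.trace = k₂ + k₃)
    {ξ : Fin N → ℂ} (hs : IsSeparated η ξ) {t : ℂ → ℂ}
    (h : IsTransferEigenvalue η (twist 0 K₂) ξ t) :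
    ∃ (A : Finset (Fin N)) (Λ : ℂ[X]), IsFusionSolution η k₂ k₃ ξ A Λ ∧
      ∀ x, t x = -((nodal Aᶜ ξ).eval x * Λ.eval x) := by
  obtain ⟨A, w, hw, hx⟩ := h.exists_chain
  obtain ⟨s, hs0⟩ := Function.ne_iff.mp hw
  have hs0 : w s ≠ 0 := hs0
  obtain ⟨p, hp, hpc, hpe⟩ : HasTopCoeff A.card (K₂.trace * w s)
      fun x => (chainTransfer η K₂ ξ A x).mulVec w s := by
    have := HasTopCoeff.sum Finset.univ fun u _ =>
      (hasTopCoeff_chainTransfer η K₂ ξ A s u).mul (HasTopCoeff.const (w u))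
    simpa [Matrix.mulVec, dotProduct] using this
  replace hpe : ∀ x, (chainTransfer η K₂ ξ A x).mulVec w s = p.eval x := hpe
  let Λ : ℂ[X] := C (w s)⁻¹ * p
  have ht : ∀ x, t x = -((nodal Aᶜ ξ).eval x * Λ.eval x) := by
    intro x
    have h1 := congrFun (hx x) s
    rw [Pi.smul_apply, Pi.smul_apply, smul_eq_mul, smul_eq_mul, hpe] at h1
    simp only [Λ, eval_mul, eval_C]
    field_simp
    linear_combination h1
  -- Dividing by `d_{Aᶜ}` is legitimate at the only points where fusion needs it: `ξ n` with `n ∈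
  -- A`, and `ξ n + η`.
  have hτ : ∀ x, (nodal Aᶜ ξ).eval x ≠ 0 →
      (chainTransfer η K₂ ξ A x).mulVec w = Λ.eval x • w := by
    intro x hx0
    have h1 := hx x
    rw [ht x] at h1
    funext u
    have h2 := congrFun h1 u
    simp only [Pi.smul_apply, smul_eq_mul] at h2 ⊢
    exact mul_left_cancel₀ hx0 (by linear_combination h2)
  refine ⟨A, Λ, ⟨(natDegree_C_mul_le _ _).trans hp, ?_, fun n hn => ?_⟩, ht⟩
  · rw [coeff_C_mul, hpc, htr]
    field_simp
  · have h1 : (nodal Aᶜ ξ).eval (ξ n) ≠ 0 := by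
      rw [eval_nodal, Finset.prod_ne_zero_iff]
      intro m hm h0
      exact Finset.mem_compl.mp hm (hs.inj (sub_eq_zero.mp h0) ▸ hn)
    have h2 := congrArg (fun M => M.mulVec w) (chainTransfer_mul η K₂ ξ hn)
    simp only [← Matrix.mulVec_mulVec, hτ _ h1, hτ _ (hs.nodal_add_ne hη n), Matrix.mulVec_smul,
      Matrix.smul_mulVec, Matrix.one_mulVec, smul_smul, hdet] at h2
    have h3 := congrFun h2 s
    rw [Pi.smul_apply, Pi.smul_apply, smul_eq_mul, smul_eq_mul] at h3
    linear_combination mul_right_cancel₀ hs0 h3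

end GL12

namespace GL12

open Matrix Polynomial Lagrange
open scoped Topology

/-! ### Simple spectrum -/

/-- The matrix has as many distinct eigenvalues as its size. -/
def HasSimpleSpectrum {m : Type*} [Fintype m] (M : Matrix m m ℂ) : Prop :=
  ∃ (y : m → ℂ) (v : m → m → ℂ), Function.Injective y ∧
    ∀ s, v s ≠ 0 ∧ M.mulVec (v s) = y s • v s

theorem HasSimpleSpectrum.smul {m : Type*} [Fintype m] {M : Matrix m m ℂ} (h : HasSimpleSpectrum M) {c : ℂ} (hc : c ≠ 0) :
    HasSimpleSpectrum (c • M) := by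
  obtain ⟨y, v, hy, hv⟩ := h
  refine ⟨fun s => c * y s, v, fun s t hst => hy (mul_left_cancel₀ hc hst), fun s =>
    ⟨(hv s).1, ?_⟩⟩
  rw [Matrix.smul_mulVec, (hv s).2, smul_smul]

section

variable {m : Type*} [Fintype m] [DecidableEq m]

theorem isRoot_charpoly_iff {M : Matrix m m ℂ} {y : ℂ} :
    M.charpoly.IsRoot y ↔ ∃ v, v ≠ 0 ∧ M.mulVec v = y • v := by
  rw [IsRoot.def, Matrix.eval_charpoly, ← Matrix.exists_mulVec_eq_zero_iff]
  refine exists_congr fun v => and_congr_right fun _ => ?_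
  rw [Matrix.sub_mulVec, sub_eq_zero, Matrix.scalar_apply, ← Matrix.smul_one_eq_diagonal,
    Matrix.smul_mulVec, Matrix.one_mulVec]
  exact eq_comm

theorem hasSimpleSpectrum_iff_separable {M : Matrix m m ℂ} :
    HasSimpleSpectrum M ↔ M.charpoly.Separable := by
  constructor
  · rintro ⟨y, v, hy, hv⟩
    have hdvd : ∏ s, (X - C (y s)) ∣ M.charpoly :=
      Finset.prod_dvd_of_coprime (fun s _ t _ hst => pairwise_coprime_X_sub_C hy hst)
        fun s _ => dvd_iff_isRoot.mpr (isRoot_charpoly_iff.mpr ⟨v s, hv s⟩)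
    have h : M.charpoly = ∏ s, (X - C (y s)) :=
      eq_of_monic_of_dvd_of_natDegree_le (monic_prod_X_sub_C y Finset.univ)
        (Matrix.charpoly_monic M) hdvd (by
          rw [Matrix.charpoly_natDegree_eq_dim,
            natDegree_prod_of_monic _ _ fun s _ => monic_X_sub_C _]
          simp)
    rw [h]
    exact separable_prod_X_sub_C_iff.mpr hy
  · intro h
    have hcard : M.charpoly.roots.toFinset.card = Fintype.card m := by
      rw [Multiset.toFinset_card_of_nodup (nodup_roots h), ← Matrix.charpoly_natDegree_eq_dim M]
      exact (IsAlgClosed.splits _).natDegree_eq_card_roots.symm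
    let e : m ≃ M.charpoly.roots.toFinset := Fintype.equivOfCardEq (by simpa using hcard.symm)
    have hr : ∀ s, ∃ v, v ≠ 0 ∧ M.mulVec v = (e s : ℂ) • v := fun s =>
      isRoot_charpoly_iff.mp (isRoot_of_mem_roots (Multiset.mem_toFinset.mp (e s).2))
    choose v hv using hr
    exact ⟨fun s => e s, v, Subtype.val_injective.comp e.injective, hv⟩

/-- `D` is the resultant of the universal characteristic polynomial and its derivative. The fixed
formal degrees are the true ones for every `M`, because the characteristic polynomial is monic and
the characteristic is zero. -/
theorem exists_discriminant (m : Type*) [Fintype m] [DecidableEq m] :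
    ∃ D : MvPolynomial (m × m) ℂ, ∀ M : Matrix m m ℂ,
      MvPolynomial.eval (fun p => M p.1 p.2) D ≠ 0 ↔ HasSimpleSpectrum M := by
  refine ⟨resultant (Matrix.charpoly.univ ℂ m) (derivative (Matrix.charpoly.univ ℂ m))
    (Fintype.card m) (Fintype.card m - 1), fun M => ?_⟩
  have hmap : (Matrix.charpoly.univ ℂ m).map (MvPolynomial.eval fun p => M p.1 p.2)
      = M.charpoly := Matrix.charpoly.univ_map_eval₂Hom (n := m) (RingHom.id ℂ) fun p => M p.1 p.2
  have hd := Matrix.charpoly_natDegree_eq_dim M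
  have hd' : (derivative M.charpoly).natDegree = Fintype.card m - 1 := by
    rw [natDegree_derivative, hd]
  rw [← resultant_map_map, ← derivative_map, hmap, ← hd', ← hd, hasSimpleSpectrum_iff_separable,
    Ne, resultant_eq_zero_iff, Separable]
  have : M.charpoly ≠ 0 := (Matrix.charpoly_monic M).ne_zero
  tauto

/-- A matrix which commutes with a matrix with simple spectrum has the same eigenvectors. -/
theorem mulVec_eq_smul_of_commute {M T : Matrix m m ℂ} (hT : M * T = T * M) {y : m → ℂ}
    {v : m → m → ℂ} (hy : Function.Injective y) (hv : ∀ s, v s ≠ 0 ∧ M.mulVec (v s) = y s • v s)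
    (s : m) : ∃ c : ℂ, T.mulVec (v s) = c • v s := by
  have hli : LinearIndependent ℂ v :=
    Module.End.eigenvectors_linearIndependent' (Matrix.toLin' M) y hy v fun s =>
      ⟨Module.End.mem_eigenspace_iff.mpr (by rw [Matrix.toLin'_apply, (hv s).2]), (hv s).1⟩
  let b := basisOfLinearIndependentOfCardEqFinrank' v hli (by simp)
  have hb : ∀ r, b r = v r := fun r => by simp [b]
  set a := b.repr (T.mulVec (v s))
  have hsum : T.mulVec (v s) = ∑ r, a r • v r := by
    rw [← b.sum_repr (T.mulVec (v s))]
    simp [hb, a]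
  have h1 : M.mulVec (T.mulVec (v s)) = y s • T.mulVec (v s) := by
    rw [Matrix.mulVec_mulVec, hT, ← Matrix.mulVec_mulVec, (hv s).2, Matrix.mulVec_smul]
  have h2 : ∑ r, (a r * (y r - y s)) • v r = 0 := by
    have h3 : M.mulVec (T.mulVec (v s)) = ∑ r, (a r * y r) • v r := by
      rw [hsum, Matrix.mulVec_sum]
      refine Finset.sum_congr rfl fun r _ => ?_
      rw [Matrix.mulVec_smul, (hv r).2, smul_smul]
    rw [h3, hsum, Finset.smul_sum, ← sub_eq_zero, ← Finset.sum_sub_distrib] at h1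
    rw [← h1]
    refine Finset.sum_congr rfl fun r _ => ?_
    rw [smul_smul, ← sub_smul]
    ring_nf
  have h4 := Fintype.linearIndependent_iff.mp hli _ h2
  refine ⟨a s, ?_⟩
  rw [hsum, Finset.sum_eq_single s (fun r _ hr => ?_) (by simp)]
  rcases mul_eq_zero.mp (h4 r) with h | h
  · rw [h, zero_smul]
  · exact absurd (hy (sub_eq_zero.mp h)) hr

end

/-! ### The transfer matrix at the inhomogeneities -/

/-- The transfer matrix at the `n`-th inhomogeneity, divided by `η`. -/
def siteTransfer {N : ℕ} (η : ℂ) (K : Matrix (Fin 3) (Fin 3) ℂ) (ζ : Fin N → ℂ) (n : Fin N) :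
    Op N :=
  Matrix.of fun s t => -(fsign s * (K * oprod fun m =>
    if m = n then lax 1 0 (s m) (t m) else lax η (ζ n - ζ m) (s m) (t m)).trace)

theorem oprod_smul {m : Type*} [Fintype m] [DecidableEq m] {n : ℕ} (c : Fin n → ℂ)
    (W : Fin n → Matrix m m ℂ) : oprod (fun i => c i • W i) = (∏ i, c i) • oprod W := by
  induction n with
  | zero => simp
  | succ n ih =>
    rw [oprod_succ, oprod_succ, ih, Fin.prod_univ_castSucc, Matrix.smul_mul, Matrix.mul_smul,
      smul_smul, mul_comm (c _)]

/-- Spreading the sites by `ε⁻¹` amounts to weakening the coupling to `ε * η`. At an inhomogeneity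
the local matrix of that site is a pure permutation, which supplies the factor `η` in place of an
`ε⁻¹`. -/
theorem transfer_inv_mul {N : ℕ} (η : ℂ) (K₂ : Matrix (Fin 2) (Fin 2) ℂ) (ζ : Fin N → ℂ)
    (n : Fin N) {ε : ℂ} (hε : ε ≠ 0) :
    transfer η (twist 0 K₂) (fun m => ε⁻¹ * ζ m) (ε⁻¹ * ζ n)
      = (η * ε * ε⁻¹ ^ N) • siteTransfer (ε * η) (twist 0 K₂) ζ n := by
  have hc : η * ε * ε⁻¹ ^ N = ∏ m, if m = n then η else ε⁻¹ := by
    have : ∀ m, (if m = n then η else ε⁻¹) = (if m = n then η * ε else 1) * ε⁻¹ := fun m => by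
      split_ifs
      · field_simp
      · ring
    rw [Finset.prod_congr rfl fun m _ => this m, Finset.prod_mul_distrib]
    simp
  ext s t
  rw [transfer_twist_apply, bareTransfer, Matrix.of_apply, Matrix.smul_apply, siteTransfer,
    Matrix.of_apply, hc, smul_eq_mul]
  have hW : (fun m => lax η (ε⁻¹ * ζ n - ε⁻¹ * ζ m) (s m) (t m)) = fun m =>
      (if m = n then η else ε⁻¹) •
        if m = n then lax 1 0 (s m) (t m) else lax (ε * η) (ζ n - ζ m) (s m) (t m) := by
    funext m
    by_cases h : m = n
    · subst h
      ext i j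
      simp [lax]
    · simp only [if_neg h]
      ext i j
      simp only [lax, Matrix.of_apply, Matrix.smul_apply, smul_eq_mul, mul_add, mul_ite, mul_zero]
      congr 1
      · split_ifs <;> ring
      · split_ifs
        · field_simp
        · rfl
  rw [hW, oprod_smul, Matrix.mul_smul, Matrix.trace_smul, smul_eq_mul]
  ring

theorem continuous_siteTransfer {N : ℕ} (K : Matrix (Fin 3) (Fin 3) ℂ) (ζ : Fin N → ℂ)
    (n : Fin N) : Continuous fun η => siteTransfer η K ζ n := by
  refine continuous_matrix fun s t => ?_
  simp only [siteTransfer, Matrix.of_apply]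
  refine (continuous_const.mul (Continuous.matrix_trace
    (continuous_const.matrix_mul (continuous_oprod fun m => ?_)))).neg
  refine continuous_matrix fun i j => ?_
  by_cases h : m = n
  · simp only [if_pos h]
    exact continuous_const
  · simp only [if_neg h, lax, Matrix.of_apply]
    split_ifs <;> fun_prop

theorem oprod_diagonal {m : Type*} [Fintype m] [DecidableEq m] {N : ℕ} (d : Fin N → m → ℂ) :
    oprod (fun k => diagonal (d k)) = diagonal fun i => ∏ k, d k i := by
  induction N with
  | zero => simp
  | succ N ih =>
    rw [oprod_succ, ih, Matrix.diagonal_mul_diagonal]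
    congr 1
    funext i
    rw [Fin.prod_univ_castSucc, mul_comm]

/-- The diagonal factors on one side of site `n` contribute their entry at `i`, those on the other
side their entry at `j`; `hd` identifies the two. -/
theorem oprod_diagonal_apply {m : Type*} [Fintype m] [DecidableEq m] {N : ℕ}
    (d : Fin N → m → ℂ) (n : Fin N) (B : Fin N → Matrix m m ℂ) {i j : m}
    (hd : ∀ k, d k i = d k j) :
    oprod (fun k => if k = n then B k else diagonal (d k)) i j
      = ∏ k, if k = n then B k i j else d k j := by
  induction N with
  | zero => exact n.elim0
  | succ N ih =>
    rw [oprod_succ, Fin.prod_univ_castSucc]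
    rcases Fin.eq_castSucc_or_eq_last n with ⟨n, rfl⟩ | rfl
    · simp only [(Fin.castSucc_lt_last n).ne', if_false, Fin.castSucc_inj]
      rw [Matrix.diagonal_mul, ih (fun k => d k.castSucc) n (fun k => B k.castSucc)
        fun k => hd k.castSucc, hd, mul_comm]
    · simp only [(Fin.castSucc_lt_last _).ne, if_false, if_true]
      rw [oprod_diagonal, Matrix.mul_diagonal, mul_comm]

/-- Without interaction the transfer matrix at an inhomogeneity acts as the twist at that site. -/
theorem siteTransfer_zero_apply {N : ℕ} (K₂ : Matrix (Fin 2) (Fin 2) ℂ) (ζ : Fin N → ℂ)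
    (n : Fin N) (s t : Fin N → Fin 3) :
    siteTransfer 0 (twist 0 K₂) ζ n s t = (∏ m ∈ Finset.univ.erase n, (ζ n - ζ m)) *
      (twist 0 K₂ (s n) (t n) * ∏ m ∈ Finset.univ.erase n, if s m = t m then 1 else 0) := by
  let d : Fin N → Fin 3 → ℂ := fun m i =>
    (ζ n - ζ m) * ((if s m = t m then 1 else 0) * gsign i (s m))
  have hW : (fun m => if m = n then lax 1 0 (s m) (t m) else lax 0 (ζ n - ζ m) (s m) (t m))
      = fun m => if m = n then lax 1 0 (s m) (t m) else diagonal (d m) := by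
    funext m
    congr 1
    ext i j
    by_cases hij : i = j
    · subst hij
      by_cases h : s m = t m <;> simp [lax, d, gsign, h]
    · simp [lax, hij]
  have hterm : ∀ j i, twist 0 K₂ j i * oprod (fun m => if m = n then lax 1 0 (s m) (t m)
      else lax 0 (ζ n - ζ m) (s m) (t m)) i j
      = twist 0 K₂ j i * (lax 1 0 (s n) (t n) i j * ∏ m ∈ Finset.univ.erase n, d m j) := by
    intro j i
    by_cases hp : parity j = parity i
    · rw [hW, oprod_diagonal_apply d n _ fun k => by simp only [d, gsign, hp],
        ← Finset.mul_prod_erase _ _ (Finset.mem_univ n), if_pos rfl]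
      congr 2
      exact Finset.prod_congr rfl fun m hm => if_neg (Finset.ne_of_mem_erase hm)
    · rw [twist_apply_of_parity_ne K₂ j i hp, zero_mul, zero_mul]
  have hl : ∀ i j, lax 1 0 (s n) (t n) i j = (if i = t n then 1 else 0) * if s n = j then 1 else 0 := by
    intro i j
    by_cases h1 : i = t n <;> simp [lax, h1]
  have htr : (twist 0 K₂ * oprod fun m => if m = n then lax 1 0 (s m) (t m)
      else lax 0 (ζ n - ζ m) (s m) (t m)).trace
      = twist 0 K₂ (s n) (t n) * ∏ m ∈ Finset.univ.erase n, d m (s n) := by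
    simp only [Matrix.trace, Matrix.diag_apply, Matrix.mul_apply, hterm, hl]
    simp
  rw [siteTransfer, Matrix.of_apply, htr]
  simp only [d, Finset.prod_mul_distrib]
  -- An even state at site `n` is killed by the twist. For an odd one the exchange signs with the
  -- other sites cancel `fsign`.
  by_cases h0 : s n = 0
  · have : twist 0 K₂ (s n) (t n) = 0 := by
      rw [h0]
      generalize t n = j
      fin_cases j <;> simp [twist]
    rw [this]
    ring
  · have hp : parity (s n) = 1 := by
      generalize s n = j at h0
      fin_cases j <;> simp_all [parity]
    have hf : fsign s = -∏ m ∈ Finset.univ.erase n, gsign (s n) (s m) := by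
      rw [fsign, ← Finset.mul_prod_erase _ _ (Finset.mem_univ n), hp]
      simp [gsign, hp]
    have hsq := fsign_mul_self s
    rw [hf] at hsq ⊢
    linear_combination (∏ m ∈ Finset.univ.erase n, (ζ n - ζ m)) *
      (twist 0 K₂ (s n) (t n) * ∏ m ∈ Finset.univ.erase n, if s m = t m then 1 else 0) * hsq

/-- The product of vectors `φ (σ n)` over the sites. -/
def productVec {N : ℕ} (φ : Fin 3 → Fin 3 → ℂ) (σ t : Fin N → Fin 3) : ℂ := ∏ n, φ (σ n) (t n)

theorem productVec_ne_zero {N : ℕ} {φ : Fin 3 → Fin 3 → ℂ} (h : ∀ a, φ a ≠ 0)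
    (σ : Fin N → Fin 3) : productVec φ σ ≠ 0 := by
  choose t ht using fun a => Function.ne_iff.mp (h a)
  exact Function.ne_iff.mpr ⟨fun n => t (σ n), Finset.prod_ne_zero_iff.mpr fun n _ => ht _⟩

theorem siteTransfer_zero_mulVec {N : ℕ} (K₂ : Matrix (Fin 2) (Fin 2) ℂ) (ζ : Fin N → ℂ)
    (n : Fin N) {φ : Fin 3 → Fin 3 → ℂ} {κ : Fin 3 → ℂ}
    (hφ : ∀ a, (twist 0 K₂).mulVec (φ a) = κ a • φ a) (σ : Fin N → Fin 3) :
    (siteTransfer 0 (twist 0 K₂) ζ n).mulVec (productVec φ σ)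
      = ((∏ m ∈ Finset.univ.erase n, (ζ n - ζ m)) * κ (σ n)) • productVec φ σ := by
  funext s
  simp only [Matrix.mulVec, dotProduct, siteTransfer_zero_apply, Pi.smul_apply, smul_eq_mul,
    mul_assoc, ← Finset.mul_sum]
  congr 1
  let g : Fin N → Fin 3 → ℂ := fun m j =>
    (if m = n then twist 0 K₂ (s n) j else if s m = j then 1 else 0) * φ (σ m) j
  have h1 : ∀ t : Fin N → Fin 3, twist 0 K₂ (s n) (t n) *
      ((∏ m ∈ Finset.univ.erase n, if s m = t m then 1 else 0) * productVec φ σ t)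
      = ∏ m, g m (t m) := by
    intro t
    simp only [g, Finset.prod_mul_distrib, productVec]
    rw [← Finset.mul_prod_erase (a := n) (f := fun m => if m = n then _ else _) _ (Finset.mem_univ n),
      if_pos rfl, mul_assoc]
    congr 2
    exact Finset.prod_congr rfl fun m hm => (if_neg (Finset.ne_of_mem_erase hm)).symm
  have h2 : ∀ m, ∑ j, g m j = (if m = n then κ (σ n) else 1) * φ (σ m) (s m) := by
    intro m
    by_cases hm : m = n
    · subst hm
      have := congrFun (hφ (σ m)) (s m)
      simpa [g, Matrix.mulVec, dotProduct] using this
    · simp [g, hm]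
  rw [Finset.sum_congr rfl fun t _ => h1 t, ← Fintype.prod_sum g,
    Finset.prod_congr rfl fun m _ => h2 m, Finset.prod_mul_distrib]
  simp [productVec]

/-- Each pair of distinct labels excludes a hyperplane of `γ`, and finitely many hyperplanes do not
cover the space. -/
theorem exists_injective_linear_combination (N : ℕ) {κ : Fin 3 → ℂ} (hκ : Function.Injective κ) :
    ∃ γ : Fin N → ℂ, Function.Injective fun σ : Fin N → Fin 3 => ∑ n, γ n * κ (σ n) := by
  let f (p : {p : (Fin N → Fin 3) × (Fin N → Fin 3) // p.1 ≠ p.2}) : Module.Dual ℂ (Fin N → ℂ) :=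
    ∑ n, (κ (p.1.1 n) - κ (p.1.2 n)) • LinearMap.proj n
  obtain ⟨γ, hγ⟩ := Module.Dual.exists_forall_ne_zero_of_forall_exists f fun p => by
    obtain ⟨n, hn⟩ := Function.ne_iff.mp p.2
    refine ⟨Pi.single n 1, ?_⟩
    simpa [f, Pi.single_apply, sub_eq_zero] using hκ.ne hn
  refine ⟨γ, fun σ τ h => ?_⟩
  by_contra hne
  refine hγ ⟨(σ, τ), hne⟩ ?_
  have h' : ∑ n, γ n * κ (σ n) = ∑ n, γ n * κ (τ n) := h
  rw [← sub_eq_zero, ← Finset.sum_sub_distrib] at h'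
  simp only [f, LinearMap.sum_apply, LinearMap.smul_apply, LinearMap.proj_apply, smul_eq_mul]
  rw [← h']
  exact Finset.sum_congr rfl fun n _ => by ring

/-- The eigenvalues `0`, `k₂`, `k₃` are distinct; the eigenvectors are the even basis vector and the
columns of `W`. -/
theorem hasSimpleSpectrum_twist {k₂ k₃ : ℂ} (hk₂ : k₂ ≠ 0) (hk₃ : k₃ ≠ 0) (hk : k₂ ≠ k₃)
    {K₂ W : Matrix (Fin 2) (Fin 2) ℂ} (hW : IsUnit W)
    (hK₂ : K₂ = W * Matrix.diagonal ![k₂, k₃] * W⁻¹) : HasSimpleSpectrum (twist 0 K₂) := by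
  have hdet : IsUnit W.det := (Matrix.isUnit_iff_isUnit_det W).mp hW
  have hKW : K₂ * W = W * Matrix.diagonal ![k₂, k₃] := by
    rw [hK₂, Matrix.mul_assoc, Matrix.nonsing_inv_mul W hdet, Matrix.mul_one]
  refine ⟨Fin.cons 0 ![k₂, k₃], Fin.cons (Fin.cons 1 0) fun a => Fin.cons 0 fun i => W i a, ?_,
    fun s => ⟨?_, ?_⟩⟩
  · intro i j
    fin_cases i <;> fin_cases j <;> simp [hk₂, hk₃, hk, hk₂.symm, hk₃.symm, hk.symm]
  · refine Fin.cases ?_ (fun a => ?_) s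
    · intro h
      simpa using congrFun h 0
    · intro h
      refine hdet.ne_zero (Matrix.det_eq_zero_of_column_eq_zero a fun i => ?_)
      simpa using congrFun h i.succ
  · refine Fin.cases ?_ (fun a => ?_) s
    · funext i
      fin_cases i <;> simp [Matrix.mulVec, dotProduct, Fin.sum_univ_succ, twist]
    · funext i
      refine Fin.cases ?_ (fun i => ?_) i
      · simp [Matrix.mulVec, dotProduct, Fin.sum_univ_succ, twist]
      · have h1 := congrFun (congrFun hKW i) a
        rw [Matrix.mul_diagonal, Matrix.mul_apply] at h1
        simp only [Matrix.mulVec, dotProduct, Fin.sum_univ_succ (n := 2), Fin.cons_succ,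
          Fin.cons_zero, mul_zero, zero_add, Pi.smul_apply, smul_eq_mul]
        rw [mul_comm (_ : ℂ) (W i a), ← h1]
        refine Finset.sum_congr rfl fun j _ => ?_
        congr 1
        fin_cases i <;> fin_cases j <;> simp [twist]

end GL12

/-! ### Simple spectrum for generic inhomogeneities -/

namespace MvPolynomial.IsPolyFun

variable {σ τ : Type*}

theorem comp_eval (p : MvPolynomial τ ℂ) {g : τ → (σ → ℂ) → ℂ} (hg : ∀ i, IsPolyFun (g i)) :
    IsPolyFun fun x => eval (fun i => g i x) p := by
  choose q hq using hg
  refine ⟨bind₁ q p, fun x => ?_⟩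
  have h := eval₂Hom_bind₁ (RingHom.id ℂ) x q p
  change eval (fun i => g i x) p = eval₂Hom (RingHom.id ℂ) x (bind₁ q p)
  have hg : (fun i => g i x) = fun i => eval x (q i) := _root_.funext fun i => hq i x
  rw [hg]
  exact h.symm

theorem oprod {m : Type*} [Fintype m] [DecidableEq m] {n : ℕ}
    {W : (σ → ℂ) → Fin n → Matrix m m ℂ} (hW : ∀ k i j, IsPolyFun fun x => W x k i j) (i j : m) :
    IsPolyFun fun x => GL12.oprod (W x) i j := by
  induction n generalizing i with
  | zero => simpa using const _
  | succ n ih =>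
    simp only [GL12.oprod_succ, Matrix.mul_apply]
    exact sum _ fun k _ => (hW _ i k).mul (ih (fun k => hW k.castSucc) k)

end MvPolynomial.IsPolyFun

namespace GL12

open Matrix
open scoped Topology

theorem isPolyFun_transfer {N : ℕ} (η : ℂ) (K₂ : Matrix (Fin 2) (Fin 2) ℂ) (n : Fin N)
    (s t : Fin N → Fin 3) :
    MvPolynomial.IsPolyFun fun ξ : Fin N → ℂ => transfer η (twist 0 K₂) ξ (ξ n) s t := by
  have h : ∀ ξ : Fin N → ℂ, transfer η (twist 0 K₂) ξ (ξ n) s t = (-fsign s) * ∑ j, ∑ i,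
      twist 0 K₂ j i * oprod (fun m => lax η (ξ n - ξ m) (s m) (t m)) i j := by
    intro ξ
    rw [transfer_twist_apply, bareTransfer, Matrix.of_apply, neg_mul]
    rfl
  simp only [h]
  refine (MvPolynomial.IsPolyFun.const _).mul (.sum _ fun j _ => .sum _ fun i _ =>
    (MvPolynomial.IsPolyFun.const _).mul (.oprod (fun m i j => ?_) i j))
  simp only [lax, Matrix.of_apply]
  refine .add ?_ (.const _)
  split_ifs
  · exact ((MvPolynomial.IsPolyFun.coord n).sub (.coord m)).mul (.const _)
  · exact .const _

/-- For generic inhomogeneities the transfer matrix has as many eigenvalues as the dimension of the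
quantum space. -/
theorem exists_polynomial_isTransferEigenvalue (N : ℕ) {η : ℂ} (hη : η ≠ 0)
    {K₂ : Matrix (Fin 2) (Fin 2) ℂ} (hK : HasSimpleSpectrum (twist 0 K₂)) :
    ∃ P : MvPolynomial (Fin N) ℂ, P ≠ 0 ∧ ∀ ξ, MvPolynomial.eval ξ P ≠ 0 →
      ∃ t : (Fin N → Fin 3) → ℂ → ℂ, Function.Injective t ∧
        ∀ σ, IsTransferEigenvalue η (twist 0 K₂) ξ (t σ) := by
  obtain ⟨κ, φ, hκ, hφ⟩ := hK
  obtain ⟨γ, hγ⟩ := exists_injective_linear_combination N hκ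
  let ζ : Fin N → ℂ := fun n => ((n : ℕ) : ℂ)
  have hζ : ∀ n, ∏ m ∈ Finset.univ.erase n, (ζ n - ζ m) ≠ 0 := fun n =>
    Finset.prod_ne_zero_iff.mpr fun m hm => sub_ne_zero.mpr fun h =>
      Finset.ne_of_mem_erase hm (Fin.ext (Nat.cast_injective h.symm))
  -- With these weights the decoupled operator `Z 0` has the eigenvalues `∑ n, γ n * κ (σ n)`, which
  -- are distinct by the choice of `γ`.
  let c : Fin N → ℂ := fun n => γ n * (∏ m ∈ Finset.univ.erase n, (ζ n - ζ m))⁻¹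
  let Y : (Fin N → ℂ) → Op N := fun ξ => ∑ n, c n • transfer η (twist 0 K₂) ξ (ξ n)
  let Z : ℂ → Op N := fun ε => ∑ n, c n • siteTransfer (ε * η) (twist 0 K₂) ζ n
  have hYZ : ∀ ε, ε ≠ 0 → Y (fun n => ε⁻¹ * ζ n) = (η * ε * ε⁻¹ ^ N) • Z ε := by
    intro ε hε
    simp only [Y, Z, transfer_inv_mul η K₂ ζ _ hε, Finset.smul_sum, smul_comm (c _)]
  have hZ0 : HasSimpleSpectrum (Z 0) := by
    refine ⟨fun σ => ∑ n, γ n * κ (σ n), productVec φ, hγ, fun σ =>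
      ⟨productVec_ne_zero (fun a => (hφ a).1) σ, ?_⟩⟩
    simp only [Z, zero_mul, Matrix.sum_mulVec, Matrix.smul_mulVec,
      siteTransfer_zero_mulVec K₂ ζ _ fun a => (hφ a).2, smul_smul, ← Finset.sum_smul]
    congr 1
    refine Finset.sum_congr rfl fun n _ => ?_
    simp only [c]
    field_simp [hζ n]
  obtain ⟨D, hD⟩ := exists_discriminant (Fin N → Fin 3)
  have hZc : Continuous Z := continuous_finsetSum _ fun n _ =>
    ((continuous_siteTransfer _ ζ n).comp (continuous_id.mul continuous_const)).const_smul (c n)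
  have hev : ∀ᶠ ε in 𝓝[≠] (0 : ℂ), HasSimpleSpectrum (Z ε) := by
    have hc : Continuous fun ε => MvPolynomial.eval (fun p => Z ε p.1 p.2) D :=
      (MvPolynomial.continuous_eval D).comp (continuous_pi fun p => hZc.matrix_elem p.1 p.2)
    filter_upwards [(hc.continuousAt.eventually_ne ((hD (Z 0)).mpr hZ0)).filter_mono
      nhdsWithin_le_nhds] with ε hε
    exact (hD _).mp hε
  obtain ⟨ε, hε, hε0⟩ := (hev.and self_mem_nhdsWithin).exists
  have hε0 : ε ≠ 0 := hε0
  obtain ⟨P, hP⟩ := MvPolynomial.IsPolyFun.comp_eval (σ := Fin N) D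
    (g := fun p ξ => Y ξ p.1 p.2) fun p => by
      simp only [Y, Matrix.sum_apply, Matrix.smul_apply, smul_eq_mul]
      exact .sum _ fun n _ => (MvPolynomial.IsPolyFun.const _).mul (isPolyFun_transfer η K₂ n _ _)
  refine ⟨P, ?_, fun ξ hξ => ?_⟩
  -- The discriminant of `Y` is nonzero at the configuration `ε⁻¹ • ζ`, where `Y` is a nonzero
  -- multiple of `Z ε`.
  · rintro rfl
    have h1 : HasSimpleSpectrum (Y fun n => ε⁻¹ * ζ n) := by
      rw [hYZ ε hε0]
      exact hε.smul (mul_ne_zero (mul_ne_zero hη hε0) (pow_ne_zero _ (inv_ne_zero hε0)))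
    have h2 := (hD _).mpr h1
    exact h2 ((hP _).trans (map_zero _))
  · rw [← hP, hD] at hξ
    obtain ⟨y, v, hy, hv⟩ := hξ
    have hcomm : ∀ x, Y ξ * transfer η (twist 0 K₂) ξ x = transfer η (twist 0 K₂) ξ x * Y ξ := by
      intro x
      simp only [Y, Finset.sum_mul, Finset.mul_sum, Matrix.smul_mul, Matrix.mul_smul,
        transfer_twist_mul_comm η K₂ ξ _ x]
    choose t ht using fun σ x => mulVec_eq_smul_of_commute (hcomm x) hy hv σ
    refine ⟨t, fun σ τ h => hy ?_, fun σ => ⟨v σ, (hv σ).1, ht σ⟩⟩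
    -- The eigenvalue of `Y ξ` is a combination of values of `t σ`, so distinct eigenvalues of `Y ξ`
    -- force distinct functions `t σ`.
    have hyt : ∀ σ, y σ = ∑ n, c n * t σ (ξ n) := by
      intro σ
      have h1 := (hv σ).2
      simp only [Y, Matrix.sum_mulVec, Matrix.smul_mulVec, ht, smul_smul, ← Finset.sum_smul] at h1
      exact (smul_left_injective ℂ (hv σ).1 h1).symm
    rw [hyt, hyt, h]

end GL12

namespace GL12

open Matrix Polynomial Lagrange

/-! ### Fusion solutions and Bethe solutions -/

variable {N : ℕ} {η k₂ k₃ : ℂ} {ξ : Fin N → ℂ} {A : Finset (Fin N)}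

theorem eval_nodal_id (s : Finset ℂ) (x : ℂ) : (nodal s id).eval x = qFun s x := by
  rw [eval_nodal]
  rfl

theorem qFun_image (h : Function.Injective ξ) (A : Finset (Fin N)) (x : ℂ) :
    qFun (A.image ξ) x = (nodal A ξ).eval x := by
  rw [qFun, Finset.prod_image h.injOn, eval_nodal]

theorem dFun_eq_mul (ξ : Fin N → ℂ) (A : Finset (Fin N)) (x : ℂ) :
    dFun ξ x = (nodal A ξ).eval x * (nodal Aᶜ ξ).eval x := by
  rw [eval_nodal, eval_nodal, Finset.prod_mul_prod_compl]
  rfl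

theorem qFun_eq_zero_iff {s : Finset ℂ} {x : ℂ} : qFun s x = 0 ↔ x ∈ s := by
  rw [qFun, Finset.prod_eq_zero_iff]
  constructor
  · rintro ⟨r, hr, h⟩
    rwa [sub_eq_zero.mp h]
  · exact fun h => ⟨x, h, sub_self x⟩

theorem dFun_eq_zero_iff {x : ℂ} : dFun ξ x = 0 ↔ x ∈ Set.range ξ := by
  rw [dFun, Finset.prod_eq_zero_iff]
  simp [sub_eq_zero, eq_comm]

theorem IsBaxterPair.hasBetheForm (hξ : Function.Injective ξ) {Λ : ℂ[X]} {Μ : Finset ℂ}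
    (h : IsBaxterPair η k₂ k₃ ξ A Λ (nodal Μ id)) :
    HasBetheForm η 0 k₂ k₃ ξ (A.image ξ) Μ fun x => -((nodal Aᶜ ξ).eval x * Λ.eval x) := by
  intro x h1 h2
  have hx := h x
  simp only [eval_nodal_id] at hx
  rw [dFun_eq_mul ξ A]
  simp only [qFun_image hξ] at h1 ⊢
  field_simp
  linear_combination -((nodal Aᶜ ξ).eval x * (nodal A ξ).eval x) * hx

/-- The Bethe form fixes a function only off the finitely many roots; continuity supplies the
remaining values. -/
theorem HasBetheForm.ext {Λ Μ : Finset ℂ} {t t' : ℂ → ℂ} (ht : Continuous t) (ht' : Continuous t')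
    (h : HasBetheForm η 0 k₂ k₃ ξ Λ Μ t) (h' : HasBetheForm η 0 k₂ k₃ ξ Λ Μ t') : t = t' := by
  have hd : Dense ((Λ ∪ Μ : Finset ℂ) : Set ℂ)ᶜ :=
    (Finset.countable_toSet _).dense_compl ℂ
  refine Continuous.ext_on hd ht ht' fun x hx => ?_
  have hx' : x ∉ Λ ∧ x ∉ Μ := by simpa using hx
  have h1 := qFun_eq_zero_iff.not.mpr hx'.1
  have h2 := qFun_eq_zero_iff.not.mpr hx'.2
  rw [h x h1 h2, h' x h1 h2]

/-- Bethe solutions come from fusion solutions. -/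
theorem IsBetheSolution.exists_fusionSolution (hs : IsSeparated η ξ) (hη : η ≠ 0) (hk₂ : k₂ ≠ 0)
    (hk₃ : k₃ ≠ 0) {S Μ : Finset ℂ} (h : IsBetheSolution η 0 k₂ k₃ ξ S Μ) :
    ∃ (A : Finset (Fin N)) (Λ : ℂ[X]), S = A.image ξ ∧ IsFusionSolution η k₂ k₃ ξ A Λ ∧
      IsBaxterPair η k₂ k₃ ξ A Λ (nodal Μ id) := by
  have hrange : ∀ l ∈ S, l ∈ Set.range ξ := by
    intro l hl
    have h1 := h.eq_one l hl
    rw [zero_mul, zero_mul, zero_eq_mul, mul_eq_zero, or_assoc] at h1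
    rcases h1 with h1 | h1 | h1
    · exact absurd h1 hk₂
    · exact dFun_eq_zero_iff.mp h1
    · rw [qFun_eq_zero_iff] at h1
      -- If `l + η` is a root of `Q₂`, the second Bethe equation there reduces to `k₃ Q₂(l) Q₁(l +
      -- η) = 0`, and either zero would be common to the two sets of roots.
      have h2 := h.eq_two _ h1
      rw [add_sub_cancel_right, qFun_eq_zero_iff.mpr hl, mul_zero, zero_eq_mul, mul_eq_zero,
        neg_eq_zero, qFun_eq_zero_iff, qFun_eq_zero_iff] at h2
      rcases h2 with (h2 | h2) | h2
      · exact absurd h2 hk₃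
      · exact absurd h2 (Finset.disjoint_left.mp h.disjoint hl)
      · exact absurd h1 (Finset.disjoint_left.mp h.disjoint h2)
  obtain ⟨A, rfl⟩ : ∃ A : Finset (Fin N), S = A.image ξ := by
    obtain ⟨A, -, hA⟩ := Finset.subset_set_image_iff.mp
      (show (S : Set ℂ) ⊆ ξ '' Set.univ by rwa [Set.image_univ])
    exact ⟨A, hA.symm⟩
  obtain ⟨Λ, hΛ, hB⟩ := GL12.exists_fusionSolution hs hη hk₃ Μ (A := A) (k₂ := k₂)
    (fun m hm => by
      have h2 := h.eq_two m hm
      simp only [qFun_image hs.inj] at h2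
      simp only [eval_nodal_id]
      linear_combination h2)
    (fun n hn => Finset.disjoint_left.mp h.disjoint (Finset.mem_image_of_mem ξ hn))
  exact ⟨A, Λ, rfl, hΛ, hB⟩

theorem IsBaxterPair.isBetheSolution (hξ : Function.Injective ξ) {Λ : ℂ[X]} {Μ : Finset ℂ}
    (h : IsBaxterPair η k₂ k₃ ξ A Λ (nodal Μ id)) (hne : ∀ m ∈ Μ, ∀ n, m ≠ ξ n) :
    IsBetheSolution η 0 k₂ k₃ ξ (A.image ξ) Μ where
  disjoint := by
    rw [Finset.disjoint_right]
    intro m hm hA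
    obtain ⟨n, -, hn⟩ := Finset.mem_image.mp hA
    exact hne m hm n hn.symm
  eq_one := by
    intro l hl
    obtain ⟨n, -, rfl⟩ := Finset.mem_image.mp hl
    rw [dFun_eq_zero_iff.mpr ⟨n, rfl⟩]
    ring
  eq_two := by
    intro m hm
    have hx := h m
    simp only [eval_nodal_id, qFun_eq_zero_iff.mpr hm, mul_zero] at hx
    simp only [qFun_image hξ]
    linear_combination -hx

/-- The eigenvalue determines the set of odd sites and the fusion solution. -/
theorem IsFusionSolution.ext (hs : IsSeparated η ξ) (hη : η ≠ 0) (hk₂ : k₂ ≠ 0) (hk₃ : k₃ ≠ 0)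
    {A' : Finset (Fin N)} {Λ Λ' : ℂ[X]} (h : IsFusionSolution η k₂ k₃ ξ A Λ)
    (h' : IsFusionSolution η k₂ k₃ ξ A' Λ')
    (heq : ∀ x, (nodal Aᶜ ξ).eval x * Λ.eval x = (nodal A'ᶜ ξ).eval x * Λ'.eval x) :
    A = A' ∧ Λ = Λ' := by
  -- `A` is read off from the eigenvalue as the set of sites where it does not vanish at `ξ n`.
  have key : ∀ {A : Finset (Fin N)} {Λ : ℂ[X]}, IsFusionSolution η k₂ k₃ ξ A Λ → ∀ n,
      n ∈ A ↔ (nodal Aᶜ ξ).eval (ξ n) * Λ.eval (ξ n) ≠ 0 := by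
    intro A Λ h n
    have hn : (nodal Aᶜ ξ).eval (ξ n) = 0 ↔ n ∉ A := by
      rw [eval_nodal, Finset.prod_eq_zero_iff]
      constructor
      · rintro ⟨m, hm, h0⟩
        rw [hs.inj (sub_eq_zero.mp h0)]
        exact Finset.mem_compl.mp hm
      · exact fun hn => ⟨n, Finset.mem_compl.mpr hn, sub_self _⟩
    constructor
    · exact fun hA => mul_ne_zero (fun h0 => hn.mp h0 hA) (h.eval_ne_zero hs hη hk₂ hk₃ hA)
    · intro h0
      by_contra hA
      rw [hn.mpr hA, zero_mul] at h0
      exact h0 rfl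
  obtain rfl : A = A' := by
    ext n
    rw [key h, key h', heq]
  refine ⟨rfl, mul_left_cancel₀ (nodal_ne_zero (s := Aᶜ) (v := ξ)) (Polynomial.funext fun x => ?_)⟩
  rw [eval_mul, eval_mul, heq]

/-- If every monic Baxter polynomial of bounded degree has simple roots away from the
inhomogeneities, then a fusion solution has a Baxter polynomial of that form. -/
theorem IsFusionSolution.exists_nodal_baxterPair {Λ : ℂ[X]} (h : IsFusionSolution η k₂ k₃ ξ A Λ)
    (hs : IsSeparated η ξ) (hη : η ≠ 0) (hk₂ : k₂ ≠ 0) (hk₃ : k₃ ≠ 0)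
    (hroots : ∀ Q : ℂ[X], IsFusionSolution η k₂ k₃ ξ A Λ → Q.Monic → Q.natDegree ≤ A.card →
      IsBaxterPair η k₂ k₃ ξ A Λ Q →
      ∃ Μ : Finset ℂ, Q = nodal Μ id ∧ ∀ m ∈ Μ, ∀ n, m ≠ ξ n ∧ m ≠ ξ n + η) :
    ∃ Μ : Finset ℂ, IsBaxterPair η k₂ k₃ ξ A Λ (nodal Μ id) ∧
      ∀ m ∈ Μ, ∀ n, m ≠ ξ n ∧ m ≠ ξ n + η := by
  obtain ⟨Q, hQ0, hQd, hQ⟩ := h.exists_baxterPair hs hη hk₂ hk₃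
  have hB : IsBaxterPair η k₂ k₃ ξ A Λ (C Q.leadingCoeff⁻¹ * Q) := by
    intro x
    simp only [eval_mul, eval_C]
    linear_combination Q.leadingCoeff⁻¹ * hQ x
  have hm : (C Q.leadingCoeff⁻¹ * Q).Monic :=
    monic_C_mul_of_mul_leadingCoeff_eq_one (inv_mul_cancel₀ (leadingCoeff_ne_zero.mpr hQ0))
  obtain ⟨Μ, hΜ, hne⟩ := hroots _ h hm ((natDegree_C_mul_le _ _).trans hQd) hB
  exact ⟨Μ, hΜ ▸ hB, hne⟩

/-- There are at most `3 ^ N` fusion solutions. -/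
theorem card_sigma_fusionSolution_le (hs : IsSeparated η ξ)
    (S : Finset (Finset (Fin N) × ℂ[X])) (hS : ∀ p ∈ S, IsFusionSolution η k₂ k₃ ξ p.1 p.2) :
    S.card ≤ 3 ^ N := by
  classical
  rw [Finset.card_eq_sum_card_fiberwise (f := Prod.fst) (t := Finset.univ) (by simp [Set.MapsTo])]
  calc ∑ A, (S.filter fun p => p.1 = A).card ≤ ∑ A : Finset (Fin N), 2 ^ A.card := by
        refine Finset.sum_le_sum fun A _ => ?_
        rw [← Finset.card_image_of_injOn (f := Prod.snd)]
        · refine card_fusionSolution_le (A := A) (k₂ := k₂) (k₃ := k₃) hs _ fun Λ hΛ => ?_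
          obtain ⟨p, hp, rfl⟩ := Finset.mem_image.mp hΛ
          obtain ⟨hpS, rfl⟩ := Finset.mem_filter.mp hp
          exact hS p hpS
        · intro p hp q hq hpq
          have h1 := (Finset.mem_filter.mp hp).2
          have h2 := (Finset.mem_filter.mp hq).2
          exact Prod.ext (h1.trans h2.symm) hpq
    _ = 3 ^ N := by
        have := Fintype.sum_pow_mul_eq_add_pow (Fin N) (2 : ℕ) 1
        simpa using this

/-- If the transfer matrix has simple spectrum, then every fusion solution gives an eigenvalue. -/
theorem IsFusionSolution.isTransferEigenvalue (hs : IsSeparated η ξ) (hη : η ≠ 0)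
    {K₂ : Matrix (Fin 2) (Fin 2) ℂ} (hdet : K₂.det = k₂ * k₃) (htr : K₂.trace = k₂ + k₃)
    {t : (Fin N → Fin 3) → ℂ → ℂ} (ht : Function.Injective t)
    (htT : ∀ σ, IsTransferEigenvalue η (twist 0 K₂) ξ (t σ)) {Λ : ℂ[X]}
    (h : IsFusionSolution η k₂ k₃ ξ A Λ) :
    IsTransferEigenvalue η (twist 0 K₂) ξ fun x => -((nodal Aᶜ ξ).eval x * Λ.eval x) := by
  classical
  choose B Θ hΘ htΘ using fun σ => (htT σ).exists_fusionSolution hη hdet htr hs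
  let p (σ : Fin N → Fin 3) : Finset (Fin N) × ℂ[X] := (B σ, Θ σ)
  have hp : Function.Injective p := by
    intro σ τ hστ
    have h1 : B σ = B τ := congrArg Prod.fst hστ
    have h2 : Θ σ = Θ τ := congrArg Prod.snd hστ
    refine ht (funext fun x => ?_)
    rw [htΘ, htΘ, h1, h2]
  by_cases hmem : (A, Λ) ∈ Finset.univ.image p
  · obtain ⟨σ, -, hσ⟩ := Finset.mem_image.mp hmem
    have h1 : B σ = A := congrArg Prod.fst hσ
    have h2 : Θ σ = Λ := congrArg Prod.snd hσ
    have h3 := htT σ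
    rwa [funext (htΘ σ), h1, h2] at h3
  -- The `3 ^ N` distinct eigenvalues already give `3 ^ N` pairs, so a further pair would exceed the
  -- bound.
  · have hcard := card_sigma_fusionSolution_le (k₂ := k₂) (k₃ := k₃) hs
      (insert (A, Λ) (Finset.univ.image p)) (by
        intro q hq
        rcases Finset.mem_insert.mp hq with rfl | hq
        · exact h
        · obtain ⟨σ, -, rfl⟩ := Finset.mem_image.mp hq
          exact hΘ σ)
    rw [Finset.card_insert_of_notMem hmem, Finset.card_image_of_injective _ hp] at hcard
    simp at hcard

end GL12

/-! ### The correspondence between eigenvalues and Bethe solutions -/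

theorem corollary3p1 (N : ℕ) (η k₂ k₃ : ℂ) (hη : η ≠ 0) (hk₂ : k₂ ≠ 0) (hk₃ : k₃ ≠ 0)
    (hk : k₂ ≠ k₃) (K₂ : Matrix (Fin 2) (Fin 2) ℂ)
    (hK₂ : ∃ W : Matrix (Fin 2) (Fin 2) ℂ, IsUnit W ∧
      K₂ = W * Matrix.diagonal ![k₂, k₃] * W⁻¹) :
    ∃ P : MvPolynomial (Fin N) ℂ, P ≠ 0 ∧ ∀ ξ : Fin N → ℂ, MvPolynomial.eval ξ P ≠ 0 →
      ∀ t₁ : ℂ → ℂ, Differentiable ℂ t₁ →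
        ((GL12.IsTransferEigenvalue η (GL12.twist 0 K₂) ξ t₁ ↔
          ∃ Λ Μ : Finset ℂ, GL12.IsBetheSolution η 0 k₂ k₃ ξ Λ Μ ∧
            GL12.HasBetheForm η 0 k₂ k₃ ξ Λ Μ t₁) ∧
        (GL12.IsTransferEigenvalue η (GL12.twist 0 K₂) ξ t₁ →
          ∃ Λ Μ : Finset ℂ, GL12.IsBetheSolution η 0 k₂ k₃ ξ Λ Μ ∧
            GL12.HasBetheForm η 0 k₂ k₃ ξ Λ Μ t₁ ∧
            GL12.IsAdmissible η ξ Λ Μ ∧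
            ∀ Λ' Μ' : Finset ℂ, GL12.IsBetheSolution η 0 k₂ k₃ ξ Λ' Μ' →
              GL12.HasBetheForm η 0 k₂ k₃ ξ Λ' Μ' t₁ → Λ' = Λ ∧ Μ' = Μ)) := by
  obtain ⟨W, hW, hKW⟩ := hK₂
  have hWd : IsUnit W.det := (Matrix.isUnit_iff_isUnit_det W).mp hW
  have hdet : K₂.det = k₂ * k₃ := by
    rw [hKW, Matrix.det_mul_right_comm, Matrix.mul_nonsing_inv W hWd, one_mul, Matrix.det_diagonal]
    simp
  have htr : K₂.trace = k₂ + k₃ := by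
    rw [hKW, Matrix.trace_mul_comm, ← Matrix.mul_assoc, Matrix.nonsing_inv_mul W hWd, one_mul,
      Matrix.trace_diagonal]
    simp
  obtain ⟨P₁, hP₁, hsep⟩ := GL12.exists_polynomial_isSeparated (ι := Fin N) η
  obtain ⟨P₂, hP₂, hroots⟩ := GL12.exists_polynomial_roots_simple (ι := Fin N) hη hk₂ hk₃ hk
  obtain ⟨P₃, hP₃, hspec⟩ := GL12.exists_polynomial_isTransferEigenvalue N hη
    (GL12.hasSimpleSpectrum_twist hk₂ hk₃ hk hW hKW)
  -- The three factors ensure separated sites, simple roots away from the forbidden points, and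
  -- simple spectrum.
  refine ⟨P₁ * P₂ * P₃, mul_ne_zero (mul_ne_zero hP₁ hP₂) hP₃, fun ξ hξ t₁ ht₁ => ?_⟩
  rw [map_mul, map_mul, mul_ne_zero_iff, mul_ne_zero_iff] at hξ
  have hs := hsep ξ hξ.1.1
  replace hroots := hroots ξ hξ.1.2
  obtain ⟨t, ht, htT⟩ := hspec ξ hξ.2
  have hcont : ∀ (A : Finset (Fin N)) (Λ : Polynomial ℂ),
      Continuous fun x => -((Lagrange.nodal Aᶜ ξ).eval x * Λ.eval x) := fun A Λ => by fun_prop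
  have hback : ∀ S Μ : Finset ℂ, GL12.IsBetheSolution η 0 k₂ k₃ ξ S Μ →
      GL12.HasBetheForm η 0 k₂ k₃ ξ S Μ t₁ → ∃ (A : Finset (Fin N)) (Λ : Polynomial ℂ),
        S = A.image ξ ∧ GL12.IsFusionSolution η k₂ k₃ ξ A Λ ∧
        GL12.IsBaxterPair η k₂ k₃ ξ A Λ (Lagrange.nodal Μ id) ∧
        t₁ = fun x => -((Lagrange.nodal Aᶜ ξ).eval x * Λ.eval x) := by
    intro S Μ hB hF
    obtain ⟨A, Λ, rfl, hΛ, hQ⟩ := hB.exists_fusionSolution hs hη hk₂ hk₃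
    exact ⟨A, Λ, rfl, hΛ, hQ, hF.ext ht₁.continuous (hcont A Λ) (hQ.hasBetheForm hs.inj)⟩
  have hfwd : GL12.IsTransferEigenvalue η (GL12.twist 0 K₂) ξ t₁ →
      ∃ Λ Μ : Finset ℂ, GL12.IsBetheSolution η 0 k₂ k₃ ξ Λ Μ ∧
        GL12.HasBetheForm η 0 k₂ k₃ ξ Λ Μ t₁ ∧ GL12.IsAdmissible η ξ Λ Μ ∧
        ∀ Λ' Μ' : Finset ℂ, GL12.IsBetheSolution η 0 k₂ k₃ ξ Λ' Μ' →
          GL12.HasBetheForm η 0 k₂ k₃ ξ Λ' Μ' t₁ → Λ' = Λ ∧ Μ' = Μ := by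
    intro hT
    obtain ⟨A, Λ, hΛ, hΛt⟩ := hT.exists_fusionSolution hη hdet htr hs
    obtain ⟨Μ, hQ, hne⟩ := hΛ.exists_nodal_baxterPair hs hη hk₂ hk₃ (hroots A Λ)
    refine ⟨A.image ξ, Μ, hQ.isBetheSolution hs.inj fun m hm n => (hne m hm n).1, ?_, ⟨?_, ?_⟩, ?_⟩
    · rw [funext hΛt]
      exact hQ.hasBetheForm hs.inj
    · simp
    · rw [Set.eq_empty_iff_forall_notMem]
      rintro m ⟨hm, ⟨n, rfl⟩ | ⟨n, rfl⟩⟩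
      · exact (hne _ hm n).1 rfl
      · exact (hne _ hm n).2 rfl
    · intro S Μ' hB hF
      obtain ⟨A', Λ', rfl, hΛ', hQ', ht'⟩ := hback S Μ' hB hF
      obtain ⟨rfl, rfl⟩ := hΛ'.ext hs hη hk₂ hk₃ hΛ fun x => by
        have h1 := hΛt x
        rw [ht'] at h1
        exact neg_injective h1
      refine ⟨rfl, ?_⟩
      have h1 := hQ.eq_of_monic hη hk (Lagrange.nodal_monic) (Lagrange.nodal_monic) hQ'
      ext m
      rw [← GL12.qFun_eq_zero_iff, ← GL12.qFun_eq_zero_iff, ← GL12.eval_nodal_id,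
        ← GL12.eval_nodal_id, h1]
  refine ⟨⟨fun hT => ?_, ?_⟩, hfwd⟩
  · obtain ⟨S, Μ, hB, hF, -⟩ := hfwd hT
    exact ⟨S, Μ, hB, hF⟩
  · rintro ⟨S, Μ, hB, hF⟩
    obtain ⟨A, Λ, -, hΛ, -, rfl⟩ := hback S Μ hB hF
    exact hΛ.isTransferEigenvalue hs hη hdet htr ht htT
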